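/- Intersection graphs. Let $p,q,\Delta\ge 1$. Let $T$ be an oriented torus, let $\partial_1P,\dots,\partial_pP$ be parallel circles on $T$ of slope $\alpha$, and $\partial_1Q,\dots,\partial_qQ$ parallel circles of slope $\beta$, numbered in the order in which they appear on $T$, where $\Delta=\Delta(\alpha,\beta)$ and each $\partial_iP$ meets each $\partial_jQ$ transversely in exactly $\Delta$ points. A pair of intersection graphs in the 2-spheres $\widehat P,\widehat Q$ consists of a graph $G_P\subset\widehat P$ with $p$ signed fat (disk) vertices $1,\dots,p$ and a graph $G_Q\subset\widehat Q$ with $q$ signed fat vertices $1,\dots,q$, such that: * the edge-endpoints of $G_P$ at its vertex $i$ are the intersection points on $\partial_iP$, a point of $\partial_iP\cap\partial_jQ$ having the label $j$; they are placed around the vertex in their order along $\partial_iP$, in which the labels read $1,\dots,q$ repeated $\Delta$ times, anticlockwise if the vertex is positive and clockwise if it is negative. Likewise the edge-endpoints of $G_Q$ at its vertex $j$ are the intersection points on $\partial_jQ$, with labels $1,\dots,p$ repeated $\Delta$ times; * $G_P$ and $G_Q$ have the same edges: two intersection points are joined by an edge in $G_P$ if and only if they are joined by an edge in $G_Q$;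 * (parity rule) an edge joins vertices of the same sign in $G_P$ if and only if it joins vertices of opposite signs in $G_Q$; * neither graph contains a trivial loop, that is, a loop which together with an arc of the boundary of its fat vertex bounds a disk containing no vertex. Neither graph is assumed to be connected. Such a pair arises from the arcs of $P\cap Q$ whenever $M$ is a compact orientable 3-manifold with boundary torus $T$, $\widehat P\subset M(\alpha)$ and $\widehat Q\subset M(\beta)$ are 2-spheres in the Dehn fillings of $M$ which meet the filling solid tori in $p\ge1$, respectively $q\ge1$, meridian disks, and the properly embedded surfaces $P=\widehat P\cap M$ and $Q=\widehat Q\cap M$ meet transversely, with each component of $\partial P$ meeting each component of $\partial Q$ in exactly $\Delta(\alpha,\beta)$ points, and with every arc of $P\cap Q$ essential in $P$ and in $Q$. Types. The boundary of a disk face of $G_P$ alternates between edges and corners; each corner is an arc of the boundary of a vertex between consecutive labels $j,j+1$ (taken modulo $q$), i.e. a $\mathbf q$-interval $(j,j+1)$. For a disk face $D$ of $G_P$ let $[D]\in\mathbb Z^q$ be the sum of its corners, as $\mathbf q$-intervals, each counted with the sign of its vertex. The face $D$ represents a $q$-type $\tau=(\varepsilon_1,\dots,\varepsilon_q)\in\{\pm1\}^q$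 if (1) for some $\eta=\pm1$ one has $\operatorname{sign}[D]_j=\eta\varepsilon_j$ for all $j$ with $[D]_j\ne0$, and $\sum_j|[D]_j|\ge2$; and (2) no $\mathbf q$-interval occurs as a corner of $D$ at two vertices of opposite sign. The graph $G_P$ represents all types if there is a set of disk faces of $G_P$ such that every $q$-type is represented by some member of it. A Scharlemann cycle in $G_Q$ is a disk face of $G_Q$ all of whose vertices have the same sign and all of whose corners are the same $\mathbf p$-interval $(i,i+1)$. Theorem 6.3. Let $G_P,G_Q$ be a pair of intersection graphs as above, with $\widehat P$ and $\widehat Q$ 2-spheres and $\Delta\ge1$. Then either $G_P$ represents all types or $G_Q$ contains a Scharlemann cycle. -/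

import Mathlib

namespace DehnGraphs

/-! ### The intersection points on the boundary torus

Two slopes `α`, `β` on the torus `∂M` meet in `Δ` points.  The circles
`∂_i P` (`i : ZMod p`, slope `α`) and `∂_j Q` (`j : ZMod q`, slope `β`), numbered in the order in
which they appear on the torus, cut it into a quadrangular grid with `p * q * Δ` nodes, which are
the points of `∂P ∩ ∂Q`.  Labels `1, …, p` and `1, …, q` are read as residue classes, so that
successive labels (cyclically) are `i` and `i + 1`. -/

/-- The points of `∂P ∩ ∂Q`: the triple `(i, j, k)` is the `k`-th of the `Δ` points of
`∂_i P ∩ ∂_j Q`. -/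
abbrev BdryPoint (p q Δ : ℕ) : Type := ZMod p × ZMod q × ZMod Δ

/-- Move along the circle `∂_i P`, in its positive direction on the torus, to the next point of
`∂Q`.  One meets `∂Q` in the labels `1, …, q, 1, …, q, …`, and after each round of labels
(that is, each time label `q` is followed by label `1`) the counter `k` goes up by one. -/
def alongP (p q Δ : ℕ) : Equiv.Perm (BdryPoint p q Δ) where
  toFun x := (x.1, x.2.1 + 1, if x.2.1 + 1 = 0 then x.2.2 + 1 else x.2.2)
  invFun x := (x.1, x.2.1 - 1, if x.2.1 = 0 then x.2.2 - 1 else x.2.2)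
  left_inv := by
    rintro ⟨i, j, k⟩
    by_cases h : j + 1 = 0
    · simp only [h, if_true, zero_sub, add_sub_cancel_right]
      exact Prod.ext rfl (Prod.ext (neg_eq_of_add_eq_zero_left h) rfl)
    · simp [h]
  right_inv := by
    rintro ⟨i, j, k⟩
    by_cases h : j = 0 <;> simp [h]

/-- Move along the circle `∂_j Q`, in its positive direction on the torus, to the next point of
`∂P`.  After each round of the labels `1, …, p` the counter `k` changes by the unit `u` of
`ℤ/Δ`.  This unit is determined by the pair of slopes: if `α = (1, 0)` and `β = (b, Δ)` in a basis
of `H₁` of the torus, with `b` prime to `Δ`, it is the class of `b`. -/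
def alongQ (p q : ℕ) {Δ : ℕ} (u : (ZMod Δ)ˣ) : Equiv.Perm (BdryPoint p q Δ) where
  toFun x := (x.1 + 1, x.2.1, if x.1 + 1 = 0 then x.2.2 + u else x.2.2)
  invFun x := (x.1 - 1, x.2.1, if x.1 = 0 then x.2.2 - u else x.2.2)
  left_inv := by
    rintro ⟨i, j, k⟩
    by_cases h : i + 1 = 0
    · simp only [h, if_true, zero_sub, add_sub_cancel_right]
      exact Prod.ext (neg_eq_of_add_eq_zero_left h) rfl
    · simp [h]
  right_inv := by
    rintro ⟨i, j, k⟩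
    by_cases h : i = 0 <;> simp [h]

variable {p q Δ : ℕ}

/-- The anticlockwise successor of an edge-endpoint around its fat vertex of `G_P`: at a positive
vertex the positive direction of `∂_i P` on the torus is anticlockwise, at a negative vertex it is
clockwise. -/
def rotP (signP : ZMod p → ℤˣ) : Equiv.Perm (BdryPoint p q Δ) where
  toFun x := if signP x.1 = 1 then alongP p q Δ x else (alongP p q Δ).symm x
  invFun x := if signP x.1 = 1 then (alongP p q Δ).symm x else alongP p q Δ x
  left_inv := by
    intro x
    by_cases h : signP x.1 = 1
    · have h' : signP ((alongP p q Δ) x).1 = 1 := h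
      simp [h, h']
    · have h' : ¬ signP ((alongP p q Δ).symm x).1 = 1 := h
      simp [h, h']
  right_inv := by
    intro x
    by_cases h : signP x.1 = 1
    · have h' : signP ((alongP p q Δ).symm x).1 = 1 := h
      simp [h, h']
    · have h' : ¬ signP ((alongP p q Δ) x).1 = 1 := h
      simp [h, h']

/-- The anticlockwise successor of an edge-endpoint around its fat vertex of `G_Q`. -/
def rotQ (u : (ZMod Δ)ˣ) (signQ : ZMod q → ℤˣ) : Equiv.Perm (BdryPoint p q Δ) where
  toFun x := if signQ x.2.1 = 1 then alongQ p q u x else (alongQ p q u).symm x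
  invFun x := if signQ x.2.1 = 1 then (alongQ p q u).symm x else alongQ p q u x
  left_inv := by
    intro x
    by_cases h : signQ x.2.1 = 1
    · have h' : signQ ((alongQ p q u) x).2.1 = 1 := h
      simp [h, h']
    · have h' : ¬ signQ ((alongQ p q u).symm x).2.1 = 1 := h
      simp [h, h']
  right_inv := by
    intro x
    by_cases h : signQ x.2.1 = 1
    · have h' : signQ ((alongQ p q u).symm x).2.1 = 1 := h
      simp [h, h']
    · have h' : ¬ signQ ((alongQ p q u) x).2.1 = 1 := h
      simp [h, h']

/-! ### Graphs with fat vertices in the 2-sphere -/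

/-- The number of cycles (fixed points included) of a permutation. -/
noncomputable def numCycles {X : Type} (σ : Equiv.Perm X) : ℕ :=
  Nat.card (Quotient (Equiv.Perm.SameCycle.setoid σ))

/-- An embedding in the 2-sphere of the finite graph without isolated vertices (not necessarily
connected) whose set of edge-endpoints is `X`, whose fat vertices are the cycles of `rot` (the
anticlockwise order around the vertex), and whose edges are the cycles of the involution `arc`.

The corner of a vertex that lies between the successive endpoints `x` and `rot x` is denoted by
`x`.  A component of the boundary of a face is an alternating cyclic sequence of corners and
edges: corner `x` is followed by the edge with endpoint `rot x`, and this by the corner that starts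
at the other endpoint `arc (rot x)` of that edge.  So the boundary components of the faces
are the cycles of `arc * rot` (first `rot`, then `arc`), and a face is a set of corners which is a
union of one or more such cycles.

Gluing the faces, a face with `b` boundary components being a sphere with `b` holes, of Euler
characteristic `2 - b`, to the fat graph gives a closed oriented surface.  It is a sphere if and
only if it is connected and has Euler characteristic `2`. -/
structure SphereGraph {X : Type} (rot arc : Equiv.Perm X) where
  /-- The relation "to be corners of the same face". -/
  sameFace : Setoid X
  /-- Successive corners along the boundary belong to the same face. -/
  boundary : ∀ x, sameFace x (arc (rot x))
  /-- The surface is connected. -/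
  connected : sameFace ⊔ Equiv.Perm.SameCycle.setoid rot ⊔ Equiv.Perm.SameCycle.setoid arc = ⊤
  /-- `V - E + ∑ (2 - b) = 2`, the sum being over all faces. -/
  euler : (numCycles rot : ℤ) - numCycles arc
    + (2 * Nat.card (Quotient sameFace) - numCycles (arc * rot)) = 2

namespace SphereGraph

variable {X : Type} {rot arc : Equiv.Perm X} (G : SphereGraph rot arc)

/-- The faces of an embedded graph. -/
def Face : Type := Quotient G.sameFace

variable {G}

/-- The set of corners of a face. -/
def Face.corners (D : G.Face) : Set X := {x | Quotient.mk G.sameFace x = D}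

/-- A disk face: a face with exactly one boundary component. -/
def Face.IsDisk (D : G.Face) : Prop :=
  ∀ x ∈ D.corners, ∀ y ∈ D.corners, (arc * rot).SameCycle x y

/-- There are no trivial loops.  A trivial loop together with an arc of the boundary of its
fat vertex bounds a disk without vertices, and an innermost edge in this disk bounds a disk face
with a single corner (and a single edge); conversely the edge of such a face is a trivial loop. -/
def NoTrivialLoop (G : SphereGraph rot arc) : Prop :=
  ∀ D : G.Face, D.IsDisk → D.corners.ncard ≠ 1

end SphereGraph

/-! ### Pairs of intersection graphs -/

/-- The pair of labelled graphs `G_P`, `G_Q` in 2-spheres `P̂`, `Q̂` that is given by the arcs of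
`P ∩ Q`, where `P` and `Q` are the corresponding punctured spheres with `p` and `q` boundary
components, in an oriented 3-manifold with boundary torus, whose slopes `α`, `β` have intersection
number `Δ`.  The fat vertices of `G_P` (of `G_Q`) are the `i : ZMod p` (the `j : ZMod q`),
and an edge-endpoint `(i, j, k)` lies at the vertex `i` of `G_P`, where its label is `j`, and at the
vertex `j` of `G_Q`, where its label is `i`. -/
structure IntersectionPair (p q Δ : ℕ) where
  /-- The unit that describes how the two slopes intersect. -/
  twist : (ZMod Δ)ˣ
  /-- Signs of the vertices of `G_P`. -/
  signP : ZMod p → ℤˣ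
  /-- Signs of the vertices of `G_Q`. -/
  signQ : ZMod q → ℤˣ
  /-- The other endpoint of the arc of `P ∩ Q` that starts at a given point. -/
  arc : Equiv.Perm (BdryPoint p q Δ)
  arc_arc : ∀ x, arc (arc x) = x
  /-- The surfaces and the 3-manifold are oriented, so the two ends of an arc are points of
  `∂P ∩ ∂Q` of opposite intersection sign on the torus: the arc joins vertices of the same sign in `G_P` if and
  only if it joins vertices of opposite signs in `G_Q`.  (So an arc has two distinct ends.) -/
  parity : ∀ x, signP x.1 = signP (arc x).1 ↔ signQ x.2.1 ≠ signQ (arc x).2.1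
  /-- The graph `G_P` in the 2-sphere `P̂`. -/
  GP : SphereGraph (rotP signP) arc
  /-- The graph `G_Q` in the 2-sphere `Q̂`. -/
  GQ : SphereGraph (rotQ twist signQ) arc
  /-- The arcs are essential in `P`. -/
  essentialP : GP.NoTrivialLoop
  /-- The arcs are essential in `Q`. -/
  essentialQ : GQ.NoTrivialLoop

/-! ### Types -/

/-- The integer vector `a` represents the type `τ`. -/
def RepresentsType {ι : Type} (a : ι → ℤ) (τ : ι → ℤˣ) : Prop :=
  (∃ η : ℤˣ, ∀ i, a i ≠ 0 → Int.sign (a i) = η * τ i) ∧ 2 ≤ ∑ᶠ i, |a i|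

namespace IntersectionPair

variable (G : IntersectionPair p q Δ)

/-- The `q`-interval `(j, j + 1)`, denoted by `j : ZMod q`, in which the corner `x` of `G_P` lies.
This corner runs anticlockwise from `x` to `rotP x`, whose label at a positive vertex is the next
one, and at a negative vertex the previous one. -/
def intervalP (x : BdryPoint p q Δ) : ZMod q :=
  if G.signP x.1 = 1 then x.2.1 else x.2.1 - 1

/-- The `p`-interval `(i, i + 1)`, denoted by `i : ZMod p`, in which the corner `x` of `G_Q`
lies. -/
def intervalQ (x : BdryPoint p q Δ) : ZMod p :=
  if G.signQ x.2.1 = 1 then x.1 else x.1 - 1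

/-- The element `[D]` of the free abelian group on the `q`-intervals: the algebraic sum of
the corners of `D`, each with the sign of its vertex. -/
noncomputable def cornerSum (D : G.GP.Face) : ZMod q → ℤ := fun j =>
  ∑ᶠ x ∈ {x | x ∈ D.corners ∧ G.intervalP x = j}, (G.signP x.1 : ℤ)

/-- The coherence condition: no `q`-interval appears as a corner of `D` at two vertices of
opposite sign. -/
def Coherent (D : G.GP.Face) : Prop :=
  ∀ x ∈ D.corners, ∀ y ∈ D.corners, G.intervalP x = G.intervalP y → G.signP x.1 = G.signP y.1

/-- The face `D` of `G_P` represents the `q`-type `τ`. -/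
def FaceRepresents (D : G.GP.Face) (τ : ZMod q → ℤˣ) : Prop :=
  RepresentsType (G.cornerSum D) τ ∧ G.Coherent D

/-- `G_P` represents all types: there is a set of disk faces of `G_P` such that each `q`-type is
represented by one of them. -/
def RepresentsAllTypes : Prop :=
  ∃ 𝒟 : Set G.GP.Face, (∀ D ∈ 𝒟, D.IsDisk) ∧
    ∀ τ : ZMod q → ℤˣ, ∃ D ∈ 𝒟, G.FaceRepresents D τ

/-- A face of `G_Q` is a Scharlemann cycle if it is a disk face, all of its vertices have the same
sign, and all of its corners are the same `p`-interval. -/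
def IsScharlemannCycle (D : G.GQ.Face) : Prop :=
  D.IsDisk ∧
    (∃ s : ℤˣ, ∀ x ∈ D.corners, G.signQ x.2.1 = s) ∧
    ∃ i : ZMod p, ∀ x ∈ D.corners, G.intervalQ x = i

end IntersectionPair

end DehnGraphs

namespace DehnGraphs

open Equiv.Perm

section Cells

variable {X : Type}

/-- The number of classes of `s` whose chosen representative satisfies `P`. -/
noncomputable def cellCount (s : Setoid X) (P : X → Prop) : ℕ :=
  Nat.card {c : Quotient s // P c.out}

lemma out_iff {s : Setoid X} {P : X → Prop} (hP : ∀ x y, s x y → P x → P y) (x : X) :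
    P (Quotient.mk s x).out ↔ P x := by
  have h : s (Quotient.mk s x).out x := Quotient.exact (Quotient.out_eq _)
  exact ⟨hP _ _ h, hP _ _ (s.symm h)⟩

lemma cellCount_true (s : Setoid X) : cellCount s (fun _ => True) = Nat.card (Quotient s) :=
  Nat.card_congr (Equiv.subtypeUnivEquiv (fun _ => trivial))

lemma cellCount_congr {s : Setoid X} {P Q : X → Prop} (h : ∀ x, P x ↔ Q x) :
    cellCount s P = cellCount s Q := by
  rw [show P = Q from funext fun x => propext (h x)]

lemma cellCount_add_not [Finite X] (s : Setoid X) (P : X → Prop) :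
    cellCount s P + cellCount s (fun x => ¬ P x) = Nat.card (Quotient s) := by
  classical
  have := Fintype.ofFinite (Quotient s)
  unfold cellCount
  rw [Nat.card_eq_fintype_card, Nat.card_eq_fintype_card, Nat.card_eq_fintype_card]
  rw [Fintype.card_subtype_compl]
  have := Fintype.card_subtype_le (fun c : Quotient s => P c.out)
  omega

lemma sum_cellCount_fiber [Finite X] {ι : Type} [Fintype ι] (s : Setoid X) (P : X → Prop)
    (f : X → ι) : ∑ i, cellCount s (fun x => P x ∧ f x = i) = cellCount s P := by
  classical
  have := Fintype.ofFinite (Quotient s)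
  unfold cellCount
  simp only [Nat.card_eq_fintype_card, Fintype.card_subtype]
  rw [Finset.card_eq_sum_card_fiberwise (f := fun c : Quotient s => f c.out)
    (t := Finset.univ) (by simp)]
  simp [Finset.filter_filter]

lemma sameCycle_involution_iff {σ : Equiv.Perm X} (hσ : ∀ x, σ (σ x) = x) (x y : X) :
    SameCycle σ x y ↔ (y = x ∨ y = σ x) := by
  constructor
  · rintro ⟨n, rfl⟩
    have hs : σ ^ (2 : ℤ) = 1 := by
      ext x
      exact hσ x
    rcases Int.even_or_odd' n with ⟨k, rfl | rfl⟩
    · left; rw [zpow_mul, hs]; simp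
    · right; rw [zpow_add, zpow_mul, hs]; simp
  · rintro (rfl | rfl)
    · rfl
    · exact ⟨1, by simp⟩

lemma two_mul_cellCount_involution [Finite X] {σ : Equiv.Perm X} (hσ : ∀ x, σ (σ x) = x)
    (hfix : ∀ x, σ x ≠ x) {P : X → Prop} (hP : ∀ x, P x → P (σ x)) :
    2 * cellCount (SameCycle.setoid σ) P = Nat.card {x // P x} := by
  classical
  have := Fintype.ofFinite X
  have := Fintype.ofFinite (Quotient (SameCycle.setoid σ))
  have key := sameCycle_involution_iff hσ
  have hP' : ∀ x y, SameCycle.setoid σ x y → P x → P y := by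
    intro x y h hx
    rcases (key x y).1 h with rfl | rfl
    · exact hx
    · exact hP _ hx
  unfold cellCount
  simp only [Nat.card_eq_fintype_card, Fintype.card_subtype]
  rw [Finset.card_eq_sum_card_fiberwise (s := Finset.univ.filter P)
    (f := fun x => Quotient.mk (SameCycle.setoid σ) x)
    (t := Finset.univ.filter fun c => P c.out)]
  · rw [Finset.sum_const_nat (m := 2)]
    · ring
    · intro c hc
      have : (Finset.univ.filter P).filter (fun x => Quotient.mk (SameCycle.setoid σ) x = c)
          = {c.out, σ c.out} := by
        ext x
        simp only [Finset.mem_filter, Finset.mem_univ, true_and, Finset.mem_insert,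
          Finset.mem_singleton] at hc ⊢
        constructor
        · rintro ⟨-, rfl⟩
          have h2 : SameCycle.setoid σ (Quotient.mk _ x).out x := Quotient.exact (Quotient.out_eq _)
          exact (key _ _).1 h2
        · intro h
          have h2 : SameCycle.setoid σ c.out x := (key _ _).2 h
          refine ⟨hP' _ _ h2 hc, ?_⟩
          rw [← Quotient.out_eq c]
          exact (Quotient.sound h2).symm
      rw [this, Finset.card_pair (hfix _).symm]
  · intro x hx
    simp only [Finset.coe_filter, Finset.mem_univ, true_and, Set.mem_ofPred_eq] at hx ⊢
    exact (out_iff hP' x).2 hx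

/-- The functions that are constant on the classes of `s` and vanish outside `P`. -/
def invariantFun (s : Setoid X) (P : X → Prop) : Submodule (ZMod 2) (X → ZMod 2) where
  carrier := {f | (∀ x y, s x y → f x = f y) ∧ ∀ x, ¬ P x → f x = 0}
  zero_mem' := ⟨fun _ _ _ => rfl, fun _ _ => rfl⟩
  add_mem' := fun ha hb => ⟨fun x y h => by simp [ha.1 x y h, hb.1 x y h],
    fun x h => by simp [ha.2 x h, hb.2 x h]⟩
  smul_mem' := fun c _ ha => ⟨fun x y h => by simp [ha.1 x y h],
    fun x h => by simp [ha.2 x h]⟩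

lemma finrank_invariantFun [Finite X] {s : Setoid X} {P : X → Prop}
    (hP : ∀ x y, s x y → P x → P y) :
    Module.finrank (ZMod 2) (invariantFun s P) = cellCount s P := by
  classical
  have := Fintype.ofFinite (Quotient s)
  let e : invariantFun s P ≃ₗ[ZMod 2] ({c : Quotient s // P c.out} → ZMod 2) :=
    { toFun := fun f c => f.1 c.1.out
      map_add' := fun _ _ => rfl
      map_smul' := fun _ _ => rfl
      invFun := fun g => ⟨fun x => if h : P (Quotient.mk s x).out then g ⟨_, h⟩ else 0, by
        constructor
        · intro x y h
          have : Quotient.mk s x = Quotient.mk s y := Quotient.sound h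
          simp only [this]
        · intro x h
          exact dif_neg (by rwa [out_iff hP])⟩
      left_inv := by
        rintro ⟨f, h1, h2⟩
        ext x
        simp only
        split_ifs with h
        · exact h1 _ _ (Quotient.exact (Quotient.out_eq _))
        · rw [out_iff hP] at h
          exact (h2 x h).symm
      right_inv := by
        intro g
        ext ⟨c, hc⟩
        simp [hc] }
  rw [e.finrank_eq, Module.finrank_fintype_fun_eq_card, cellCount, Nat.card_eq_fintype_card]

lemma rel_of_sameCycle {σ : Equiv.Perm X} {s : Setoid X} (h : ∀ x, s x (σ x)) {x y : X}
    (hxy : SameCycle σ x y) : s x y := by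
  obtain ⟨n, rfl⟩ := hxy
  induction n using Int.induction_on with
  | zero => exact s.refl _
  | succ i ih =>
    refine s.trans ih ?_
    rw [add_comm, zpow_add]
    exact h _
  | pred i ih =>
    refine s.trans ih (s.symm ?_)
    have := h ((σ ^ (-(i : ℤ) - 1)) x)
    rwa [← Equiv.Perm.mul_apply, ← zpow_one_add, show (1 : ℤ) + (-(i : ℤ) - 1) = -i by ring] at this

end Cells

namespace SphereGraph

variable {X : Type} {rot arc : Equiv.Perm X} (G : SphereGraph rot arc) (Y : Set X)

/-- The regions that remain when only the edges with endpoints in `Y` are kept. -/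
def region : Setoid X :=
  Relation.EqvGen.setoid fun x y => G.sameFace x y ∨ (y = rot x ∧ y ∉ Y)

/-- No endpoint at the vertex of the corner `x` is in `Y`. -/
def FreeVertex (rot : Equiv.Perm X) (Y : Set X) (x : X) : Prop :=
  ∀ y, SameCycle rot x y → y ∉ Y

/-- The defect of a region: an Euler characteristic, in which a face with `b` boundary components
counts `2 - b`, a deleted edge `-1` and an interior vertex `1`. -/
noncomputable def defect (R : Quotient (G.region Y)) : ℤ :=
  2 * cellCount G.sameFace (fun x => True ∧ Quotient.mk (G.region Y) x = R)
    - cellCount (SameCycle.setoid (arc * rot)) (fun x => True ∧ Quotient.mk (G.region Y) x = R)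
    - cellCount (SameCycle.setoid arc) (fun x => x ∉ Y ∧ Quotient.mk (G.region Y) x = R)
    + cellCount (SameCycle.setoid rot)
        (fun x => FreeVertex rot Y x ∧ Quotient.mk (G.region Y) x = R)

variable {G Y}

lemma region_of_sameFace {x y : X} (h : G.sameFace x y) : G.region Y x y :=
  Relation.EqvGen.rel _ _ (Or.inl h)

lemma region_rot {x : X} (h : rot x ∉ Y) : G.region Y x (rot x) :=
  Relation.EqvGen.rel _ _ (Or.inr ⟨rfl, h⟩)

lemma region_le {s : Setoid X} (hF : ∀ x y, G.sameFace x y → s x y)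
    (hr : ∀ x, rot x ∉ Y → s x (rot x)) {x y : X} (h : G.region Y x y) : s x y := by
  induction h with
  | rel x y h =>
    rcases h with h | ⟨rfl, h⟩
    · exact hF _ _ h
    · exact hr _ h
  | refl x => exact s.refl _
  | symm x y _ ih => exact s.symm ih
  | trans x y z _ _ ih1 ih2 => exact s.trans ih1 ih2

variable (G Y) in
lemma region_next (x : X) : G.region Y x (arc (rot x)) := region_of_sameFace (G.boundary x)

variable (harc : ∀ x, arc (arc x) = x) (hY : ∀ x ∈ Y, arc x ∈ Y)
include harc

lemma sameFace_inv_arc (x : X) : G.sameFace (rot⁻¹ (arc x)) x := by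
  have := G.boundary (rot⁻¹ (arc x))
  simpa [harc] using this

include hY

lemma arc_mem_iff (x : X) : arc x ∈ Y ↔ x ∈ Y :=
  ⟨fun h => by simpa [harc] using hY _ h, hY x⟩

lemma region_arc {x : X} (h : x ∉ Y) : G.region Y x (arc x) := by
  have h1 : G.region Y (rot⁻¹ (arc x)) x := region_of_sameFace (sameFace_inv_arc harc x)
  have h2 : G.region Y (rot⁻¹ (arc x)) (rot (rot⁻¹ (arc x))) := by
    apply region_rot
    simpa [arc_mem_iff harc hY] using h
  have h3 : G.region Y (rot⁻¹ (arc x)) (arc x) := by simpa using h2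
  exact (G.region Y).trans ((G.region Y).symm h1) h3

omit harc hY in
lemma freeVertex_of_sameCycle {x y : X} (h : SameCycle rot x y) (hx : FreeVertex rot Y x) :
    FreeVertex rot Y y := fun z hz => hx z (h.trans hz)

omit harc hY in
lemma region_rot_of_free {x y : X} (h : SameCycle rot x y) (hx : FreeVertex rot Y x) :
    G.region Y x y := by
  have key : ∀ n : ℤ, G.region Y x ((rot ^ n) x) := by
    intro n
    induction n using Int.induction_on with
    | zero => exact (G.region Y).refl _
    | succ i ih =>
      refine (G.region Y).trans ih ?_
      rw [add_comm, zpow_add]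
      refine region_rot (hx _ ⟨1 + i, ?_⟩)
      rw [zpow_add]; rfl
    | pred i ih =>
      refine (G.region Y).trans ih ((G.region Y).symm ?_)
      have := region_rot (G := G) (Y := Y) (x := (rot ^ (-(i : ℤ) - 1)) x) (by
        rw [← Equiv.Perm.mul_apply, ← zpow_one_add]
        exact hx _ ⟨_, rfl⟩)
      rwa [← Equiv.Perm.mul_apply, ← zpow_one_add,
        show (1 : ℤ) + (-(i : ℤ) - 1) = -i by ring] at this
  obtain ⟨n, rfl⟩ := h
  exact key n

/-- The sum of the defects of all regions. -/
lemma two_mul_sum_defect [Finite X] [Fintype (Quotient (G.region Y))]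
    (hfix : ∀ x, arc x ≠ x) :
    2 * ∑ R, G.defect Y R = 4 - 2 * numCycles rot + Nat.card {x // x ∈ Y}
      + 2 * cellCount (SameCycle.setoid rot) (FreeVertex rot Y) := by
  have e := G.euler
  have h4 := two_mul_cellCount_involution harc hfix (P := fun x => x ∈ Y) hY
  have h5 := cellCount_add_not (SameCycle.setoid arc) (fun x => x ∈ Y)
  have h : ∑ R, G.defect Y R = 2 * Nat.card (Quotient G.sameFace) - numCycles (arc * rot)
      - cellCount (SameCycle.setoid arc) (fun x => x ∉ Y)
      + cellCount (SameCycle.setoid rot) (FreeVertex rot Y) := by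
    unfold defect
    rw [Finset.sum_add_distrib, Finset.sum_sub_distrib, Finset.sum_sub_distrib, ← Finset.mul_sum]
    rw [← Nat.cast_sum, ← Nat.cast_sum, ← Nat.cast_sum, ← Nat.cast_sum, sum_cellCount_fiber,
      sum_cellCount_fiber, sum_cellCount_fiber, sum_cellCount_fiber, cellCount_true,
      cellCount_true]
    rfl
  rw [h]
  unfold numCycles at *
  push_cast [← h4, ← h5] at *
  linarith

end SphereGraph

end DehnGraphs

namespace DehnGraphs

open Equiv.Perm

namespace SphereGraph

variable {X : Type} {rot arc : Equiv.Perm X} (G : SphereGraph rot arc) (Y : Set X)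

/-- The chosen corner on the boundary component through `x`. -/
noncomputable def base (rot arc : Equiv.Perm X) (x : X) : X :=
  (Quotient.mk (SameCycle.setoid (arc * rot)) x).out

lemma sameCycle_base (x : X) : SameCycle (arc * rot) (base rot arc x) x := by
  have h : SameCycle.setoid (arc * rot) (base rot arc x) x := Quotient.exact (Quotient.out_eq _)
  exact h

lemma base_eq {x y : X} (h : SameCycle (arc * rot) x y) : base rot arc x = base rot arc y := by
  have : Quotient.mk (SameCycle.setoid (arc * rot)) x
      = Quotient.mk (SameCycle.setoid (arc * rot)) y := Quotient.sound h
  rw [base, base, this]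

open Classical in
/-- The difference of a function on interior vertices across the deleted edges of a region, and its
sum with a function on faces along the boundary components. -/
noncomputable def coboundary₀ (rot arc : Equiv.Perm X) (Y R : Set X) :
    (X → ZMod 2) × (X → ZMod 2) →ₗ[ZMod 2] (X → ZMod 2) × (X → ZMod 2) where
  toFun a := (fun x => if x ∉ Y ∧ x ∈ R then a.1 x + a.1 (arc x) else 0,
    fun x => if x ∈ R then a.2 x + a.1 (base rot arc x) else 0)
  map_add' a b := by
    ext x
    · by_cases h : x ∉ Y ∧ x ∈ R <;> simp [h]
      ring
    · by_cases h : x ∈ R <;> simp [h]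
      ring
  map_smul' c a := by
    ext x
    · by_cases h : x ∉ Y ∧ x ∈ R <;> simp [h]
      ring
    · by_cases h : x ∈ R <;> simp [h]
      ring

open Classical in
/-- The sum of a function on edges over the boundary of a face. -/
noncomputable def coboundary₁ [Fintype X] :
    (X → ZMod 2) × (X → ZMod 2) →ₗ[ZMod 2] (X → ZMod 2) where
  toFun a := fun x => ∑ z, if G.sameFace z x then a.1 (rot z) else 0
  map_add' a b := by
    ext x
    simp only [Prod.fst_add, Pi.add_apply, ← Finset.sum_add_distrib]
    refine Finset.sum_congr rfl fun z _ => ?_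
    split_ifs <;> simp
  map_smul' c a := by
    ext x
    simp only [Prod.smul_fst, Pi.smul_apply, smul_eq_mul, Finset.mul_sum, RingHom.id_apply]
    refine Finset.sum_congr rfl fun z _ => ?_
    split_ifs <;> simp

/-- The corners of a region. -/
def regionSet (R : Quotient (G.region Y)) : Set X := {x | Quotient.mk (G.region Y) x = R}

variable {G Y}

lemma regionSet_iff {R : Quotient (G.region Y)} {x y : X} (h : G.region Y x y) :
    x ∈ G.regionSet Y R ↔ y ∈ G.regionSet Y R := by
  have : Quotient.mk (G.region Y) x = Quotient.mk (G.region Y) y := Quotient.sound h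
  simp [regionSet, this]

lemma regionSet_rel {R : Quotient (G.region Y)} {x y : X} (hx : x ∈ G.regionSet Y R)
    (hy : y ∈ G.regionSet Y R) : G.region Y x y := by
  apply Quotient.exact
  exact Eq.trans hx (Eq.symm hy)

lemma finrank_submodule_prod {K V W : Type} [Field K] [AddCommGroup V] [AddCommGroup W]
    [Module K V] [Module K W] [Module.Finite K V] [Module.Finite K W]
    (S : Submodule K V) (T : Submodule K W) :
    Module.finrank K (S.prod T) = Module.finrank K S + Module.finrank K T := by
  let e : S.prod T ≃ₗ[K] S × T :=
    { toFun := fun x => (⟨x.1.1, x.2.1⟩, ⟨x.1.2, x.2.2⟩)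
      map_add' := fun _ _ => rfl
      map_smul' := fun _ _ => rfl
      invFun := fun y => ⟨(y.1.1, y.2.1), y.1.2, y.2.2⟩
      left_inv := fun _ => rfl
      right_inv := fun _ => rfl }
  rw [e.finrank_eq, Module.finrank_prod]

lemma finrank_map_add_finrank_ker {K V W : Type} [Field K] [AddCommGroup V] [AddCommGroup W]
    [Module K V] [Module K W] [Module.Finite K V] (S : Submodule K V) (f : V →ₗ[K] W) :
    Module.finrank K (S.map f) + Module.finrank K (S ⊓ LinearMap.ker f : Submodule K V)
      = Module.finrank K S := by
  have h := LinearMap.finrank_range_add_finrank_ker (f.domRestrict S)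
  rw [LinearMap.range_domRestrict, LinearMap.ker_domRestrict,
    ← Submodule.finrank_map_subtype_eq] at h
  rw [← h, Submodule.map_comap_subtype]

lemma zmod2_add_self (a : ZMod 2) : a + a = 0 := by
  revert a; decide

section

variable (G Y) in
/-- Functions on the interior vertices and on the faces of a region. -/
def cochains₀ (R : Quotient (G.region Y)) : Submodule (ZMod 2) ((X → ZMod 2) × (X → ZMod 2)) :=
  (invariantFun (SameCycle.setoid rot) fun x => FreeVertex rot Y x ∧ x ∈ G.regionSet Y R).prod
    (invariantFun G.sameFace fun x => True ∧ x ∈ G.regionSet Y R)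

variable (G Y) in
/-- Functions on the deleted edges and on the boundary components of the faces of a region. -/
def cochains₁ (R : Quotient (G.region Y)) : Submodule (ZMod 2) ((X → ZMod 2) × (X → ZMod 2)) :=
  (invariantFun (SameCycle.setoid arc) fun x => x ∉ Y ∧ x ∈ G.regionSet Y R).prod
    (invariantFun (SameCycle.setoid (arc * rot)) fun x => True ∧ x ∈ G.regionSet Y R)

variable (harc : ∀ x, arc (arc x) = x) (hY : ∀ x ∈ Y, arc x ∈ Y)
include harc hY

omit harc hY in
lemma finrank_cochains₀ [Finite X] (R : Quotient (G.region Y)) :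
    Module.finrank (ZMod 2) (cochains₀ G Y R) =
      cellCount (SameCycle.setoid rot)
        (fun x => FreeVertex rot Y x ∧ Quotient.mk (G.region Y) x = R)
      + cellCount G.sameFace (fun x => True ∧ Quotient.mk (G.region Y) x = R) := by
  rw [cochains₀, finrank_submodule_prod, finrank_invariantFun, finrank_invariantFun]
  · rfl
  · rintro x y h ⟨-, hx⟩
    exact ⟨trivial, (regionSet_iff (region_of_sameFace h)).1 hx⟩
  · rintro x y h ⟨h1, hx⟩
    exact ⟨freeVertex_of_sameCycle h h1, (regionSet_iff (region_rot_of_free h h1)).1 hx⟩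

lemma finrank_cochains₁ [Finite X] (R : Quotient (G.region Y)) :
    Module.finrank (ZMod 2) (cochains₁ G Y R) =
      cellCount (SameCycle.setoid arc) (fun x => x ∉ Y ∧ Quotient.mk (G.region Y) x = R)
      + cellCount (SameCycle.setoid (arc * rot))
        (fun x => True ∧ Quotient.mk (G.region Y) x = R) := by
  rw [cochains₁, finrank_submodule_prod, finrank_invariantFun, finrank_invariantFun]
  · rfl
  · rintro x y h ⟨-, hx⟩
    exact ⟨trivial, (regionSet_iff (rel_of_sameCycle (region_next G Y) h)).1 hx⟩
  · rintro x y h ⟨h1, hx⟩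
    rcases (sameCycle_involution_iff harc x y).1 h with rfl | rfl
    · exact ⟨h1, hx⟩
    · exact ⟨by rwa [arc_mem_iff harc hY], (regionSet_iff (region_arc harc hY h1)).1 hx⟩

omit harc hY in
lemma coboundary₀_mem (harc : ∀ x, arc (arc x) = x) (hY : ∀ x ∈ Y, arc x ∈ Y)
    {R : Quotient (G.region Y)} {a : (X → ZMod 2) × (X → ZMod 2)}
    (ha : a ∈ cochains₀ G Y R) :
    coboundary₀ rot arc Y (G.regionSet Y R) a ∈ cochains₁ G Y R := by
  classical
  obtain ⟨⟨h1, h2⟩, h3, h4⟩ := ha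
  refine ⟨⟨?_, fun x hx => if_neg hx⟩, ?_, fun x hx => if_neg fun h => hx ⟨trivial, h⟩⟩
  · intro x y h
    rcases (sameCycle_involution_iff harc x y).1 h with rfl | rfl
    · rfl
    · by_cases hx : x ∈ Y
      · simp [coboundary₀, hx, hY x hx]
      · have := regionSet_iff (R := R) (region_arc (G := G) harc hY hx)
        simp only [coboundary₀, LinearMap.coe_mk, AddHom.coe_mk, harc]
        exact if_congr (and_congr (not_congr (arc_mem_iff harc hY x).symm) this) (add_comm _ _) rfl
  · intro x y h
    have h5 : G.sameFace x y := rel_of_sameCycle G.boundary h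
    have h6 := regionSet_iff (R := R) (region_of_sameFace (Y := Y) h5)
    simp only [coboundary₀, LinearMap.coe_mk, AddHom.coe_mk, base_eq h, h3 _ _ h5]
    exact if_congr h6 rfl rfl

lemma coboundary₀_rot {R : Quotient (G.region Y)} {a : (X → ZMod 2) × (X → ZMod 2)}
    (ha : a ∈ cochains₀ G Y R) (z : X) :
    (coboundary₀ rot arc Y (G.regionSet Y R) a).1 (rot z) = a.1 z + a.1 (arc (rot z)) := by
  obtain ⟨⟨h1, h2⟩, -⟩ := ha
  have hr : a.1 z = a.1 (rot z) := h1 z (rot z) ⟨1, by simp⟩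
  rw [hr]
  simp only [coboundary₀, LinearMap.coe_mk, AddHom.coe_mk]
  by_cases hz : rot z ∈ Y
  · have h3 : ∀ x ∈ Y, a.1 x = 0 := fun x hx => h2 x fun h => h.1 x (SameCycle.refl _ _) hx
    rw [h3 _ hz, h3 _ (hY _ hz)]
    simp [hz]
  · have h4 := regionSet_iff (R := R) (region_arc (G := G) harc hY hz)
    by_cases hR : rot z ∈ G.regionSet Y R
    · rw [if_pos ⟨hz, hR⟩]
    · rw [if_neg (by simp [hR]), h2 _ (by simp [hR]), h2 _ (by simp [← h4, hR]), add_zero]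

lemma coboundary₁_comp [Fintype X] {R : Quotient (G.region Y)}
    {a : (X → ZMod 2) × (X → ZMod 2)} (ha : a ∈ cochains₀ G Y R) :
    G.coboundary₁ (coboundary₀ rot arc Y (G.regionSet Y R) a) = 0 := by
  classical
  ext x
  have h1 : ∀ z, (if G.sameFace z x then
      (coboundary₀ rot arc Y (G.regionSet Y R) a).1 (rot z) else 0)
      = (if G.sameFace z x then a.1 z else 0)
        + if G.sameFace ((arc * rot) z) x then a.1 ((arc * rot) z) else 0 := by
    intro z
    have h2 : G.sameFace ((arc * rot) z) x ↔ G.sameFace z x :=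
      ⟨fun h => G.sameFace.trans (G.boundary z) h,
        fun h => G.sameFace.trans (G.sameFace.symm (G.boundary z)) h⟩
    rw [coboundary₀_rot harc hY ha]
    by_cases h : G.sameFace z x
    · rw [if_pos h, if_pos h, if_pos (h2.2 h)]
      rfl
    · rw [if_neg h, if_neg h, if_neg fun h' => h (h2.1 h'), add_zero]
  have h3 := Equiv.sum_comp (arc * rot) fun z => if G.sameFace z x then a.1 z else 0
  change ∑ z, (if G.sameFace z x then
      (coboundary₀ rot arc Y (G.regionSet Y R) a).1 (rot z) else 0) = 0
  rw [Finset.sum_congr rfl fun z _ => h1 z, Finset.sum_add_distrib, h3, zmod2_add_self]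

lemma coboundary₀_injective {R : Quotient (G.region Y)} {z₀ : X}
    (hz₀ : z₀ ∈ G.regionSet Y R) (hfree : ¬ FreeVertex rot Y z₀)
    {a : (X → ZMod 2) × (X → ZMod 2)} (ha : a ∈ cochains₀ G Y R)
    (h0 : coboundary₀ rot arc Y (G.regionSet Y R) a = 0) : a = 0 := by
  have hstep : ∀ z, a.1 z = a.1 (arc (rot z)) := by
    intro z
    have := coboundary₀_rot harc hY ha z
    rw [h0] at this
    have h5 : a.1 z + a.1 (arc (rot z)) + a.1 (arc (rot z)) = a.1 (arc (rot z)) := by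
      rw [← this]; simp
    rwa [add_assoc, zmod2_add_self, add_zero] at h5
  obtain ⟨⟨h1, h2⟩, h3, h4⟩ := ha
  have hbase : ∀ z, a.1 (base rot arc z) = a.1 z := fun z =>
    rel_of_sameCycle (s := Setoid.ker a.1) hstep (sameCycle_base z)
  have heq : ∀ z, a.2 z = a.1 z := by
    intro z
    by_cases hz : z ∈ G.regionSet Y R
    · have := congrFun (congrArg Prod.snd h0) z
      simp only [coboundary₀, LinearMap.coe_mk, AddHom.coe_mk, hz, if_true, hbase] at this
      have h5 : a.2 z + a.1 z + a.1 z = a.1 z := by rw [this]; simp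
      rwa [add_assoc, zmod2_add_self, add_zero] at h5
    · rw [h2 z (by simp [hz]), h4 z (by simp [hz])]
  have hconst : ∀ {x y}, G.region Y x y → a.1 x = a.1 y := by
    intro x y h
    refine region_le (s := Setoid.ker a.1) ?_ ?_ h
    · intro x y h
      change a.1 x = a.1 y
      rw [← heq, ← heq]
      exact h3 x y h
    · intro x _
      exact h1 x (rot x) ⟨1, by simp⟩
  have hz : ∀ x, a.1 x = 0 := by
    intro x
    by_cases hx : x ∈ G.regionSet Y R
    · rw [hconst (regionSet_rel hx hz₀)]
      exact h2 _ (by simp [hfree])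
    · exact h2 _ (by simp [hx])
  ext x
  · exact hz x
  · simp [heq, hz]

open Classical in
omit harc hY in
variable (G) in
/-- The indicator function of a face. -/
noncomputable def faceIndicator (x : X) : X → ZMod 2 := fun y => if G.sameFace x y then 1 else 0

lemma faceIndicator_add_mem [Fintype X] {R : Quotient (G.region Y)}
    {z : X} (hz : z ∈ G.regionSet Y R) (hr : rot z ∉ Y) :
    faceIndicator G z + faceIndicator G (rot z) ∈ (cochains₁ G Y R).map G.coboundary₁ := by
  classical
  have hzr : rot z ∈ G.regionSet Y R := (regionSet_iff (region_rot hr)).1 hz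
  have hza : arc (rot z) ∈ G.regionSet Y R := (regionSet_iff (region_arc harc hY hr)).1 hzr
  refine ⟨(fun x => (if x = rot z then 1 else 0) + if x = arc (rot z) then 1 else 0, 0),
    ⟨⟨?_, ?_⟩, fun _ _ _ => rfl, fun _ _ => rfl⟩, ?_⟩
  · intro x y h
    rcases (sameCycle_involution_iff harc x y).1 h with rfl | rfl
    · rfl
    · have e1 : arc x = rot z ↔ x = arc (rot z) :=
        ⟨fun h => by rw [← h, harc], fun h => by rw [h, harc]⟩
      simp only [e1, arc.injective.eq_iff]
      ring
  · intro x hx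
    have hx1 : x ≠ rot z := by rintro rfl; exact hx ⟨hr, hzr⟩
    have hx2 : x ≠ arc (rot z) := by
      rintro rfl
      exact hx ⟨by rwa [arc_mem_iff harc hY], hza⟩
    simp [hx1, hx2]
  · ext y
    have e2 : ∀ w, rot w = arc (rot z) ↔ w = rot⁻¹ (arc (rot z)) := fun w =>
      ⟨fun h => by rw [← h]; simp, fun h => by rw [h]; simp⟩
    have e3 : G.sameFace (rot⁻¹ (arc (rot z))) y ↔ G.sameFace (rot z) y := by
      have := sameFace_inv_arc (G := G) harc (rot z)
      exact ⟨fun h => G.sameFace.trans (G.sameFace.symm this) h,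
        fun h => G.sameFace.trans this h⟩
    change ∑ w, (if G.sameFace w y then
      ((if rot w = rot z then 1 else 0) + if rot w = arc (rot z) then 1 else 0) else 0)
      = (if G.sameFace z y then 1 else 0) + if G.sameFace (rot z) y then (1 : ZMod 2) else 0
    have h1 : ∀ w, (if G.sameFace w y then
      ((if rot w = rot z then 1 else 0) + if rot w = arc (rot z) then 1 else 0) else (0 : ZMod 2))
      = (if w = z then if G.sameFace w y then 1 else 0 else 0)
        + if w = rot⁻¹ (arc (rot z)) then if G.sameFace w y then 1 else 0 else 0 := by
      intro w
      simp only [rot.injective.eq_iff, e2]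
      split_ifs <;> simp
    rw [Finset.sum_congr rfl fun w _ => h1 w, Finset.sum_add_distrib, Finset.sum_ite_eq',
      Finset.sum_ite_eq']
    simp only [Finset.mem_univ, if_true]
    rw [if_congr e3 rfl rfl]

lemma faceIndicator_add_mem_of_region [Fintype X]
    {R : Quotient (G.region Y)} {x y : X} (h : G.region Y x y) (hx : x ∈ G.regionSet Y R) :
    faceIndicator G x + faceIndicator G y ∈ (cochains₁ G Y R).map G.coboundary₁ := by
  classical
  have hself : ∀ v : X → ZMod 2, v + v = 0 := fun v => by ext; simp [zmod2_add_self]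
  induction h with
  | rel x y h =>
    rcases h with h | ⟨rfl, h⟩
    · have : faceIndicator G x = faceIndicator G y := by
        ext z
        have : G.sameFace x z ↔ G.sameFace y z :=
          ⟨fun h' => G.sameFace.trans (G.sameFace.symm h) h', fun h' => G.sameFace.trans h h'⟩
        exact if_congr this rfl rfl
      rw [this, hself]
      exact Submodule.zero_mem _
    · exact faceIndicator_add_mem harc hY hx h
  | refl x => rw [hself]; exact Submodule.zero_mem _
  | symm x y h ih =>
    rw [add_comm]
    exact ih ((regionSet_iff (G := G) (Y := Y) h).2 hx)
  | trans x y z h1 h2 ih1 ih2 =>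
    have := Submodule.add_mem _ (ih1 hx) (ih2 ((regionSet_iff (G := G) (Y := Y) h1).1 hx))
    rwa [show faceIndicator G x + faceIndicator G y + (faceIndicator G y + faceIndicator G z)
      = faceIndicator G x + (faceIndicator G y + faceIndicator G y) + faceIndicator G z by abel,
      hself, add_zero] at this

lemma card_faces_le [Fintype X] {R : Quotient (G.region Y)} {z₀ : X}
    (hz₀ : z₀ ∈ G.regionSet Y R) :
    cellCount G.sameFace (fun x => True ∧ Quotient.mk (G.region Y) x = R)
      ≤ Module.finrank (ZMod 2) ((cochains₁ G Y R).map G.coboundary₁) + 1 := by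
  classical
  rw [← finrank_invariantFun]
  · have hle : invariantFun G.sameFace (fun x => True ∧ Quotient.mk (G.region Y) x = R)
        ≤ (cochains₁ G Y R).map G.coboundary₁
          ⊔ Submodule.span (ZMod 2) {faceIndicator G z₀} := by
      rintro f ⟨h1, h2⟩
      have := Fintype.ofFinite (Quotient G.sameFace)
      have hf : f = ∑ c : Quotient G.sameFace, f c.out • faceIndicator G c.out := by
        ext x
        have hc : ∀ c : Quotient G.sameFace, f c.out * faceIndicator G c.out x
            = if c = Quotient.mk _ x then f x else 0 := by
          intro c
          by_cases h : c = Quotient.mk _ x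
          · have h5 : G.sameFace c.out x := by
              subst h
              exact Quotient.exact (Quotient.out_eq _)
            simp [faceIndicator, h5, if_pos h, h1 _ _ h5]
          · have h5 : ¬ G.sameFace c.out x := by
              intro h5
              apply h
              rw [← Quotient.out_eq c]
              exact Quotient.sound h5
            simp [faceIndicator, h5, if_neg h]
        simp [Finset.sum_apply, hc]
      rw [hf]
      refine Submodule.sum_mem _ fun c _ => ?_
      by_cases hc : c.out ∈ G.regionSet Y R
      · refine Submodule.smul_mem _ _ ?_
        have h6 := faceIndicator_add_mem_of_region harc hY (regionSet_rel hc hz₀) hc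
        have h7 : faceIndicator G c.out = (faceIndicator G c.out + faceIndicator G z₀)
            + faceIndicator G z₀ := by
          rw [add_assoc, show faceIndicator G z₀ + faceIndicator G z₀ = 0 by
            ext; simp [zmod2_add_self], add_zero]
        rw [h7]
        exact Submodule.add_mem_sup h6 (Submodule.mem_span_singleton_self _)
      · rw [h2 _ fun h => hc h.2, zero_smul]
        exact Submodule.zero_mem _
    refine (Submodule.finrank_mono hle).trans ((Submodule.finrank_add_le_finrank_add_finrank _ _).trans ?_)
    have := finrank_span_le_card (R := ZMod 2) {faceIndicator G z₀}
    rw [Set.toFinset_singleton, Finset.card_singleton] at this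
    omega
  · rintro x y h ⟨-, hx⟩
    exact ⟨trivial, (regionSet_iff (region_of_sameFace h)).1 hx⟩

lemma region_exact_aux [Fintype X] {R : Quotient (G.region Y)} {z₀ : X}
    (hz₀ : z₀ ∈ G.regionSet Y R) (hfree : ¬ FreeVertex rot Y z₀) :
    G.defect Y R ≤ 1 ∧ (G.defect Y R = 1 →
      cochains₁ G Y R ⊓ LinearMap.ker G.coboundary₁
        ≤ (cochains₀ G Y R).map (coboundary₀ rot arc Y (G.regionSet Y R))) := by
  set D₀ := coboundary₀ rot arc Y (G.regionSet Y R)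
  have h1 := finrank_cochains₀ (G := G) (Y := Y) R
  have h2 := finrank_cochains₁ (G := G) (Y := Y) harc hY R
  have h3 := card_faces_le (G := G) (Y := Y) harc hY hz₀
  have h4 : Module.finrank (ZMod 2) ((cochains₀ G Y R).map D₀)
      = Module.finrank (ZMod 2) (cochains₀ G Y R) := by
    have h := finrank_map_add_finrank_ker (cochains₀ G Y R) D₀
    rw [show cochains₀ G Y R ⊓ LinearMap.ker D₀ = ⊥ from eq_bot_iff.2 fun a ha =>
      coboundary₀_injective harc hY hz₀ hfree ha.1 ha.2, finrank_bot] at h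
    exact h
  have h5 := finrank_map_add_finrank_ker (cochains₁ G Y R) G.coboundary₁
  have h6 : (cochains₀ G Y R).map D₀ ≤ cochains₁ G Y R ⊓ LinearMap.ker G.coboundary₁ := by
    rintro _ ⟨a, ha, rfl⟩
    exact ⟨coboundary₀_mem harc hY ha, coboundary₁_comp harc hY ha⟩
  have h7 := Submodule.finrank_mono h6
  constructor
  · unfold defect
    omega
  · intro h
    refine (Submodule.eq_of_le_of_finrank_le h6 ?_).ge
    unfold defect at h
    omega

/-- A region with a corner at a vertex that has a kept endpoint has defect at most one. -/
lemma defect_le_one [Finite X] {R : Quotient (G.region Y)} {z₀ : X}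
    (hz₀ : z₀ ∈ G.regionSet Y R) (hfree : ¬ FreeVertex rot Y z₀) : G.defect Y R ≤ 1 := by
  have := Fintype.ofFinite X
  exact (region_exact_aux harc hY hz₀ hfree).1

open Classical in
/-- In a region of defect one, every even cochain is a coboundary. -/
lemma region_exact [Fintype X] {R : Quotient (G.region Y)} {z₀ : X}
    (hz₀ : z₀ ∈ G.regionSet Y R) (hfree : ¬ FreeVertex rot Y z₀) (hone : G.defect Y R = 1)
    (g k : X → ZMod 2) (hg : ∀ x ∈ G.regionSet Y R, x ∉ Y → g (arc x) = g x)
    (hsum : ∀ x ∈ G.regionSet Y R,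
      ∑ z, (if G.sameFace z x ∧ rot z ∉ Y then g (rot z) else 0) = 0) :
    ∃ f φ : X → ZMod 2, (∀ x y, SameCycle rot x y → f x = f y) ∧
      (∀ x, ¬ FreeVertex rot Y x → f x = 0) ∧ (∀ x y, G.sameFace x y → φ x = φ y) ∧
      (∀ x ∈ G.regionSet Y R, x ∉ Y → f x + f (arc x) = g x) ∧
      ∀ x ∈ G.regionSet Y R, φ x + f (base rot arc x) = k (base rot arc x) := by
  have hmem : ((fun x => if x ∉ Y ∧ x ∈ G.regionSet Y R then g x else 0,
      fun x => if x ∈ G.regionSet Y R then k (base rot arc x) else 0) :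
      (X → ZMod 2) × (X → ZMod 2)) ∈ cochains₁ G Y R ⊓ LinearMap.ker G.coboundary₁ := by
    refine ⟨⟨⟨?_, fun x hx => if_neg hx⟩, ?_, fun x hx => if_neg fun h => hx ⟨trivial, h⟩⟩, ?_⟩
    · intro x y h
      rcases (sameCycle_involution_iff harc x y).1 h with rfl | rfl
      · rfl
      · by_cases hx : x ∈ Y
        · simp [hx, hY x hx]
        · have h1 := regionSet_iff (R := R) (region_arc (G := G) harc hY hx)
          have h2 : arc x ∉ Y := by rwa [arc_mem_iff harc hY]
          by_cases hR : x ∈ G.regionSet Y R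
          · simp only
            rw [if_pos ⟨hx, hR⟩, if_pos ⟨h2, h1.1 hR⟩, hg x hR hx]
          · simp only
            rw [if_neg fun h => hR h.2, if_neg fun h => hR (h1.2 h.2)]
    · intro x y h
      have h1 := regionSet_iff (R := R) (rel_of_sameCycle (region_next G Y) h)
      simp only [base_eq h]
      exact if_congr h1 rfl rfl
    · ext x
      change ∑ z, (if G.sameFace z x then
        (if rot z ∉ Y ∧ rot z ∈ G.regionSet Y R then g (rot z) else 0) else 0) = 0
      by_cases hx : x ∈ G.regionSet Y R
      · refine (Finset.sum_congr rfl fun z _ => ?_).trans (hsum x hx)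
        by_cases h1 : G.sameFace z x
        · by_cases h2 : rot z ∈ Y
          · simp [h2]
          · have h3 : rot z ∈ G.regionSet Y R :=
              (regionSet_iff (region_rot h2)).1 ((regionSet_iff (region_of_sameFace h1)).2 hx)
            rw [if_pos h1, if_pos ⟨h2, h3⟩, if_pos ⟨h1, h2⟩]
        · rw [if_neg h1, if_neg fun h => h1 h.1]
      · refine Finset.sum_eq_zero fun z _ => ?_
        by_cases h1 : G.sameFace z x
        · rw [if_pos h1, if_neg]
          rintro ⟨h2, h3⟩
          exact hx ((regionSet_iff (region_of_sameFace h1)).1 ((regionSet_iff (region_rot h2)).2 h3))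
        · rw [if_neg h1]
  obtain ⟨⟨f, φ⟩, ⟨⟨h1, h2⟩, h3, h4⟩, h5⟩ :=
    (region_exact_aux harc hY hz₀ hfree).2 hone hmem
  refine ⟨f, φ, h1, fun x hx => h2 x fun h => hx h.1, h3, fun x hR hx => ?_, fun x hR => ?_⟩
  · have := congrFun (congrArg Prod.fst h5) x
    simpa [coboundary₀, hR, hx] using this
  · have := congrFun (congrArg Prod.snd h5) x
    simpa [coboundary₀, hR] using this

end

end SphereGraph

end DehnGraphs

namespace DehnGraphs

open Equiv.Perm

lemma cellCount_split {X : Type} [Finite X] (s : Setoid X) (P Q : X → Prop) :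
    cellCount s P = cellCount s (fun x => P x ∧ Q x) + cellCount s (fun x => P x ∧ ¬ Q x) := by
  classical
  have := Fintype.ofFinite (Quotient s)
  unfold cellCount
  simp only [Nat.card_eq_fintype_card, Fintype.card_subtype]
  rw [← Finset.filter_filter, ← Finset.filter_filter]
  exact (Finset.card_filter_add_card_filter_not (fun c : Quotient s => Q c.out)).symm

lemma cellCount_eq_zero {X : Type} {s : Setoid X} {P : X → Prop} (h : ∀ x, ¬ P x) :
    cellCount s P = 0 := by
  unfold cellCount
  have : IsEmpty {c : Quotient s // P c.out} := ⟨fun c => h _ c.2⟩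
  simp

namespace SphereGraph

variable {X : Type} {rot arc : Equiv.Perm X} {G : SphereGraph rot arc} {Y Y' : Set X}

lemma region_mono (h : Y' ⊆ Y) {x y : X} (hxy : G.region Y x y) : G.region Y' x y :=
  region_le (fun _ _ => region_of_sameFace) (fun _ hx => region_rot fun h' => hx (h h')) hxy

variable (G) in
/-- The region with fewer kept edges that contains a given region. -/
def regionMap (h : Y' ⊆ Y) : Quotient (G.region Y) → Quotient (G.region Y') :=
  Quotient.lift (fun x => Quotient.mk (G.region Y') x) fun _ _ hxy =>
    Quotient.sound (region_mono h hxy)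

lemma sum_cellCount_regionMap [Finite X] [Fintype (Quotient (G.region Y))]
    [DecidableEq (Quotient (G.region Y'))] (h : Y' ⊆ Y)
    (s : Setoid X) (P : X → Prop) (R' : Quotient (G.region Y')) :
    ∑ R with regionMap G h R = R', cellCount s (fun x => P x ∧ Quotient.mk (G.region Y) x = R)
      = cellCount s (fun x => P x ∧ Quotient.mk (G.region Y') x = R') := by
  classical
  rw [← sum_cellCount_fiber s _ (fun x => Quotient.mk (G.region Y) x), Finset.sum_filter]
  refine Finset.sum_congr rfl fun R _ => ?_
  split_ifs with hR
  · refine cellCount_congr fun x => ⟨fun hx => ⟨⟨hx.1, ?_⟩, hx.2⟩, fun hx => ⟨hx.1.1, hx.2⟩⟩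
    rw [← hR, ← hx.2]
    rfl
  · symm
    refine cellCount_eq_zero fun x hx => hR ?_
    rw [← hx.1.2, ← hx.2]
    rfl

/-- Keeping more edges divides a region, and changes the total defect by the number of the new
edges. -/
lemma two_mul_sum_defect_regionMap [Finite X] [Fintype (Quotient (G.region Y))]
    [DecidableEq (Quotient (G.region Y'))]
    (harc : ∀ x, arc (arc x) = x) (hfix : ∀ x, arc x ≠ x) (hY : ∀ x ∈ Y, arc x ∈ Y)
    (hY' : ∀ x ∈ Y', arc x ∈ Y') (h : Y' ⊆ Y) (hfree : ∀ x, ¬ FreeVertex rot Y' x)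
    (R' : Quotient (G.region Y')) :
    2 * ∑ R with regionMap G h R = R', G.defect Y R
      = 2 * G.defect Y' R' + Nat.card {x // (x ∉ Y' ∧ Quotient.mk (G.region Y') x = R') ∧ x ∈ Y} := by
  have hfreeY : ∀ x, ¬ FreeVertex rot Y x := fun x hx => hfree x fun y hy hy' => hx y hy (h hy')
  have h1 : ∀ R, cellCount (SameCycle.setoid rot)
      (fun x => FreeVertex rot Y x ∧ Quotient.mk (G.region Y) x = R) = 0 := fun R =>
    cellCount_eq_zero fun x hx => hfreeY x hx.1
  have h2 : cellCount (SameCycle.setoid rot)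
      (fun x => FreeVertex rot Y' x ∧ Quotient.mk (G.region Y') x = R') = 0 :=
    cellCount_eq_zero fun x hx => hfree x hx.1
  have h3 := cellCount_split (SameCycle.setoid arc)
    (fun x => x ∉ Y' ∧ Quotient.mk (G.region Y') x = R') (fun x => x ∈ Y)
  have h4 := two_mul_cellCount_involution harc hfix
    (P := fun x => (x ∉ Y' ∧ Quotient.mk (G.region Y') x = R') ∧ x ∈ Y) (by
      rintro x ⟨⟨h5, h6⟩, h7⟩
      refine ⟨⟨by rwa [arc_mem_iff harc hY'], ?_⟩, hY x h7⟩
      exact (regionSet_iff (region_arc harc hY' h5)).1 h6)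
  have h8 : cellCount (SameCycle.setoid arc)
      (fun x => (x ∉ Y' ∧ Quotient.mk (G.region Y') x = R') ∧ ¬ x ∈ Y)
      = cellCount (SameCycle.setoid arc) (fun x => x ∉ Y ∧ Quotient.mk (G.region Y') x = R') :=
    cellCount_congr fun x => ⟨fun hx => ⟨hx.2, hx.1.2⟩, fun hx => ⟨⟨fun h' => hx.1 (h h'), hx.2⟩, hx.1⟩⟩
  unfold defect
  rw [Finset.sum_add_distrib, Finset.sum_sub_distrib, Finset.sum_sub_distrib, ← Finset.mul_sum]
  simp only [h1, h2]
  rw [← Nat.cast_sum, ← Nat.cast_sum, ← Nat.cast_sum, sum_cellCount_regionMap,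
    sum_cellCount_regionMap, sum_cellCount_regionMap]
  simp only [Nat.cast_zero, Finset.sum_const_zero]
  rw [← h8]
  push_cast [h3, ← h4]
  ring

end SphereGraph

end DehnGraphs

namespace DehnGraphs

open Equiv.Perm SphereGraph

/-- An equivalence relation on `ZMod n × ZMod Δ` that relates each point to its successor on the
spiral with twist `u` is everything. -/
lemma spiral_transitive {n Δ : ℕ} [NeZero n] [NeZero Δ] (u : (ZMod Δ)ˣ)
    (s : Setoid (ZMod n × ZMod Δ))
    (h : ∀ i k, s (i, k) (i + 1, if i + 1 = 0 then k + u else k)) (x y : ZMod n × ZMod Δ) :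
    s x y := by
  have hrow : ∀ m : ℕ, m < n → ∀ k : ZMod Δ, s (0, k) ((m : ZMod n), k) := by
    intro m
    induction m with
    | zero => intro _ k; simp
    | succ m ih =>
      intro hm k
      refine s.trans (ih (by omega) k) ?_
      have h1 := h m k
      have h2 : ((m : ZMod n) + 1) ≠ 0 := by
        intro h3
        have h4 : ((m + 1 : ℕ) : ZMod n) = 0 := by push_cast; exact h3
        rw [ZMod.natCast_eq_zero_iff] at h4
        exact absurd (Nat.le_of_dvd (by omega) h4) (by omega)
      rw [if_neg h2] at h1
      push_cast
      exact h1
  have hrow' : ∀ i k, s (0, k) (i, k) := by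
    intro i k
    have := hrow i.val (ZMod.val_lt i) k
    rwa [ZMod.natCast_zmod_val] at this
  have hup : ∀ k, s (0, k) (0, k + u) := by
    intro k
    have h1 := h (-1) k
    simp only [neg_add_cancel, if_true] at h1
    exact s.trans (hrow' _ k) h1
  have hcol : ∀ m : ℕ, s (0, 0) (0, (m : ZMod Δ) * u) := by
    intro m
    induction m with
    | zero => simp
    | succ m ih =>
      refine s.trans ih ?_
      have := hup (m * u)
      push_cast
      rwa [add_mul, one_mul]
  have hall : ∀ z, s (0, 0) z := by
    rintro ⟨i, k⟩
    have := hcol (k * ↑u⁻¹ : ZMod Δ).val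
    rw [ZMod.natCast_zmod_val, mul_assoc, Units.inv_mul, mul_one] at this
    exact s.trans this (hrow' i k)
  exact s.trans (s.symm (hall x)) (hall y)

variable {p q Δ : ℕ}

lemma sameCycle_ite {X : Type} {σ τ : Equiv.Perm X} {P : X → Prop} [DecidablePred P]
    (hσ : ∀ x, σ x = if P x then τ x else τ.symm x) (hP : ∀ x, P (τ x) ↔ P x) (x : X) :
    SameCycle σ x (τ x) := by
  by_cases h : P x
  · exact ⟨1, by simp [hσ, h]⟩
  · have : σ (τ x) = x := by
      rw [hσ, if_neg (by rwa [hP])]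
      simp
    exact SameCycle.symm ⟨1, by simpa using this⟩

lemma sameCycle_rotP [NeZero q] [NeZero Δ] (signP : ZMod p → ℤˣ) {x y : BdryPoint p q Δ}
    (h : x.1 = y.1) : SameCycle (rotP signP) x y := by
  obtain ⟨i, a⟩ := x
  obtain ⟨i', b⟩ := y
  obtain rfl : i = i' := h
  let s : Setoid (ZMod q × ZMod Δ) :=
    (SameCycle.setoid (rotP (q := q) (Δ := Δ) signP)).comap fun a => (i, a)
  refine spiral_transitive 1 s ?_ a b
  intro j k
  exact sameCycle_ite (σ := rotP signP) (τ := alongP p q Δ) (P := fun x => signP x.1 = 1)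
    (fun _ => rfl) (fun _ => Iff.rfl) (i, j, k)

lemma sameCycle_rotQ [NeZero p] [NeZero Δ] (u : (ZMod Δ)ˣ) (signQ : ZMod q → ℤˣ)
    {x y : BdryPoint p q Δ} (h : x.2.1 = y.2.1) : SameCycle (rotQ u signQ) x y := by
  obtain ⟨i, j, k⟩ := x
  obtain ⟨i', j', k'⟩ := y
  obtain rfl : j = j' := h
  let s : Setoid (ZMod p × ZMod Δ) :=
    (SameCycle.setoid (rotQ (p := p) u signQ)).comap fun a => (a.1, j, a.2)
  refine spiral_transitive u s ?_ (i, k) (i', k')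
  intro i k
  exact sameCycle_ite (σ := rotQ u signQ) (τ := alongQ p q u) (P := fun x => signQ x.2.1 = 1)
    (fun _ => rfl) (fun _ => Iff.rfl) (i, j, k)

lemma rotP_fst (signP : ZMod p → ℤˣ) (x : BdryPoint p q Δ) : (rotP signP x).1 = x.1 := by
  change (if signP x.1 = 1 then alongP p q Δ x else (alongP p q Δ).symm x).1 = x.1
  split_ifs <;> rfl

lemma rotP_inv_fst (signP : ZMod p → ℤˣ) (x : BdryPoint p q Δ) :
    ((rotP signP)⁻¹ x).1 = x.1 := by
  have := rotP_fst signP ((rotP signP)⁻¹ x)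
  rw [← this]; simp

lemma rotQ_label (u : (ZMod Δ)ˣ) (signQ : ZMod q → ℤˣ) (x : BdryPoint p q Δ) :
    (rotQ u signQ x).2.1 = x.2.1 := by
  change (if signQ x.2.1 = 1 then alongQ p q u x else (alongQ p q u).symm x).2.1 = x.2.1
  split_ifs <;> rfl

lemma numCycles_rotP [NeZero p] [NeZero q] [NeZero Δ] (signP : ZMod p → ℤˣ) :
    numCycles (rotP (q := q) (Δ := Δ) signP) = p := by
  have e : Quotient (SameCycle.setoid (rotP (q := q) (Δ := Δ) signP)) ≃ ZMod p :=
    { toFun := Quotient.lift (fun x => x.1) fun x y h =>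
        rel_of_sameCycle (s := Setoid.ker fun x : BdryPoint p q Δ => x.1)
          (fun x => (rotP_fst signP x).symm) h
      invFun := fun i => Quotient.mk _ (i, 0, 0)
      left_inv := by
        intro c
        induction c using Quotient.ind
        exact Quotient.sound (sameCycle_rotP signP rfl)
      right_inv := fun _ => rfl }
  rw [numCycles, Nat.card_congr e, Nat.card_zmod]

namespace IntersectionPair

variable (G : IntersectionPair p q Δ)

/-- The sign that a type gives to a corner of `G_P`. -/
def cornerSign (T : ZMod q → ℤˣ) (x : BdryPoint p q Δ) : ℤˣ := G.signP x.1 * T (G.intervalP x)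

/-- The corner that ends at `e`, clockwise before `e`. -/
def prev (e : BdryPoint p q Δ) : BdryPoint p q Δ := (rotP G.signP)⁻¹ e

/-- The labels where a type changes from `-1` to `1`. -/
def ascents (T : ZMod q → ℤˣ) : Set (ZMod q) := {m | T (m - 1) = -1 ∧ T m = 1}

/-- The labels where a type changes from `1` to `-1`. -/
def descents (T : ZMod q → ℤˣ) : Set (ZMod q) := {m | T (m - 1) = 1 ∧ T m = -1}

/-- The edge-endpoints with a label in `M` at one of the two ends of the edge. -/
def touch (M : Set (ZMod q)) : Set (BdryPoint p q Δ) := {e | e.2.1 ∈ M ∨ (G.arc e).2.1 ∈ M}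

/-- The two corners on one side of an edge have different signs. -/
def Change (T : ZMod q → ℤˣ) (e : BdryPoint p q Δ) : Prop :=
  G.cornerSign T (G.prev e) ≠ G.cornerSign T (G.arc e)

lemma arc_ne (x : BdryPoint p q Δ) : G.arc x ≠ x := by
  intro h
  have := G.parity x
  simp [h] at this

lemma arc_mem_touch {M : Set (ZMod q)} {e : BdryPoint p q Δ} (h : e ∈ G.touch M) :
    G.arc e ∈ G.touch M := by
  rcases h with h | h
  · right; rwa [G.arc_arc]
  · left; exact h

lemma arc_mem_touch_iff {M : Set (ZMod q)} {e : BdryPoint p q Δ} :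
    G.arc e ∈ G.touch M ↔ e ∈ G.touch M :=
  arc_mem_iff G.arc_arc (fun _ => G.arc_mem_touch) e

lemma touch_mono {M M' : Set (ZMod q)} (h : M' ⊆ M) : G.touch M' ⊆ G.touch M :=
  fun _ he => he.imp (fun h' => h h') (fun h' => h h')

lemma intervalP_pos {x : BdryPoint p q Δ} (h : G.signP x.1 = 1) : G.intervalP x = x.2.1 :=
  if_pos h

lemma intervalP_neg {x : BdryPoint p q Δ} (h : G.signP x.1 = -1) :
    G.intervalP x = x.2.1 - 1 := if_neg (by rw [h]; decide)

lemma prev_fst (e : BdryPoint p q Δ) : (G.prev e).1 = e.1 := rotP_inv_fst _ _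

lemma prev_label_pos {e : BdryPoint p q Δ} (h : G.signP e.1 = 1) :
    (G.prev e).2.1 = e.2.1 - 1 := by
  change (if G.signP e.1 = 1 then (alongP p q Δ).symm e else alongP p q Δ e).2.1 = _
  rw [if_pos h]; rfl

lemma prev_label_neg {e : BdryPoint p q Δ} (h : G.signP e.1 = -1) :
    (G.prev e).2.1 = e.2.1 + 1 := by
  change (if G.signP e.1 = 1 then (alongP p q Δ).symm e else alongP p q Δ e).2.1 = _
  rw [if_neg (by rw [h]; decide)]; rfl

lemma intervalP_prev_pos {e : BdryPoint p q Δ} (h : G.signP e.1 = 1) :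
    G.intervalP (G.prev e) = e.2.1 - 1 := by
  rw [intervalP_pos _ (by rwa [prev_fst]), prev_label_pos _ h]

lemma intervalP_prev_neg {e : BdryPoint p q Δ} (h : G.signP e.1 = -1) :
    G.intervalP (G.prev e) = e.2.1 := by
  rw [intervalP_neg _ (by rwa [prev_fst]), prev_label_neg _ h]; ring

lemma cornerSign_prev (T : ZMod q → ℤˣ) (e : BdryPoint p q Δ) :
    G.cornerSign T (G.prev e) = if G.signP e.1 = 1 then T (e.2.1 - 1) else - T e.2.1 := by
  unfold cornerSign
  rcases Int.units_eq_one_or (G.signP e.1) with h | h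
  · rw [intervalP_prev_pos _ h, prev_fst, h]; simp
  · rw [intervalP_prev_neg _ h, prev_fst, h]
    simp [show (-1 : ℤˣ) ≠ 1 by decide]

lemma cornerSign_eq (T : ZMod q → ℤˣ) (e : BdryPoint p q Δ) :
    G.cornerSign T e = if G.signP e.1 = 1 then T e.2.1 else - T (e.2.1 - 1) := by
  unfold cornerSign
  rcases Int.units_eq_one_or (G.signP e.1) with h | h
  · rw [intervalP_pos _ h, h]; simp
  · rw [intervalP_neg _ h, h]
    simp [show (-1 : ℤˣ) ≠ 1 by decide]

lemma cornerSign_of_ascent {T : ZMod q → ℤˣ} {e : BdryPoint p q Δ} (h : e.2.1 ∈ ascents T) :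
    G.cornerSign T (G.prev e) = -1 ∧ G.cornerSign T e = 1 := by
  rw [cornerSign_prev, cornerSign_eq, h.1, h.2]
  split_ifs <;> simp

lemma cornerSign_of_descent {T : ZMod q → ℤˣ} {e : BdryPoint p q Δ} (h : e.2.1 ∈ descents T) :
    G.cornerSign T (G.prev e) = 1 ∧ G.cornerSign T e = -1 := by
  rw [cornerSign_prev, cornerSign_eq, h.1, h.2]
  split_ifs <;> simp

lemma cornerSign_of_eq {T : ZMod q → ℤˣ} {e : BdryPoint p q Δ} (h : T (e.2.1 - 1) = T e.2.1) :
    G.cornerSign T (G.prev e) = G.cornerSign T e := by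
  rw [cornerSign_prev, cornerSign_eq, h]

lemma switch_cases (T : ZMod q → ℤˣ) (m : ZMod q) :
    m ∈ ascents T ∨ m ∈ descents T ∨ T (m - 1) = T m := by
  rcases Int.units_eq_one_or (T (m - 1)) with h | h <;>
    rcases Int.units_eq_one_or (T m) with h' | h' <;> simp [ascents, descents, h, h']

/-- The type `T` switches only at labels in `M`, and each simply connected region of the graph of
the edges at labels in `M` has an edge side on its boundary with a sign change. -/
structure Unrepresented (M : Set (ZMod q)) (T : ZMod q → ℤˣ) : Prop where
  switch : ∀ j ∉ M, T (j - 1) = T j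
  change : ∀ R : Quotient (G.GP.region (G.touch M)), G.GP.defect (G.touch M) R = 1 →
    ∃ e ∈ G.touch M, G.arc e ∈ G.GP.regionSet (G.touch M) R ∧ G.Change T e

lemma Unrepresented.neg {G : IntersectionPair p q Δ} {M : Set (ZMod q)} {T : ZMod q → ℤˣ}
    (h : G.Unrepresented M T) : G.Unrepresented M (-T) := by
  refine ⟨fun j hj => by simp [h.switch j hj], fun R hR => ?_⟩
  obtain ⟨e, he, heR, hc⟩ := h.change R hR
  refine ⟨e, he, heR, ?_⟩
  simpa [Change, cornerSign] using hc

variable [NeZero p] [NeZero q] [NeZero Δ]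

omit [NeZero p] in
lemma not_freeVertex_touch {M : Set (ZMod q)} (hM : M.Nonempty) (x : BdryPoint p q Δ) :
    ¬ FreeVertex (rotP G.signP) (G.touch M) x := by
  obtain ⟨m, hm⟩ := hM
  intro h
  exact h (x.1, m, 0) (sameCycle_rotP _ rfl) (Or.inl hm)

lemma defect_touch_le_one {M : Set (ZMod q)} (hM : M.Nonempty)
    (R : Quotient (G.GP.region (G.touch M))) : G.GP.defect (G.touch M) R ≤ 1 := by
  obtain ⟨x, rfl⟩ := Quotient.exists_rep R
  exact defect_le_one G.arc_arc (fun _ => G.arc_mem_touch) (z₀ := x) rfl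
    (G.not_freeVertex_touch hM x)

end IntersectionPair

end DehnGraphs

namespace DehnGraphs

open Equiv.Perm SphereGraph

variable {p q Δ : ℕ}

namespace IntersectionPair

variable (G : IntersectionPair p q Δ)

lemma arc_rot_prev (e : BdryPoint p q Δ) : G.arc (rotP G.signP (G.prev e)) = G.arc e := by
  simp [prev]

lemma sameFace_prev (e : BdryPoint p q Δ) : G.GP.sameFace (G.prev e) (G.arc e) := by
  have := G.GP.boundary (G.prev e)
  rwa [arc_rot_prev] at this

variable {G} in
lemma prev_mem_regionSet {Y : Set (BdryPoint p q Δ)} {R : Quotient (G.GP.region Y)}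
    {e : BdryPoint p q Δ} : G.prev e ∈ G.GP.regionSet Y R ↔ G.arc e ∈ G.GP.regionSet Y R :=
  regionSet_iff (region_of_sameFace (G.sameFace_prev e))

variable {G} in
lemma arc_mem_regionSet {M : Set (ZMod q)} {R : Quotient (G.GP.region (G.touch M))}
    {e : BdryPoint p q Δ} (he : e ∉ G.touch M) :
    G.arc e ∈ G.GP.regionSet (G.touch M) R ↔ e ∈ G.GP.regionSet (G.touch M) R :=
  (regionSet_iff (region_arc G.arc_arc (fun _ => G.arc_mem_touch) he)).symm

variable {G} in
lemma Unrepresented.cornerSign_prev {M : Set (ZMod q)} {T : ZMod q → ℤˣ}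
    (h : G.Unrepresented M T) {e : BdryPoint p q Δ} (he : e ∉ G.touch M) :
    G.cornerSign T (G.prev e) = G.cornerSign T e :=
  G.cornerSign_of_eq (h.switch _ fun h' => he (Or.inl h'))

variable [NeZero p] [NeZero q] [NeZero Δ]

open Classical in
/-- The edge sides on the boundary of a region. -/
noncomputable def sides {Y : Set (BdryPoint p q Δ)} (R : Quotient (G.GP.region Y)) :
    Finset (BdryPoint p q Δ) := {e | G.arc e ∈ G.GP.regionSet Y R}

lemma mem_sides {Y : Set (BdryPoint p q Δ)} {R : Quotient (G.GP.region Y)}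
    {e : BdryPoint p q Δ} : e ∈ G.sides R ↔ G.arc e ∈ G.GP.regionSet Y R := by
  simp [sides]

@[to_additive]
lemma prod_sides {A : Type} [CommMonoid A] {Y : Set (BdryPoint p q Δ)}
    (R : Quotient (G.GP.region Y)) (f : BdryPoint p q Δ → A) :
    ∏ e ∈ G.sides R, f (G.prev e) = ∏ e ∈ G.sides R, f (G.arc e) := by
  classical
  refine Finset.prod_bij' (fun e _ => G.arc (G.prev e))
    (fun e _ => rotP G.signP (G.arc e)) ?_ ?_ ?_ ?_ ?_
  · intro e he
    rw [mem_sides] at he ⊢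
    rwa [G.arc_arc, prev_mem_regionSet]
  · intro e he
    rw [mem_sides] at he ⊢
    rw [← prev_mem_regionSet]
    simpa [prev] using he
  · intro e _
    simp [G.arc_arc, prev]
  · intro e _
    simp [G.arc_arc, prev]
  · intro e _
    rw [G.arc_arc]

@[to_additive]
lemma prod_sides_arc {A : Type} [CommMonoid A] {M : Set (ZMod q)} [DecidablePred (· ∈ G.touch M)]
    (R : Quotient (G.GP.region (G.touch M))) (f : BdryPoint p q Δ → A) :
    ∏ e ∈ G.sides R with e ∉ G.touch M, f (G.arc e)
      = ∏ e ∈ G.sides R with e ∉ G.touch M, f e := by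
  refine Finset.prod_bij' (fun e _ => G.arc e) (fun e _ => G.arc e) ?_ ?_ ?_ ?_ ?_
  · intro e he
    rw [Finset.mem_filter, mem_sides] at he ⊢
    rw [G.arc_mem_touch_iff, G.arc_arc, ← arc_mem_regionSet he.2]
    exact he
  · intro e he
    rw [Finset.mem_filter, mem_sides] at he ⊢
    rw [G.arc_mem_touch_iff, G.arc_arc, ← arc_mem_regionSet he.2]
    exact he
  · intro e _
    exact G.arc_arc e
  · intro e _
    exact G.arc_arc e
  · intro e _
    rfl

open Classical in
/-- Twice the defect of a region is at most the number of sign changes on its sides. -/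
lemma Unrepresented.two_mul_defect_le {G : IntersectionPair p q Δ} {M : Set (ZMod q)}
    (hM : M.Nonempty) {T : ZMod q → ℤˣ} (h : G.Unrepresented M T)
    (R : Quotient (G.GP.region (G.touch M))) :
    2 * G.GP.defect (G.touch M) R
      ≤ ({e ∈ G.sides R | e ∈ G.touch M ∧ G.Change T e} : Finset _).card := by
  have h1 := G.defect_touch_le_one hM R
  by_cases hR : G.GP.defect (G.touch M) R = 1
  · rw [hR]
    obtain ⟨e, he, heR, hc⟩ := h.change R hR
    have hmem : e ∈ ({e ∈ G.sides R | e ∈ G.touch M ∧ G.Change T e} : Finset _) := by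
      simp [mem_sides, he, heR, hc]
    have h2 : 1 < ({e ∈ G.sides R | e ∈ G.touch M ∧ G.Change T e} : Finset _).card := by
      by_contra hlt
      have hone : ({e ∈ G.sides R | e ∈ G.touch M ∧ G.Change T e} : Finset _) = {e} :=
        (Finset.card_eq_one.1 (le_antisymm (not_lt.1 hlt) (Finset.card_pos.2 ⟨e, hmem⟩))).elim
          fun a ha => by rw [ha] at hmem ⊢; rw [Finset.mem_singleton.1 hmem]
      have hprod : ∏ e ∈ G.sides R, G.cornerSign T (G.prev e) * G.cornerSign T (G.arc e) = 1 := by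
        rw [Finset.prod_mul_distrib, G.prod_sides R, ← Finset.prod_mul_distrib]
        exact Finset.prod_eq_one fun x _ => Int.units_mul_self _
      rw [← Finset.prod_filter_mul_prod_filter_not (G.sides R) (fun e => e ∈ G.touch M)] at hprod
      have hout : ∏ e ∈ G.sides R with e ∉ G.touch M,
          G.cornerSign T (G.prev e) * G.cornerSign T (G.arc e) = 1 := by
        rw [Finset.prod_mul_distrib, G.prod_sides_arc R, ← Finset.prod_mul_distrib]
        refine Finset.prod_eq_one fun x hx => ?_
        rw [h.cornerSign_prev (Finset.mem_filter.1 hx).2]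
        exact Int.units_mul_self _
      rw [hout, mul_one, Finset.prod_eq_single_of_mem e] at hprod
      · have : G.cornerSign T (G.prev e) = G.cornerSign T (G.arc e) := by
          rw [← Int.units_inv_eq_self (G.cornerSign T (G.arc e))]
          exact eq_inv_of_mul_eq_one_left hprod
        exact hc this
      · simp [mem_sides, he, heR]
      · intro x hx hne
        rw [Finset.mem_filter] at hx
        by_cases hcx : G.Change T x
        · have : x ∈ ({e ∈ G.sides R | e ∈ G.touch M ∧ G.Change T e} : Finset _) := by
            simp [hx, hcx]
          rw [hone, Finset.mem_singleton] at this
          exact absurd this hne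
        · rw [Change, not_ne_iff] at hcx
          rw [hcx]
          exact Int.units_mul_self _
    omega
  · have : G.GP.defect (G.touch M) R ≤ 0 := by omega
    omega

open Classical in
lemma sum_card_sides {Y : Set (BdryPoint p q Δ)} [Fintype (Quotient (G.GP.region Y))]
    (s : Finset (Quotient (G.GP.region Y)))
    (P : BdryPoint p q Δ → Prop) [DecidablePred P] :
    ∑ R ∈ s, ({e ∈ G.sides R | P e} : Finset _).card
      = ({e | P e ∧ Quotient.mk (G.GP.region Y) (G.arc e) ∈ s} : Finset _).card := by
  rw [Finset.card_eq_sum_card_fiberwise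
    (f := fun e => Quotient.mk (G.GP.region Y) (G.arc e)) (t := s)]
  · refine Finset.sum_congr rfl fun R hR => ?_
    congr 1
    ext e
    simp only [Finset.mem_filter, mem_sides, Finset.mem_univ, true_and, regionSet,
      Set.mem_ofPred_eq]
    constructor
    · rintro ⟨rfl, h⟩
      exact ⟨⟨h, hR⟩, rfl⟩
    · rintro ⟨⟨h, -⟩, rfl⟩
      exact ⟨rfl, h⟩
  · intro e he
    simp only [Finset.coe_filter, Finset.mem_univ, true_and, Set.mem_ofPred_eq] at he
    exact he.2

open Classical in
/-- The number of edge sides without a sign change is bounded. -/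
lemma Unrepresented.card_not_change_le {G : IntersectionPair p q Δ} {M : Set (ZMod q)}
    (hM : M.Nonempty) {T : ZMod q → ℤˣ} (h : G.Unrepresented M T) :
    ({e | e ∈ G.touch M ∧ ¬ G.Change T e} : Finset _).card + 4 ≤ 2 * p := by
  have := Fintype.ofFinite (Quotient (G.GP.region (G.touch M)))
  have h1 := two_mul_sum_defect (G := G.GP) (Y := G.touch M) G.arc_arc
    (fun _ => G.arc_mem_touch) G.arc_ne
  rw [cellCount_eq_zero (G.not_freeVertex_touch hM), numCycles_rotP, Finset.mul_sum] at h1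
  have h2 := Finset.sum_le_sum fun R (_ : R ∈ Finset.univ) => h.two_mul_defect_le hM R
  rw [← Nat.cast_sum, G.sum_card_sides] at h2
  rw [Nat.card_eq_fintype_card, Fintype.card_subtype] at h1
  have h3 := Finset.card_filter_add_card_filter_not (s := {e | e ∈ G.touch M})
    (fun e => G.Change T e)
  simp only [Finset.filter_filter, Finset.mem_univ, and_true] at h2 h3
  push_cast at h1
  omega

open Classical in
omit [NeZero p] [NeZero q] [NeZero Δ] in
lemma not_change_iff_of_const {T : ZMod q → ℤˣ} {c : ℤˣ} (hT : ∀ j, T j = c) (e : BdryPoint p q Δ) :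
    ¬ G.Change T e ↔ G.signQ e.2.1 ≠ G.signQ (G.arc e).2.1 := by
  rw [← G.parity, Change, not_ne_iff]
  simp [cornerSign, hT, prev_fst]

open Classical in
/-- For a constant type, the edges of `G_Q` between vertices of opposite signs are few. -/
lemma Unrepresented.card_negative_le {G : IntersectionPair p q Δ} {M : Set (ZMod q)}
    (hM : M.Nonempty) {T : ZMod q → ℤˣ} (h : G.Unrepresented M T) {c : ℤˣ} (hT : ∀ j, T j = c) :
    ({e | e ∈ G.touch M ∧ G.signQ e.2.1 ≠ G.signQ (G.arc e).2.1} : Finset _).card + 4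
      ≤ 2 * p := by
  have := h.card_not_change_le hM
  simpa only [G.not_change_iff_of_const hT] using this

open Classical in
/-- The edge-endpoints at labels in `S` whose edge has its other end at a label outside `S`. -/
noncomputable def leaving (S : Set (ZMod q)) : Finset (BdryPoint p q Δ) :=
  {e | e.2.1 ∈ S ∧ (G.arc e).2.1 ∉ S}

lemma mem_leaving {S : Set (ZMod q)} {e : BdryPoint p q Δ} :
    e ∈ G.leaving S ↔ e.2.1 ∈ S ∧ (G.arc e).2.1 ∉ S := by
  simp [leaving]

lemma sum_arc {A : Type} [AddCommMonoid A] (f : BdryPoint p q Δ → A) :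
    ∑ e, f (G.arc e) = ∑ e, f e := Equiv.sum_comp G.arc f

/-- For a type that is not constant, few edges leave the ascents and the descents. -/
lemma Unrepresented.card_leaving_le {G : IntersectionPair p q Δ} {M : Set (ZMod q)}
    (hM : M.Nonempty) {T : ZMod q → ℤˣ} (h : G.Unrepresented M T) :
    (G.leaving (ascents T)).card + (G.leaving (descents T)).card + 4 ≤ 2 * p := by
  classical
  have h1 := h.card_not_change_le hM
  have hsub : ∀ m, m ∈ ascents T ∨ m ∈ descents T → m ∈ M := by
    intro m hm
    by_contra hM
    have := h.switch m hM
    rcases hm with ⟨h2, h3⟩ | ⟨h2, h3⟩ <;> rw [h2, h3] at this <;> exact absurd this (by decide)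
  have hpt : ∀ e, (((if e ∈ G.leaving (ascents T) then 1 else 0)
      + if e ∈ G.leaving (descents T) then 1 else 0)
      + (((if G.arc e ∈ G.leaving (ascents T) then 1 else 0)
      + if G.arc e ∈ G.leaving (descents T) then 1 else 0)) : ℕ)
      ≤ (if e ∈ G.touch M ∧ ¬ G.Change T e then 1 else 0)
      + if G.arc e ∈ G.touch M ∧ ¬ G.Change T (G.arc e) then 1 else 0 := by
    intro e
    have hd : ∀ m, m ∈ ascents T → m ∉ descents T := fun m h h' => by
      have := h.1.symm.trans h'.1
      exact absurd this (by decide)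
    have key : ∀ f : BdryPoint p q Δ,
        (f.2.1 ∈ ascents T ∧ f.2.1 ∉ descents T ∧ f ∈ G.touch M ∧
          G.cornerSign T (G.prev f) = -1 ∧ G.cornerSign T f = 1) ∨
        (f.2.1 ∈ descents T ∧ f.2.1 ∉ ascents T ∧ f ∈ G.touch M ∧
          G.cornerSign T (G.prev f) = 1 ∧ G.cornerSign T f = -1) ∨
        (f.2.1 ∉ descents T ∧ f.2.1 ∉ ascents T ∧
          G.cornerSign T (G.prev f) = G.cornerSign T f) := by
      intro f
      rcases switch_cases T f.2.1 with h2 | h2 | h2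
      · exact Or.inl ⟨h2, hd _ h2, Or.inl (hsub _ (Or.inl h2)), G.cornerSign_of_ascent h2⟩
      · exact Or.inr (Or.inl ⟨h2, fun h' => hd _ h' h2, Or.inl (hsub _ (Or.inr h2)),
          G.cornerSign_of_descent h2⟩)
      · refine Or.inr (Or.inr ⟨fun h3 => ?_, fun h3 => ?_, G.cornerSign_of_eq h2⟩) <;>
          rw [h3.1, h3.2] at h2 <;> exact absurd h2 (by decide)
    simp only [mem_leaving, G.arc_arc, Change, not_ne_iff, G.arc_mem_touch_iff]
    have hu := Int.units_eq_one_or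
    rcases key e with ⟨a1, a2, a3, a4, a5⟩ | ⟨a1, a2, a3, a4, a5⟩ | ⟨a1, a2, a5⟩ <;>
    rcases key (G.arc e) with ⟨b1, b2, b3, b4, b5⟩ | ⟨b1, b2, b3, b4, b5⟩ | ⟨b1, b2, b5⟩ <;>
    first
    | simp [*]; done
    | (simp [a1, a2, a3, a4, a5, b1, b2, b5]
       rcases hu (G.cornerSign T (G.arc e)) with h | h <;> simp [h])
    | (rw [G.arc_mem_touch_iff] at b3
       simp [a1, a2, a5, b1, b2, b3, b4, b5]
       rcases hu (G.cornerSign T e) with h | h <;> simp [h])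
  have h2 := Finset.sum_le_sum fun e (_ : e ∈ Finset.univ) => hpt e
  have e1 := G.sum_arc fun e => if e ∈ G.leaving (ascents T) then 1 else 0
  have e2 := G.sum_arc fun e => if e ∈ G.leaving (descents T) then 1 else 0
  have e3 := G.sum_arc fun e => if e ∈ G.touch M ∧ ¬ G.Change T e then 1 else 0
  simp only [Finset.sum_add_distrib] at h2
  rw [e1, e2, e3] at h2
  simp only [Finset.sum_boole, Nat.cast_id, Finset.filter_mem_eq_inter, Finset.univ_inter] at h2
  omega

end IntersectionPair

end DehnGraphs

namespace DehnGraphs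

open Equiv.Perm SphereGraph

variable {p q Δ : ℕ}

namespace IntersectionPair

variable (G : IntersectionPair p q Δ)

/-- The parity of a sign. -/
def signBit (a : ℤˣ) : ZMod 2 := if a = 1 then 0 else 1

lemma signBit_injective {a b : ℤˣ} (h : signBit a = signBit b) : a = b := by
  rcases Int.units_eq_one_or a with rfl | rfl <;> rcases Int.units_eq_one_or b with rfl | rfl <;>
    simp_all [signBit, show (-1 : ℤˣ) ≠ 1 by decide]

lemma signBit_add_eq_zero {a b : ℤˣ} (h : signBit a + signBit b = 0) : a = b := by
  apply signBit_injective
  have : signBit a + signBit b + signBit b = signBit b := by rw [h]; simp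
  rwa [add_assoc, zmod2_add_self, add_zero] at this

variable [NeZero p] [NeZero q] [NeZero Δ]

/-- In a region of defect one, a type without sign changes on the sides gives the same sign to
all corners. -/
lemma cornerSign_const {M : Set (ZMod q)} (hM : M.Nonempty) {T : ZMod q → ℤˣ}
    (hT : ∀ j ∉ M, T (j - 1) = T j) {R : Quotient (G.GP.region (G.touch M))}
    (hR : G.GP.defect (G.touch M) R = 1)
    (hc : ∀ e ∈ G.touch M, G.arc e ∈ G.GP.regionSet (G.touch M) R → ¬ G.Change T e) :
    ∃ ν, ∀ x ∈ G.GP.regionSet (G.touch M) R, G.cornerSign T x = ν := by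
  classical
  let σ : Equiv.Perm (BdryPoint p q Δ) := G.arc * rotP G.signP
  obtain ⟨x₀, rfl⟩ := Quotient.exists_rep R
  set R := Quotient.mk (G.GP.region (G.touch M)) x₀
  have hx₀ : x₀ ∈ G.GP.regionSet (G.touch M) R := rfl
  have hprev : ∀ e ∉ G.touch M, G.cornerSign T (G.prev e) = G.cornerSign T e := fun e he =>
    G.cornerSign_of_eq (hT _ fun h' => he (Or.inl h'))
  obtain ⟨f, φ, -, hf, hφ, hg, hk⟩ := region_exact G.arc_arc (fun _ => G.arc_mem_touch) hx₀
    (G.not_freeVertex_touch hM x₀) hR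
    (fun x => signBit (G.cornerSign T x) + signBit (G.cornerSign T (G.arc x)))
    (fun x => signBit (G.cornerSign T x)) (fun x _ _ => by rw [G.arc_arc, add_comm]) (by
      intro x hx
      have h1 : ∀ z, (if G.GP.sameFace z x ∧ rotP G.signP z ∉ G.touch M then
          signBit (G.cornerSign T (rotP G.signP z))
            + signBit (G.cornerSign T (G.arc (rotP G.signP z))) else 0)
          = (if G.GP.sameFace z x then signBit (G.cornerSign T z) else 0)
            + if G.GP.sameFace (σ z) x then
              signBit (G.cornerSign T (σ z)) else 0 := by
        intro z
        have hz : G.prev (rotP G.signP z) = z := by simp [prev]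
        have h2 : G.GP.sameFace (σ z) x ↔ G.GP.sameFace z x :=
          ⟨fun h => G.GP.sameFace.trans (G.GP.boundary z) h,
            fun h => G.GP.sameFace.trans (G.GP.sameFace.symm (G.GP.boundary z)) h⟩
        by_cases h : G.GP.sameFace z x
        · rw [if_pos h, if_pos (h2.2 h)]
          by_cases h3 : rotP G.signP z ∈ G.touch M
          · rw [if_neg fun h' => h'.2 h3]
            have h4 := hc _ h3 ((regionSet_iff (G := G.GP) (region_of_sameFace (h2.2 h))).2 hx)
            rw [Change, not_ne_iff, hz] at h4
            rw [h4]
            exact (zmod2_add_self _).symm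
          · rw [if_pos ⟨h, h3⟩, ← hprev _ h3, hz]
            rfl
        · rw [if_neg h, if_neg fun h' => h h'.1, if_neg fun h' => h (h2.1 h'), add_zero]
      rw [Finset.sum_congr rfl fun z _ => h1 z, Finset.sum_add_distrib,
        Equiv.sum_comp σ fun z =>
          if G.GP.sameFace z x then signBit (G.cornerSign T z) else 0, zmod2_add_self])
  have hf0 : ∀ x, f x = 0 := fun x => hf x (G.not_freeVertex_touch hM x)
  simp only [hf0, add_zero] at hg hk
  have hg' : ∀ x ∈ G.GP.regionSet (G.touch M) R, x ∉ G.touch M →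
      G.cornerSign T x = G.cornerSign T (G.arc x) := fun x hx hxY =>
    signBit_add_eq_zero (hg x hx hxY).symm
  let F : BdryPoint p q Δ → ℤˣ := fun x =>
    if x ∈ G.GP.regionSet (G.touch M) R then G.cornerSign T x else 1
  have hF : ∀ x y, G.GP.region (G.touch M) x y →
      (x ∈ G.GP.regionSet (G.touch M) R → y ∈ G.GP.regionSet (G.touch M) R →
        G.cornerSign T x = G.cornerSign T y) → F x = F y := by
    intro x y hxy h
    have h1 := regionSet_iff (R := R) hxy
    by_cases hx : x ∈ G.GP.regionSet (G.touch M) R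
    · simp only [F]
      rw [if_pos hx, if_pos (h1.1 hx), h hx (h1.1 hx)]
    · simp only [F]
      rw [if_neg hx, if_neg fun hy => hx (h1.2 hy)]
  have hcyc : ∀ z, F z = F (σ z) := by
    intro z
    refine hF _ _ (region_next _ _ _) fun h1 h2 => ?_
    have hz : G.prev (rotP G.signP z) = z := by simp [prev]
    by_cases h3 : rotP G.signP z ∈ G.touch M
    · have h4 := hc _ h3 h2
      rw [Change, not_ne_iff, hz] at h4
      exact h4
    · have h5 := hprev _ h3
      rw [hz] at h5
      rw [h5]
      exact hg' _ ((regionSet_iff (region_rot h3)).1 h1) h3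
  have hbase : ∀ z, F (base (rotP G.signP) G.arc z) = F z := fun z =>
    rel_of_sameCycle (s := Setoid.ker F) hcyc (sameCycle_base z)
  have hin : ∀ x ∈ G.GP.regionSet (G.touch M) R, F x = G.cornerSign T x := fun x hx => if_pos hx
  refine ⟨F x₀, fun x hx => ?_⟩
  rw [← hin x hx]
  refine region_le (s := Setoid.ker F) ?_ ?_ (regionSet_rel hx hx₀)
  · intro x y h
    refine hF _ _ (region_of_sameFace h) fun h1 h2 => signBit_injective ?_
    have hb : ∀ z ∈ G.GP.regionSet (G.touch M) R,
        G.cornerSign T (base (rotP G.signP) G.arc z) = G.cornerSign T z := by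
      intro z hz
      rw [← hin z hz, ← hbase z]
      refine (hin _ ((regionSet_iff ?_).1 hz)).symm
      exact rel_of_sameCycle (region_next G.GP _) (sameCycle_base z).symm
    rw [← hb x h1, ← hb y h2, ← hk x h1, ← hk y h2, hφ x y h]
  · intro x h
    refine hF _ _ (region_rot h) fun _ _ => ?_
    have := hprev _ h
    rwa [show G.prev (rotP G.signP x) = x by simp [prev]] at this

open Classical in
/-- The weight `-2` of an edge side without sign change. -/
noncomputable def deficit (M : Set (ZMod q)) (T : ZMod q → ℤˣ) (e : BdryPoint p q Δ) : ℤ :=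
  if e ∈ G.touch M ∧ ¬ G.Change T e then -2 else 0

open Classical in
/-- A potential that bounds the sign changes of `T` transfers the property of being unrepresented
to another type with fewer switches. -/
lemma Unrepresented.transfer {G : IntersectionPair p q Δ} {M M' : Set (ZMod q)}
    {T T' : ZMod q → ℤˣ} (h : G.Unrepresented M T) (hsub : M' ⊆ M) (hne : M'.Nonempty)
    (hT' : ∀ j ∉ M', T' (j - 1) = T' j)
    (hΦ : ∀ ν : ℤˣ, ∃ Φ : BdryPoint p q Δ → ℤ,
      (∀ e ∈ G.touch M', G.cornerSign T' (G.prev e) = ν → G.cornerSign T' (G.arc e) = ν →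
        (if G.Change T e then 2 else 0) ≤ Φ (G.arc e) - Φ (G.prev e)) ∧
      ∀ e ∉ G.touch M', G.cornerSign T' e = ν → G.cornerSign T' (G.arc e) = ν →
        G.deficit M T e + G.deficit M T (G.arc e) ≤
          (Φ e - Φ (G.prev e)) + (Φ (G.arc e) - Φ (G.prev (G.arc e)))) :
    G.Unrepresented M' T' := by
  refine ⟨hT', fun R' hR' => ?_⟩
  by_contra! hcon
  obtain ⟨ν, hν⟩ := G.cornerSign_const hne hT' hR' fun e he heR hc => hcon e he heR hc
  obtain ⟨Φ, hΦ1, hΦ2⟩ := hΦ ν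
  have := Fintype.ofFinite (Quotient (G.GP.region (G.touch M)))
  have hM : M.Nonempty := hne.mono hsub
  have hsubY := G.touch_mono hsub
  have h1 := two_mul_sum_defect_regionMap G.arc_arc G.arc_ne (fun _ => G.arc_mem_touch)
    (fun _ => G.arc_mem_touch) hsubY (G.not_freeVertex_touch hne) R'
  have h2 := Finset.sum_le_sum fun R
    (_ : R ∈ (Finset.univ.filter fun R => regionMap G.GP hsubY R = R')) =>
    h.two_mul_defect_le hM R
  rw [← Finset.mul_sum, h1, hR', ← Nat.cast_sum, G.sum_card_sides, Nat.card_eq_fintype_card,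
    Fintype.card_subtype] at h2
  -- all quantities as sums over the sides of the region
  have h3 : ({e | (e ∉ G.touch M' ∧ Quotient.mk (G.GP.region (G.touch M')) e = R')
      ∧ e ∈ G.touch M} : Finset (BdryPoint p q Δ))
      = {e ∈ G.sides R' | e ∉ G.touch M' ∧ e ∈ G.touch M} := by
    ext e
    simp only [Finset.mem_filter, Finset.mem_univ, true_and, mem_sides]
    constructor
    · rintro ⟨⟨a, b⟩, c⟩
      exact ⟨(arc_mem_regionSet a).2 b, a, c⟩
    · rintro ⟨a, b, c⟩
      exact ⟨⟨b, (arc_mem_regionSet b).1 a⟩, c⟩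
  have h4 : ({e | (e ∈ G.touch M ∧ G.Change T e) ∧ Quotient.mk (G.GP.region (G.touch M)) (G.arc e)
      ∈ Finset.univ.filter fun R => regionMap G.GP hsubY R = R'} : Finset (BdryPoint p q Δ))
      = {e ∈ G.sides R' | e ∈ G.touch M ∧ G.Change T e} := by
    ext e
    simp only [Finset.mem_filter, Finset.mem_univ, true_and, mem_sides, and_comm]
    rfl
  rw [h3, h4, Finset.card_filter, Finset.card_filter] at h2
  push_cast at h2
  have h5 : ∑ e ∈ G.sides R', ((if e ∈ G.touch M ∧ G.Change T e then 1 else 0 : ℤ)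
      - if e ∉ G.touch M' ∧ e ∈ G.touch M then 1 else 0) ≥ 2 := by
    rw [Finset.sum_sub_distrib]
    linarith
  have h6 : ∀ e, 2 * ((if e ∈ G.touch M ∧ G.Change T e then 1 else 0 : ℤ)
      - if e ∉ G.touch M' ∧ e ∈ G.touch M then 1 else 0)
      = (if e ∈ G.touch M' then (if G.Change T e then 2 else 0) else G.deficit M T e) := by
    intro e
    have key : ∀ a b c : Prop, (a → b) → 2 * ((if b ∧ c then 1 else 0 : ℤ)
        - if ¬ a ∧ b then 1 else 0) = if a then (if c then 2 else 0) else if b ∧ ¬ c then -2 else 0 := by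
      clear * -
      intro a b c h
      by_cases ha : a <;> by_cases hb : b <;> by_cases hc : c <;> simp_all
    exact key _ _ _ (@hsubY e)
  have h7 := G.sum_sides R' Φ
  have h8 := Finset.mul_sum (G.sides R') (fun e =>
    ((if e ∈ G.touch M ∧ G.Change T e then 1 else 0 : ℤ)
      - if e ∉ G.touch M' ∧ e ∈ G.touch M then 1 else 0)) 2
  simp only [h6] at h8
  rw [Finset.sum_ite] at h8
  have h9 := G.sum_sides_arc R' (fun e => G.deficit M T e)
  have h10 := G.sum_sides_arc R' (fun e => Φ (G.prev e))
  have h11 := G.sum_sides_arc R' (fun e => Φ e)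
  have h12 := Finset.sum_le_sum (s := G.sides R' |>.filter fun e => e ∈ G.touch M')
    (f := fun e => if G.Change T e then 2 else 0) (g := fun e => Φ (G.arc e) - Φ (G.prev e)) (by
      intro e he
      rw [Finset.mem_filter, mem_sides] at he
      exact hΦ1 e he.2 (hν _ (prev_mem_regionSet.2 he.1)) (hν _ he.1))
  have h13 := Finset.sum_le_sum (s := G.sides R' |>.filter fun e => e ∉ G.touch M')
    (f := fun e => G.deficit M T e + G.deficit M T (G.arc e))
    (g := fun e => (Φ e - Φ (G.prev e)) + (Φ (G.arc e) - Φ (G.prev (G.arc e)))) (by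
      intro e he
      rw [Finset.mem_filter, mem_sides] at he
      exact hΦ2 e he.2 (hν _ ((arc_mem_regionSet he.2).1 he.1)) (hν _ he.1))
  rw [Finset.sum_sub_distrib] at h12
  rw [Finset.sum_add_distrib, Finset.sum_add_distrib, Finset.sum_sub_distrib,
    Finset.sum_sub_distrib, h9, h10] at h13
  rw [← Finset.sum_filter_add_sum_filter_not (G.sides R') (fun e => e ∈ G.touch M'),
    ← Finset.sum_filter_add_sum_filter_not (G.sides R') (fun e => e ∈ G.touch M')
      (fun e => Φ (G.arc e))] at h7
  linarith

end IntersectionPair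

end DehnGraphs

namespace DehnGraphs

open Equiv.Perm SphereGraph

namespace SphereGraph

variable {X : Type} {rot arc : Equiv.Perm X} {G : SphereGraph rot arc}

lemma region_univ_iff {x y : X} : G.region Set.univ x y ↔ G.sameFace x y :=
  ⟨region_le (fun _ _ h => h) (fun _ h => absurd (Set.mem_univ _) h), region_of_sameFace⟩

/-- A disk face, as a region of the whole graph. -/
lemma isDisk_of_defect [Finite X] {x₀ : X}
    (h : G.defect Set.univ (Quotient.mk _ x₀) = 1) :
    Face.IsDisk (G := G) (Quotient.mk G.sameFace x₀) := by
  classical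
  have hR : ∀ {x}, Quotient.mk (G.region Set.univ) x = Quotient.mk _ x₀ ↔ G.sameFace x x₀ :=
    ⟨fun h => region_univ_iff.1 (Quotient.exact h), fun h => Quotient.sound (region_univ_iff.2 h)⟩
  unfold defect at h
  rw [cellCount_eq_zero (s := SameCycle.setoid arc) (by simp),
    cellCount_eq_zero (s := SameCycle.setoid rot) (by
      intro x hx
      exact hx.1 x (SameCycle.refl _ _) (Set.mem_univ _))] at h
  have h1 : cellCount G.sameFace
      (fun x => True ∧ Quotient.mk (G.region Set.univ) x = Quotient.mk _ x₀) ≤ 1 := by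
    unfold cellCount
    rw [Finite.card_le_one_iff_subsingleton]
    constructor
    rintro ⟨c, -, hc⟩ ⟨d, -, hd⟩
    rw [hR] at hc hd
    rw [Subtype.mk.injEq, ← Quotient.out_eq c, ← Quotient.out_eq d]
    exact Quotient.sound (G.sameFace.trans hc (G.sameFace.symm hd))
  have h2 : cellCount (SameCycle.setoid (arc * rot))
      (fun x => True ∧ Quotient.mk (G.region Set.univ) x = Quotient.mk _ x₀) ≤ 1 := by omega
  unfold cellCount at h2
  rw [Finite.card_le_one_iff_subsingleton] at h2
  intro x hx y hy
  have hb : ∀ z, Quotient.mk G.sameFace z = Quotient.mk _ x₀ →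
      True ∧ Quotient.mk (G.region Set.univ) (base rot arc z) = Quotient.mk _ x₀ := by
    intro z hz
    refine ⟨trivial, hR.2 (G.sameFace.trans ?_ (Quotient.exact hz))⟩
    exact rel_of_sameCycle G.boundary (sameCycle_base z)
  have h3 := Subtype.mk.inj (Subsingleton.elim (h := h2) ⟨_, hb x hx⟩ ⟨_, hb y hy⟩)
  exact Quotient.exact h3

end SphereGraph

variable {p q Δ : ℕ}

namespace IntersectionPair

variable (G : IntersectionPair p q Δ) [NeZero p] [NeZero q] [NeZero Δ]

lemma faceRepresents_of_cornerSign {T : ZMod q → ℤˣ} {D : G.GP.Face} (hD : D.IsDisk) {ν : ℤˣ}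
    (hν : ∀ x ∈ D.corners, G.cornerSign T x = ν) : G.FaceRepresents D T := by
  classical
  have hs : ∀ x ∈ D.corners, G.signP x.1 = ν * T (G.intervalP x) := by
    intro x hx
    rw [← hν x hx, cornerSign, mul_assoc, Int.units_mul_self, mul_one]
  have hsum : ∀ j, G.cornerSum D j
      = ((Finset.univ.filter fun x => x ∈ D.corners ∧ G.intervalP x = j).card : ℤ)
        * ((ν * T j : ℤˣ) : ℤ) := by
    intro j
    unfold cornerSum
    rw [finsum_mem_eq_finite_toFinset_sum _ (Set.toFinite _)]
    rw [Finset.sum_congr (s₂ := Finset.univ.filter fun x => x ∈ D.corners ∧ G.intervalP x = j)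
      (g := fun _ => ((ν * T j : ℤˣ) : ℤ))]
    · simp
    · ext x; simp
    · intro x hx
      simp only [Finset.mem_filter, Finset.mem_univ, true_and] at hx
      rw [hs x hx.1, hx.2]
  have habs : ∀ a : ℤˣ, |(a : ℤ)| = 1 := fun a => by
    rcases Int.units_eq_one_or a with rfl | rfl <;> simp
  have hsign : ∀ a : ℤˣ, Int.sign (a : ℤ) = a := fun a => by
    rcases Int.units_eq_one_or a with rfl | rfl <;> simp
  refine ⟨⟨⟨ν, fun j hj => ?_⟩, ?_⟩, fun x hx y hy h => by rw [hs x hx, hs y hy, h]⟩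
  · rw [hsum] at hj ⊢
    have h1 : (Finset.univ.filter fun x => x ∈ D.corners ∧ G.intervalP x = j).card ≠ 0 := by
      intro h0
      simp [h0] at hj
    rw [Int.sign_mul, Int.sign_natCast_of_ne_zero h1, one_mul, hsign]
    push_cast
    rfl
  · rw [finsum_eq_sum_of_fintype]
    simp only [hsum, abs_mul, habs, mul_one, Nat.abs_cast]
    have h1 : (Finset.univ.filter fun x => x ∈ D.corners).card
        = ∑ j, (Finset.univ.filter fun x => x ∈ D.corners ∧ G.intervalP x = j).card := by
      rw [Finset.card_eq_sum_card_fiberwise (f := fun x => G.intervalP x) (t := Finset.univ)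
        (by simp)]
      simp [Finset.filter_filter]
    have h2 : (Finset.univ.filter fun x => x ∈ D.corners).card = D.corners.ncard := by
      rw [Set.ncard_eq_toFinset_card', Set.toFinset_card, Fintype.card_subtype]
    have h3 := G.essentialP D hD
    have h4 : D.corners.ncard ≠ 0 := by
      obtain ⟨x, hx⟩ := Quotient.exists_rep D
      exact Set.ncard_ne_zero_of_mem (show x ∈ D.corners from hx)
    rw [← Nat.cast_sum, ← h1, h2]
    omega

/-- A type that no disk face represents is unrepresented. -/
lemma unrepresented_univ {T : ZMod q → ℤˣ}
    (h : ∀ D : G.GP.Face, D.IsDisk → ¬ G.FaceRepresents D T) : G.Unrepresented Set.univ T := by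
  have htouch : G.touch Set.univ = Set.univ := Set.eq_univ_of_forall fun e => Or.inl trivial
  refine ⟨fun j hj => absurd (Set.mem_univ j) hj, fun R hR => ?_⟩
  by_contra! hcon
  obtain ⟨ν, hν⟩ := G.cornerSign_const Set.univ_nonempty
    (fun j hj => absurd (Set.mem_univ j) hj) hR hcon
  clear hcon
  obtain ⟨x₀, rfl⟩ := Quotient.exists_rep R
  revert hR hν
  rw [htouch]
  intro hR hν
  refine h _ (isDisk_of_defect hR) (faceRepresents_of_cornerSign G (ν := ν) (isDisk_of_defect hR) fun x hx => ?_)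
  exact hν x (Quotient.sound (region_univ_iff.2 (Quotient.exact hx)))

end IntersectionPair

end DehnGraphs

namespace DehnGraphs

open Equiv.Perm SphereGraph

variable {p q Δ : ℕ}

lemma units_ne_iff {a b : ℤˣ} : a ≠ b ↔ a = -b := by
  rcases Int.units_eq_one_or a with rfl | rfl <;> rcases Int.units_eq_one_or b with rfl | rfl <;>
    decide

namespace IntersectionPair

variable (G : IntersectionPair p q Δ)

lemma sign_mul_arc (e : BdryPoint p q Δ) :
    G.signP (G.arc e).1 * G.signQ (G.arc e).2.1 = -(G.signP e.1 * G.signQ e.2.1) := by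
  have h := G.parity e
  rcases Int.units_eq_one_or (G.signP e.1) with h1 | h1 <;>
  rcases Int.units_eq_one_or (G.signQ e.2.1) with h2 | h2 <;>
  rcases Int.units_eq_one_or (G.signP (G.arc e).1) with h3 | h3 <;>
  rcases Int.units_eq_one_or (G.signQ (G.arc e).2.1) with h4 | h4 <;>
  rw [h1, h2, h3, h4] at h ⊢ <;> revert h <;> decide

lemma deficit_nonpos (M : Set (ZMod q)) (T : ZMod q → ℤˣ) (e : BdryPoint p q Δ) :
    G.deficit M T e ≤ 0 := by
  unfold deficit; split_ifs <;> simp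

lemma deficit_of_not_change {M : Set (ZMod q)} {T : ZMod q → ℤˣ} {e : BdryPoint p q Δ}
    (h : e ∈ G.touch M) (hc : G.cornerSign T (G.prev e) = G.cornerSign T (G.arc e)) :
    G.deficit M T e = -2 := if_pos ⟨h, by simpa [Change] using hc⟩

lemma deficit_add_le_of_switch {M : Set (ZMod q)} {T : ZMod q → ℤˣ} {e : BdryPoint p q Δ}
    (h : e ∈ G.touch M) (h1 : G.cornerSign T (G.prev e) ≠ G.cornerSign T e)
    (h2 : G.cornerSign T (G.prev (G.arc e)) = G.cornerSign T (G.arc e)) :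
    G.deficit M T e + G.deficit M T (G.arc e) ≤ -2 := by
  by_cases hc : G.cornerSign T (G.prev e) = G.cornerSign T (G.arc e)
  · rw [G.deficit_of_not_change h hc]
    linarith [G.deficit_nonpos M T (G.arc e)]
  · rw [G.deficit_of_not_change (e := G.arc e) (G.arc_mem_touch h)]
    · linarith [G.deficit_nonpos M T e]
    · rw [G.arc_arc, h2]
      rw [units_ne_iff] at h1
      rw [← ne_eq, units_ne_iff, h1, neg_inj] at hc
      exact hc.symm

lemma deficit_add_le_of_switch' {M : Set (ZMod q)} {T : ZMod q → ℤˣ} {e : BdryPoint p q Δ}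
    (h : e ∈ G.touch M) (h1 : G.cornerSign T (G.prev e) = G.cornerSign T e)
    (h2 : G.cornerSign T (G.prev (G.arc e)) ≠ G.cornerSign T (G.arc e)) :
    G.deficit M T e + G.deficit M T (G.arc e) ≤ -2 := by
  have := G.deficit_add_le_of_switch (e := G.arc e) (G.arc_mem_touch h) h2 (by rwa [G.arc_arc])
  rw [G.arc_arc] at this
  linarith

lemma deficit_add_le_of_opposite {M : Set (ZMod q)} {T : ZMod q → ℤˣ} {e : BdryPoint p q Δ}
    (h : e ∈ G.touch M) (h1 : G.cornerSign T (G.prev e) = G.cornerSign T (G.arc e))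
    (h2 : G.cornerSign T (G.prev (G.arc e)) = G.cornerSign T e) :
    G.deficit M T e + G.deficit M T (G.arc e) ≤ -4 := by
  rw [G.deficit_of_not_change h h1,
    G.deficit_of_not_change (e := G.arc e) (G.arc_mem_touch h) (by rwa [G.arc_arc])]
  norm_num

variable {G} in
lemma Unrepresented.ascents_subset {M : Set (ZMod q)} {T : ZMod q → ℤˣ}
    (h : G.Unrepresented M T) : ascents T ⊆ M := by
  intro m hm
  by_contra hM
  have := h.switch m hM
  rw [hm.1, hm.2] at this
  exact absurd this (by decide)

variable {G} in
lemma Unrepresented.descents_subset {M : Set (ZMod q)} {T : ZMod q → ℤˣ}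
    (h : G.Unrepresented M T) : descents T ⊆ M := by
  intro m hm
  by_contra hM
  have := h.switch m hM
  rw [hm.1, hm.2] at this
  exact absurd this (by decide)

/-- The sign `v` reaches the interval `j` from a descent outside `L`: through intervals of sign
`1` downwards, or through intervals of sign `-1` upwards, without crossing `L`. -/
inductive Reach (t T : ZMod q → ℤˣ) (L : Set (ZMod q)) (v : ℤˣ) : ZMod q → Prop
  | plus_end (j : ZMod q) : j + 1 ∈ descents T → j + 1 ∉ L → v = t (j + 1) → Reach t T L v j
  | minus_end (j : ZMod q) : j ∈ descents T → j ∉ L → v = t j → Reach t T L v j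
  | plus_step (j : ZMod q) : j + 1 ∉ L → T j = 1 → T (j + 1) = 1 → Reach t T L v (j + 1) →
      Reach t T L v j
  | minus_step (j : ZMod q) : j ∉ L → T (j - 1) = -1 → T j = -1 → Reach t T L v (j - 1) →
      Reach t T L v j

lemma one_ne_neg_one_units : (1 : ℤˣ) ≠ -1 := by decide

lemma descents_succ {T : ZMod q → ℤˣ} {j : ZMod q} (h : j + 1 ∈ descents T) :
    T j = 1 ∧ T (j + 1) = -1 := by
  obtain ⟨h1, h2⟩ := h
  rw [add_sub_cancel_right] at h1
  exact ⟨h1, h2⟩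

lemma Reach.plus {t T : ZMod q → ℤˣ} {L : Set (ZMod q)} {v : ℤˣ} {j : ZMod q}
    (h : Reach t T L v j) (hj : T j = 1) :
    j + 1 ∉ L ∧ ((j + 1 ∈ descents T ∧ v = t (j + 1)) ∨
      (T (j + 1) = 1 ∧ Reach t T L v (j + 1))) := by
  cases h with
  | plus_end _ h1 h2 h3 => exact ⟨h2, Or.inl ⟨h1, h3⟩⟩
  | minus_end _ h1 h2 h3 => exact absurd (hj.symm.trans h1.2) one_ne_neg_one_units
  | plus_step _ h1 h2 h3 h4 => exact ⟨h1, Or.inr ⟨h3, h4⟩⟩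
  | minus_step _ h1 h2 h3 h4 => exact absurd (hj.symm.trans h3) one_ne_neg_one_units

lemma Reach.minus {t T : ZMod q → ℤˣ} {L : Set (ZMod q)} {v : ℤˣ} {j : ZMod q}
    (h : Reach t T L v j) (hj : T j = -1) :
    j ∉ L ∧ ((j ∈ descents T ∧ v = t j) ∨ (T (j - 1) = -1 ∧ Reach t T L v (j - 1))) := by
  cases h with
  | plus_end _ h1 h2 h3 =>
    exact absurd ((descents_succ h1).1.symm.trans hj) one_ne_neg_one_units
  | minus_end _ h1 h2 h3 => exact ⟨h2, Or.inl ⟨h1, h3⟩⟩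
  | plus_step _ h1 h2 h3 h4 => exact absurd (h2.symm.trans hj) one_ne_neg_one_units
  | minus_step _ h1 h2 h3 h4 => exact ⟨h1, Or.inr ⟨h2, h4⟩⟩

lemma Reach.unique {t T : ZMod q → ℤˣ} {L : Set (ZMod q)} {v w : ℤˣ} {j : ZMod q}
    (h : Reach t T L v j) : Reach t T L w j → v = w := by
  induction h with
  | plus_end j h1 h2 h3 =>
    intro h'
    obtain ⟨-, h4 | h4⟩ := h'.plus (descents_succ h1).1
    · rw [h3, h4.2]
    · exact absurd (h4.1.symm.trans h1.2) one_ne_neg_one_units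
  | minus_end j h1 h2 h3 =>
    intro h'
    obtain ⟨-, h4 | h4⟩ := h'.minus h1.2
    · rw [h3, h4.2]
    · exact absurd (h1.1.symm.trans h4.1) one_ne_neg_one_units
  | plus_step j h1 h2 h3 h4 ih =>
    intro h'
    obtain ⟨-, h5 | h5⟩ := h'.plus h2
    · exact absurd (h3.symm.trans h5.1.2) one_ne_neg_one_units
    · exact ih h5.2
  | minus_step j h1 h2 h3 h4 ih =>
    intro h'
    obtain ⟨-, h5 | h5⟩ := h'.minus h3
    · exact absurd (h5.1.1.symm.trans h2) one_ne_neg_one_units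
    · exact ih h5.2

open Classical in
/-- The type that has the reaching sign on each interval that is reached from a descent, and
is unchanged elsewhere. -/
noncomputable def spread (t T : ZMod q → ℤˣ) (L : Set (ZMod q)) (j : ZMod q) : ℤˣ :=
  if h : ∃ v, Reach t T L v j then h.choose else T j

lemma spread_of_reach {t T : ZMod q → ℤˣ} {L : Set (ZMod q)} {v : ℤˣ} {j : ZMod q}
    (h : Reach t T L v j) : spread t T L j = v := by
  have h' : ∃ v, Reach t T L v j := ⟨v, h⟩
  rw [spread, dif_pos h']
  exact h'.choose_spec.unique h

lemma spread_of_not_reach {t T : ZMod q → ℤˣ} {L : Set (ZMod q)} {j : ZMod q}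
    (h : ∀ v, ¬ Reach t T L v j) : spread t T L j = T j :=
  dif_neg fun ⟨v, hv⟩ => h v hv

lemma spread_congr {t T : ZMod q → ℤˣ} {L : Set (ZMod q)} {i j : ZMod q} (hT : T i = T j)
    (h : ∀ v, Reach t T L v i ↔ Reach t T L v j) : spread t T L i = spread t T L j := by
  by_cases h' : ∃ v, Reach t T L v i
  · obtain ⟨v, hv⟩ := h'
    rw [spread_of_reach hv, spread_of_reach ((h v).1 hv)]
  · push Not at h'
    rw [spread_of_not_reach h', spread_of_not_reach fun v hv => h' v ((h v).2 hv), hT]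

lemma spread_of_descent {t T : ZMod q → ℤˣ} {L : Set (ZMod q)} {m : ZMod q}
    (h : m ∈ descents T) (hL : m ∉ L) : spread t T L (m - 1) = t m ∧ spread t T L m = t m := by
  constructor
  · apply spread_of_reach
    apply Reach.plus_end <;> rw [sub_add_cancel] <;> assumption
  · exact spread_of_reach (Reach.minus_end m h hL rfl)

lemma spread_switch {t T : ZMod q → ℤˣ} {L : Set (ZMod q)} {m : ZMod q}
    (hm : m ∉ ascents T ∪ L) : spread t T L (m - 1) = spread t T L m := by
  rw [Set.mem_union, not_or] at hm
  rcases switch_cases T m with h | h | h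
  · exact absurd h hm.1
  · rw [(spread_of_descent h hm.2).1, (spread_of_descent h hm.2).2]
  · refine spread_congr h fun v => ?_
    rcases Int.units_eq_one_or (T m) with h' | h'
    · have h1 : T (m - 1) = 1 := h.trans h'
      constructor
      · intro hr
        obtain ⟨-, h2 | h2⟩ := hr.plus h1
        · rw [sub_add_cancel] at h2
          exact absurd (h'.symm.trans h2.1.2) one_ne_neg_one_units
        · rw [sub_add_cancel] at h2
          exact h2.2
      · intro hr
        refine Reach.plus_step _ ?_ h1 ?_ ?_ <;> rw [sub_add_cancel]
        exacts [hm.2, h', hr]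
    · have h1 : T (m - 1) = -1 := h.trans h'
      constructor
      · exact Reach.minus_step m hm.2 h1 h'
      · intro hr
        obtain ⟨-, h2 | h2⟩ := hr.minus h'
        · exact absurd (h2.1.1.symm.trans h1) one_ne_neg_one_units
        · exact h2.2

lemma spread_before_of_mem {t T : ZMod q → ℤˣ} {L : Set (ZMod q)} {l : ZMod q} (hl : l ∈ L)
    (h : T (l - 1) = 1) : spread t T L (l - 1) = T (l - 1) :=
  spread_of_not_reach fun v hv => (hv.plus h).1 (by rwa [sub_add_cancel])

lemma spread_after_of_mem {t T : ZMod q → ℤˣ} {L : Set (ZMod q)} {l : ZMod q} (hl : l ∈ L)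
    (h : T l = -1) : spread t T L l = T l :=
  spread_of_not_reach fun _ hv => (hv.minus h).1 hl

lemma cornerSign_prev_spread {t T : ZMod q → ℤˣ} {L : Set (ZMod q)} {e : BdryPoint p q Δ}
    (he : e.2.1 ∈ L) (h : G.cornerSign T (G.prev e) = 1) :
    G.cornerSign (spread t T L) (G.prev e) = 1 := by
  rw [cornerSign_prev] at h ⊢
  split_ifs at h ⊢
  · rw [spread_before_of_mem he h, h]
  · rw [spread_after_of_mem he (neg_eq_iff_eq_neg.1 h), h]

lemma cornerSign_spread {t T : ZMod q → ℤˣ} {L : Set (ZMod q)} {e : BdryPoint p q Δ}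
    (he : e.2.1 ∈ L) (h : G.cornerSign T e = -1) :
    G.cornerSign (spread t T L) e = -1 := by
  rw [cornerSign_eq] at h ⊢
  split_ifs at h ⊢
  · rw [spread_after_of_mem he h, h]
  · rw [spread_before_of_mem he (neg_inj.1 h), h]

variable [NeZero p] [NeZero q] [NeZero Δ]

/-- Spreading the signs of the descents outside `L` gives an unrepresented type. -/
lemma Unrepresented.of_spread {G : IntersectionPair p q Δ} {M L : Set (ZMod q)} {T : ZMod q → ℤˣ}
    (h : G.Unrepresented M T) (hLM : L ⊆ M) (hne : (ascents T ∪ L).Nonempty)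
    (hL : ∀ e : BdryPoint p q Δ, e.2.1 ∈ L → (G.arc e).2.1 ∈ L ∪ ascents T) (η : ℤˣ) :
    G.Unrepresented (ascents T ∪ L) (spread (fun j => η * G.signQ j) T L) := by
  refine h.transfer (Set.union_subset h.ascents_subset hLM) hne (fun j hj => spread_switch hj)
    fun ν => ⟨fun x => ((G.cornerSign T x : ℤˣ) : ℤ), ?_, ?_⟩
  · intro e he h1 h2
    have hno : ¬ (G.cornerSign T (G.prev e) = 1 ∧ G.cornerSign T (G.arc e) = -1) := by
      rintro ⟨h3, h4⟩
      have hm : e.2.1 ∉ ascents T := fun hC =>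
        one_ne_neg_one_units (h3.symm.trans (G.cornerSign_of_ascent hC).1)
      have hm' : (G.arc e).2.1 ∉ ascents T := fun hC =>
        one_ne_neg_one_units ((G.cornerSign_of_ascent hC).2.symm.trans h4)
      have h5 : e.2.1 ∈ L ∧ (G.arc e).2.1 ∈ L := by
        rcases he with he | he
        · have he := he.resolve_left hm
          exact ⟨he, (hL e he).resolve_right hm'⟩
        · have he := he.resolve_left hm'
          have h6 := hL _ he
          rw [G.arc_arc] at h6
          exact ⟨h6.resolve_right hm, he⟩
      have h6 := G.cornerSign_prev_spread (t := fun j => η * G.signQ j) h5.1 h3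
      have h7 := G.cornerSign_spread (t := fun j => η * G.signQ j) h5.2 h4
      exact one_ne_neg_one_units (h6.symm.trans (h1.trans (h2.symm.trans h7)))
    unfold Change
    rcases Int.units_eq_one_or (G.cornerSign T (G.prev e)) with h3 | h3 <;>
    rcases Int.units_eq_one_or (G.cornerSign T (G.arc e)) with h4 | h4 <;>
    simp_all
  · intro e he h1 h2
    have hm : e.2.1 ∉ ascents T ∪ L := fun h' => he (Or.inl h')
    have hm' : (G.arc e).2.1 ∉ ascents T ∪ L := fun h' => he (Or.inr h')
    beta_reduce
    have hneg := add_nonpos (G.deficit_nonpos M T e) (G.deficit_nonpos M T (G.arc e))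
    rcases switch_cases T e.2.1 with ha | ha | ha
    · exact absurd (Or.inl ha) hm
    · have hb := G.cornerSign_of_descent ha
      have ht : e ∈ G.touch M := Or.inl (h.descents_subset ha)
      rcases switch_cases T (G.arc e).2.1 with ha' | ha' | ha'
      · exact absurd (Or.inl ha') hm'
      · exfalso
        have h3 := spread_of_descent (t := fun j => η * G.signQ j) ha fun h' => hm (Or.inr h')
        have h4 := spread_of_descent (t := fun j => η * G.signQ j) ha' fun h' => hm' (Or.inr h')
        have key : ∀ f : BdryPoint p q Δ, spread (fun j => η * G.signQ j) T L (f.2.1 - 1)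
            = η * G.signQ f.2.1 → spread (fun j => η * G.signQ j) T L f.2.1
            = η * G.signQ f.2.1 → G.cornerSign (spread (fun j => η * G.signQ j) T L) f
              = η * (G.signP f.1 * G.signQ f.2.1) := by
          intro f h5 h6
          rw [cornerSign_eq, h5, h6]
          rcases Int.units_eq_one_or (G.signP f.1) with h7 | h7 <;> simp [h7, one_ne_neg_one_units.symm]
        rw [key _ h3.1 h3.2] at h1
        rw [key _ h4.1 h4.2, G.sign_mul_arc, ← h1, mul_neg] at h2
        have h8 : ∀ a : ℤˣ, -a ≠ a := by decide
        exact h8 _ h2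
      · have hb' := G.cornerSign_of_eq ha'
        have := G.deficit_add_le_of_switch ht (by rw [hb.1, hb.2]; decide) hb'
        rw [hb.1, hb.2, hb']
        push_cast
        linarith
    · have hb := G.cornerSign_of_eq ha
      rcases switch_cases T (G.arc e).2.1 with ha' | ha' | ha'
      · exact absurd (Or.inl ha') hm'
      · have hb' := G.cornerSign_of_descent ha'
        have ht : e ∈ G.touch M := Or.inr (h.descents_subset ha')
        have := G.deficit_add_le_of_switch' ht hb (by rw [hb'.1, hb'.2]; decide)
        rw [hb'.1, hb'.2, hb]
        push_cast
        linarith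
      · have hb' := G.cornerSign_of_eq ha'
        rw [hb, hb']
        linarith

end IntersectionPair

end DehnGraphs

namespace DehnGraphs

open Equiv.Perm SphereGraph

variable {p q Δ : ℕ}

namespace IntersectionPair

/-- A mark that is created above the labels of sign `τ` at which `T` ascends, or that are in `L`
and lie below an interval of sign `1`, and that moves upwards up to the next label in `L`. -/
inductive Down (t T : ZMod q → ℤˣ) (L : Set (ZMod q)) (τ : ℤˣ) : ZMod q → Prop
  | mem (j : ZMod q) : j ∈ L → T j = 1 → t j = τ → Down t T L τ j
  | ascent (j : ZMod q) : j ∉ L → j ∈ ascents T → t j = τ → Down t T L τ j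
  | step (j : ZMod q) : j ∉ L → Down t T L τ (j - 1) → Down t T L τ j

/-- A mark that is created below the labels of sign `τ` at which `T` ascends, or that are in `L`
and lie above an interval of sign `-1`, and that moves downwards up to the next label in `L`. -/
inductive Up (t T : ZMod q → ℤˣ) (L : Set (ZMod q)) (τ : ℤˣ) : ZMod q → Prop
  | mem (j : ZMod q) : j + 1 ∈ L → T j = -1 → t (j + 1) = τ → Up t T L τ j
  | ascent (j : ZMod q) : j + 1 ∉ L → j + 1 ∈ ascents T → t (j + 1) = τ → Up t T L τ j
  | step (j : ZMod q) : j + 1 ∉ L → Up t T L τ (j + 1) → Up t T L τ j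

variable {t T : ZMod q → ℤˣ} {L : Set (ZMod q)} {τ : ℤˣ} {m : ZMod q}

lemma down_iff_of_mem (hm : m ∈ L) : Down t T L τ m ↔ T m = 1 ∧ t m = τ := by
  constructor
  · intro h
    cases h with
    | mem _ _ h1 h2 => exact ⟨h1, h2⟩
    | ascent _ h1 => exact absurd hm h1
    | step _ h1 => exact absurd hm h1
  · rintro ⟨h1, h2⟩
    exact Down.mem m hm h1 h2

lemma down_iff_of_not_mem (hm : m ∉ L) :
    Down t T L τ m ↔ (m ∈ ascents T ∧ t m = τ) ∨ Down t T L τ (m - 1) := by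
  constructor
  · intro h
    cases h with
    | mem _ h1 => exact absurd h1 hm
    | ascent _ _ h1 h2 => exact Or.inl ⟨h1, h2⟩
    | step _ _ h1 => exact Or.inr h1
  · rintro (⟨h1, h2⟩ | h)
    · exact Down.ascent m hm h1 h2
    · exact Down.step m hm h

lemma up_iff_of_mem (hm : m ∈ L) : Up t T L τ (m - 1) ↔ T (m - 1) = -1 ∧ t m = τ := by
  constructor
  · intro h
    cases h with
    | mem _ _ h1 h2 => rw [sub_add_cancel] at h2; exact ⟨h1, h2⟩
    | ascent _ h1 => rw [sub_add_cancel] at h1; exact absurd hm h1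
    | step _ h1 => rw [sub_add_cancel] at h1; exact absurd hm h1
  · rintro ⟨h1, h2⟩
    exact Up.mem _ (by rwa [sub_add_cancel]) h1 (by rwa [sub_add_cancel])

lemma up_iff_of_not_mem (hm : m ∉ L) :
    Up t T L τ (m - 1) ↔ (m ∈ ascents T ∧ t m = τ) ∨ Up t T L τ m := by
  constructor
  · intro h
    cases h with
    | mem _ h1 => rw [sub_add_cancel] at h1; exact absurd h1 hm
    | ascent _ _ h1 h2 => rw [sub_add_cancel] at h1 h2; exact Or.inl ⟨h1, h2⟩
    | step _ _ h1 => rw [sub_add_cancel] at h1; exact Or.inr h1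
  · rintro (⟨h1, h2⟩ | h)
    · exact Up.ascent _ (by rwa [sub_add_cancel]) (by rwa [sub_add_cancel]) (by rwa [sub_add_cancel])
    · exact Up.step _ (by rwa [sub_add_cancel]) (by rwa [sub_add_cancel])

open Classical in
/-- The type that is `τ` at the marked intervals and `-τ` elsewhere. -/
noncomputable def marked (t T : ZMod q → ℤˣ) (L : Set (ZMod q)) (τ : ℤˣ) (j : ZMod q) : ℤˣ :=
  if Down t T L τ j ∨ Up t T L τ j then τ else -τ

lemma marked_switch (hm : m ∉ L) : marked t T L τ (m - 1) = marked t T L τ m := by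
  unfold marked
  rw [down_iff_of_not_mem hm, up_iff_of_not_mem hm]
  congr 1
  simp only [eq_iff_iff]
  tauto

open Classical in
/-- The potential of a corner at a vertex of sign `s`, in an interval to which `T` gives the sign
`a`, with marks `d` and `u`. -/
noncomputable def markPotential (s a : ℤˣ) (d u : Prop) : ℤ :=
  if d ∨ u then (if s * a = 1 then 1 else 0) - (if (s = 1 ↔ ¬ d) then 0 else 1) else 0

lemma neg_one_ne_one_units : (-1 : ℤˣ) ≠ 1 := by decide

variable (G : IntersectionPair p q Δ)

/-- The potential of a corner of `G_P`. -/
noncomputable def potential (t T : ZMod q → ℤˣ) (L : Set (ZMod q)) (τ : ℤˣ)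
    (x : BdryPoint p q Δ) : ℤ :=
  markPotential (G.signP x.1) (T (G.intervalP x)) (Down t T L τ (G.intervalP x))
    (Up t T L τ (G.intervalP x))

variable {e : BdryPoint p q Δ} {ν : ℤˣ}

lemma potential_prev (e : BdryPoint p q Δ) : G.potential t T L τ (G.prev e)
    = if G.signP e.1 = 1 then
        markPotential 1 (T (e.2.1 - 1)) (Down t T L τ (e.2.1 - 1)) (Up t T L τ (e.2.1 - 1))
      else markPotential (-1) (T e.2.1) (Down t T L τ e.2.1) (Up t T L τ e.2.1) := by
  unfold potential
  rcases Int.units_eq_one_or (G.signP e.1) with h | h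
  · rw [intervalP_prev_pos _ h, prev_fst, h, if_pos rfl]
  · rw [intervalP_prev_neg _ h, prev_fst, h, if_neg neg_one_ne_one_units]

lemma potential_eq (e : BdryPoint p q Δ) : G.potential t T L τ e
    = if G.signP e.1 = 1 then
        markPotential 1 (T e.2.1) (Down t T L τ e.2.1) (Up t T L τ e.2.1)
      else markPotential (-1) (T (e.2.1 - 1)) (Down t T L τ (e.2.1 - 1))
        (Up t T L τ (e.2.1 - 1)) := by
  unfold potential
  rcases Int.units_eq_one_or (G.signP e.1) with h | h
  · rw [intervalP_pos _ h, h, if_pos rfl]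
  · rw [intervalP_neg _ h, h, if_neg neg_one_ne_one_units]

lemma potential_nonneg (hm : e.2.1 ∈ L ∨ e.2.1 ∈ ascents T) : 0 ≤ G.potential t T L τ e := by
  rw [potential_eq]
  unfold markPotential
  have h1 : e.2.1 ∈ L → _ := fun h => down_iff_of_mem (t := t) (T := T) (τ := τ) h
  have h2 : e.2.1 ∈ L → _ := fun h => up_iff_of_mem (t := t) (T := T) (τ := τ) h
  have h3 : e.2.1 ∈ ascents T → _ := fun h => h.1
  have h4 : e.2.1 ∈ ascents T → _ := fun h => h.2
  have h5 := neg_one_ne_one_units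
  have h6 := one_ne_neg_one_units
  rcases Int.units_eq_one_or (T e.2.1) with a | a <;>
  rcases Int.units_eq_one_or (T (e.2.1 - 1)) with b | b <;>
  rw [a] at h1 h4 ⊢ <;> rw [b] at h2 h3 ⊢ <;> split_ifs <;> simp_all

lemma potential_prev_nonpos (hm : e.2.1 ∈ L ∨ e.2.1 ∈ ascents T) :
    G.potential t T L τ (G.prev e) ≤ 0 := by
  rw [potential_prev]
  unfold markPotential
  have h1 : e.2.1 ∈ L → _ := fun h => down_iff_of_mem (t := t) (T := T) (τ := τ) h
  have h2 : e.2.1 ∈ L → _ := fun h => up_iff_of_mem (t := t) (T := T) (τ := τ) h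
  have h3 : e.2.1 ∈ ascents T → _ := fun h => h.1
  have h4 : e.2.1 ∈ ascents T → _ := fun h => h.2
  have h5 := neg_one_ne_one_units
  have h6 := one_ne_neg_one_units
  rcases Int.units_eq_one_or (T e.2.1) with a | a <;>
  rcases Int.units_eq_one_or (T (e.2.1 - 1)) with b | b <;>
  rw [a] at h1 h4 ⊢ <;> rw [b] at h2 h3 ⊢ <;> split_ifs <;> simp_all

lemma marked_eq_iff {j : ZMod q} : marked t T L τ j = τ ↔ Down t T L τ j ∨ Up t T L τ j := by
  unfold marked
  have : ∀ a : ℤˣ, -a ≠ a := by decide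
  split_ifs with h <;> simp [h, this]

lemma marked_of_ascent (h : m ∉ L) (ha : m ∈ ascents T) (ht : t m = τ) :
    marked t T L τ (m - 1) = τ ∧ marked t T L τ m = τ := by
  rw [marked_eq_iff, marked_eq_iff]
  exact ⟨Or.inr ((up_iff_of_not_mem h).2 (Or.inl ⟨ha, ht⟩)),
    Or.inl ((down_iff_of_not_mem h).2 (Or.inl ⟨ha, ht⟩))⟩

lemma potential_prev_of_neg (hm : e.2.1 ∈ L ∨ e.2.1 ∉ L ∧ e.2.1 ∈ ascents T ∧ t e.2.1 = τ)
    (h1 : G.cornerSign T (G.prev e) = -1)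
    (h2 : G.cornerSign (marked t T L τ) (G.prev e) = -(G.signP e.1 * t e.2.1)) :
    G.potential t T L τ (G.prev e) = -1 := by
  rw [cornerSign_prev] at h1 h2
  have hτ : ∀ a : ℤˣ, a ≠ -a := by decide
  rcases hm with hm | ⟨hm, ha, ht⟩
  · have hd := down_iff_of_mem (t := t) (T := T) (τ := τ) hm
    have hu := up_iff_of_mem (t := t) (T := T) (τ := τ) hm
    rw [potential_prev]
    rcases Int.units_eq_one_or (G.signP e.1) with h | h
    · simp only [h, if_true, one_mul] at h1 h2 ⊢
      have ht : t e.2.1 ≠ τ := by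
        intro ht
        rw [marked_eq_iff.2 (Or.inr (hu.2 ⟨h1, ht⟩)), ht] at h2
        exact hτ _ h2
      rw [units_ne_iff] at ht
      rw [ht, neg_neg, marked_eq_iff, hu, ht] at h2
      have h3 := h2.resolve_right fun h => hτ _ h.2.symm
      simp [markPotential, h3, h1]
    · simp only [h, if_neg neg_one_ne_one_units, neg_mul, one_mul, neg_neg, neg_inj] at h1 h2 ⊢
      have ht : t e.2.1 ≠ τ := by
        intro ht
        rw [marked_eq_iff.2 (Or.inl (hd.2 ⟨h1, ht⟩)), ht] at h2
        exact hτ _ h2.symm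
      rw [units_ne_iff] at ht
      rw [ht, neg_inj, marked_eq_iff, hd, ht] at h2
      have h3 := h2.resolve_left fun h => hτ _ h.2.symm
      have h4 : ¬ Down t T L τ e.2.1 := by rw [hd, ht]; exact fun h => hτ _ h.2.symm
      simp [markPotential, h3, h4, h1]
  · exfalso
    have h3 := marked_of_ascent hm ha ht
    rw [h3.1, h3.2, ht] at h2
    rcases Int.units_eq_one_or (G.signP e.1) with h | h <;>
      simp [h] at h2

lemma potential_of_pos (hm : e.2.1 ∈ L ∨ e.2.1 ∉ L ∧ e.2.1 ∈ ascents T ∧ t e.2.1 = τ)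
    (h1 : G.cornerSign T e = 1)
    (h2 : G.cornerSign (marked t T L τ) e = -(G.signP e.1 * t e.2.1)) :
    G.potential t T L τ e = 1 := by
  rw [cornerSign_eq] at h1 h2
  have hτ : ∀ a : ℤˣ, a ≠ -a := by decide
  rcases hm with hm | ⟨hm, ha, ht⟩
  · have hd := down_iff_of_mem (t := t) (T := T) (τ := τ) hm
    have hu := up_iff_of_mem (t := t) (T := T) (τ := τ) hm
    rw [potential_eq]
    rcases Int.units_eq_one_or (G.signP e.1) with h | h
    · simp only [h, if_true, one_mul] at h1 h2 ⊢
      have ht : t e.2.1 ≠ τ := by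
        intro ht
        rw [marked_eq_iff.2 (Or.inl (hd.2 ⟨h1, ht⟩)), ht] at h2
        exact hτ _ h2
      rw [units_ne_iff] at ht
      rw [ht, neg_neg, marked_eq_iff, hd, ht] at h2
      have h3 := h2.resolve_left fun h => hτ _ h.2.symm
      have h4 : ¬ Down t T L τ e.2.1 := by rw [hd, ht]; exact fun h => hτ _ h.2.symm
      simp [markPotential, h3, h4, h1]
    · simp only [h, if_neg neg_one_ne_one_units, neg_mul, one_mul, neg_neg] at h1 h2 ⊢
      rw [neg_eq_iff_eq_neg] at h1
      have ht : t e.2.1 ≠ τ := by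
        intro ht
        rw [marked_eq_iff.2 (Or.inr (hu.2 ⟨h1, ht⟩)), ht] at h2
        exact hτ _ h2.symm
      rw [units_ne_iff] at ht
      rw [ht, neg_inj, marked_eq_iff, hu, ht] at h2
      have h3 := h2.resolve_right fun h => hτ _ h.2.symm
      simp [markPotential, h3, h1]
  · exfalso
    have h3 := marked_of_ascent hm ha ht
    rw [h3.1, h3.2, ht] at h2
    rcases Int.units_eq_one_or (G.signP e.1) with h | h <;>
      simp [h] at h2

lemma potential_sub_of_ascent (hm : e.2.1 ∉ L) (ha : e.2.1 ∈ ascents T) :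
    0 ≤ G.potential t T L τ e - G.potential t T L τ (G.prev e) ∧
    (G.cornerSign (marked t T L τ) e = -(G.signP e.1 * t e.2.1) →
      G.potential t T L τ e - G.potential t T L τ (G.prev e) = 1) := by
  have hd := down_iff_of_not_mem (t := t) (T := T) (τ := τ) hm
  have hu := up_iff_of_not_mem (t := t) (T := T) (τ := τ) hm
  rw [potential_eq, potential_prev, cornerSign_eq, ha.1, ha.2]
  simp only [ha, true_and] at hd hu
  have hneg : marked t T L τ e.2.1 = -t e.2.1 → t e.2.1 ≠ τ ∧ (Down t T L τ e.2.1 ∨ Up t T L τ e.2.1) := by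
    intro h
    have h1 : t e.2.1 ≠ τ := by
      intro ht
      rw [(marked_of_ascent hm ha ht).2, ht] at h
      exact absurd h ((by decide : ∀ a : ℤˣ, a ≠ -a) _)
    refine ⟨h1, ?_⟩
    rw [units_ne_iff] at h1
    rw [h1, neg_neg] at h
    exact marked_eq_iff.1 h
  have hneg' : -marked t T L τ e.2.1 = t e.2.1 → t e.2.1 ≠ τ ∧
      (Down t T L τ e.2.1 ∨ Up t T L τ e.2.1) := fun h => hneg (by rw [← h, neg_neg])
  have hsw := marked_switch (t := t) (T := T) (τ := τ) hm
  rw [hsw]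
  unfold markPotential
  generalize Down t T L τ (e.2.1 - 1) = d at *
  generalize Down t T L τ e.2.1 = d' at *
  generalize Up t T L τ (e.2.1 - 1) = u at *
  generalize Up t T L τ e.2.1 = u' at *
  rcases Int.units_eq_one_or (G.signP e.1) with h | h <;> rw [h] <;>
  by_cases hτ : t e.2.1 = τ <;> by_cases d <;> by_cases u <;>
    simp_all

lemma potential_sub_of_descent (hm : e.2.1 ∉ L) (ha : e.2.1 ∈ descents T) :
    G.potential t T L τ e - G.potential t T L τ (G.prev e)
      = if marked t T L τ e.2.1 = τ then -1 else 0 := by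
  have hd := down_iff_of_not_mem (t := t) (T := T) (τ := τ) hm
  have hu := up_iff_of_not_mem (t := t) (T := T) (τ := τ) hm
  rw [potential_eq, potential_prev, ha.1, ha.2]
  have hna : e.2.1 ∉ ascents T := fun h => one_ne_neg_one_units (ha.1.symm.trans h.1)
  simp only [hna, false_and, false_or] at hd hu
  have hmk := marked_eq_iff (t := t) (T := T) (τ := τ) (L := L) (j := e.2.1)
  rw [← hd, hu]
  unfold markPotential
  generalize marked t T L τ e.2.1 = k at *
  generalize Down t T L τ e.2.1 = d' at *
  generalize Up t T L τ e.2.1 = u' at *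
  clear * - hmk
  rcases Int.units_eq_one_or (G.signP e.1) with h | h <;> rw [h] <;>
  by_cases d' <;> by_cases u' <;>
    simp_all

lemma potential_prev_of_eq (hm : e.2.1 ∉ L) (ha : T (e.2.1 - 1) = T e.2.1) :
    G.potential t T L τ (G.prev e) = G.potential t T L τ e := by
  have hd := down_iff_of_not_mem (t := t) (T := T) (τ := τ) hm
  have hu := up_iff_of_not_mem (t := t) (T := T) (τ := τ) hm
  have hna : e.2.1 ∉ ascents T := by
    intro h
    rw [h.1, h.2] at ha
    exact neg_one_ne_one_units ha
  simp only [hna, false_and, false_or] at hd hu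
  rw [potential_prev, potential_eq, ha, ← hd, hu]

variable [NeZero p] [NeZero q] [NeZero Δ]

/-- If the edges at `L` lead to `L` or to a set of ascents of one sign, and all descents outside
`L` have the same sign, then there is an unrepresented type that switches only in `L`. -/
lemma Unrepresented.of_marked {G : IntersectionPair p q Δ} {M L S : Set (ZMod q)}
    {T : ZMod q → ℤˣ} (h : G.Unrepresented M T) (hLM : L ⊆ M) (hne : L.Nonempty)
    (hL : ∀ e : BdryPoint p q Δ, e.2.1 ∈ L → (G.arc e).2.1 ∈ L ∪ S) (hSL : Disjoint S L)
    (hS : S ⊆ ascents T) {τ σ : ℤˣ} (hτ : ∀ m ∈ S, G.signQ m = τ)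
    (hA : ∀ m ∈ descents T, m ∉ L → G.signQ m = σ) :
    G.Unrepresented L (marked G.signQ T L τ) := by
  classical
  refine h.transfer hLM hne (fun j hj => marked_switch hj) fun ν =>
    ⟨fun x => -((G.cornerSign T x : ℤˣ) : ℤ) + 4 * G.potential G.signQ T L τ x, ?_, ?_⟩
  · intro e he h1 h2
    beta_reduce
    have hlab : e.2.1 ∈ L ∪ S ∧ (G.arc e).2.1 ∈ L ∪ S := by
      rcases he with he | he
      · exact ⟨Or.inl he, hL e he⟩
      · have := hL _ he
        rw [G.arc_arc] at this
        exact ⟨this, Or.inl he⟩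
    have hP : ∀ m ∈ L ∪ S, m ∈ L ∨ m ∉ L ∧ m ∈ ascents T ∧ G.signQ m = τ := fun m hm =>
      hm.imp id fun hm => ⟨Set.disjoint_left.1 hSL hm, hS hm, hτ m hm⟩
    have hP' : ∀ m ∈ L ∪ S, m ∈ L ∨ m ∈ ascents T := fun m hm => hm.imp id fun hm => hS hm
    have h3 := G.potential_nonneg (t := G.signQ) (τ := τ) (hP' _ hlab.2)
    have h4 := G.potential_prev_nonpos (t := G.signQ) (τ := τ) (hP' _ hlab.1)
    unfold Change
    rcases Int.units_eq_one_or (G.cornerSign T (G.prev e)) with a | a <;>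
    rcases Int.units_eq_one_or (G.cornerSign T (G.arc e)) with b | b
    · rw [a, b]; simp; linarith
    · rw [a, b]; simp; linarith
    · rcases Int.units_eq_one_or (ν * (G.signP e.1 * G.signQ e.2.1)) with c | c
      · have h5 := G.potential_of_pos (t := G.signQ) (hP _ hlab.2) b (by
          rw [h2, G.sign_mul_arc, neg_neg]
          exact mul_eq_one_iff_eq_inv.1 c |>.trans (Int.units_inv_eq_self _))
        rw [a, b, h5]
        simp; linarith
      · have h5 := G.potential_prev_of_neg (t := G.signQ) (hP _ hlab.1) a (by
          rw [h1]
          rw [← neg_eq_iff_eq_neg, ← neg_mul] at c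
          rw [← neg_inj, neg_neg]
          exact mul_eq_one_iff_eq_inv.1 c |>.trans (Int.units_inv_eq_self _))
        rw [a, b, h5]
        simp; linarith
    · rw [a, b]; simp; linarith
  · intro e he h1 h2
    beta_reduce
    have hm : e.2.1 ∉ L := fun h' => he (Or.inl h')
    have hm' : (G.arc e).2.1 ∉ L := fun h' => he (Or.inr h')
    have hneg := add_nonpos (G.deficit_nonpos M T e) (G.deficit_nonpos M T (G.arc e))
    have hasc := fun (f : BdryPoint p q Δ) (hf : f.2.1 ∉ L) =>
      G.potential_sub_of_ascent (t := G.signQ) (T := T) (τ := τ) hf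
    have hdesc := fun (f : BdryPoint p q Δ) (hf : f.2.1 ∉ L) =>
      G.potential_sub_of_descent (t := G.signQ) (T := T) (τ := τ) hf
    have heq := fun (f : BdryPoint p q Δ) (hf : f.2.1 ∉ L) =>
      G.potential_prev_of_eq (t := G.signQ) (T := T) (τ := τ) hf
    have hdesc' : ∀ f : BdryPoint p q Δ, f.2.1 ∉ L → f.2.1 ∈ descents T →
        -1 ≤ G.potential G.signQ T L τ f - G.potential G.signQ T L τ (G.prev f) := by
      intro f hf hfa
      rw [hdesc f hf hfa]
      split_ifs <;> simp
    rcases switch_cases T e.2.1 with ha | ha | ha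
    · have hb := G.cornerSign_of_ascent ha
      have ht : e ∈ G.touch M := Or.inl (h.ascents_subset ha)
      have hx := hasc e hm ha
      rcases switch_cases T (G.arc e).2.1 with ha' | ha' | ha'
      · have hb' := G.cornerSign_of_ascent ha'
        have hx' := hasc _ hm' ha'
        have hor : G.potential G.signQ T L τ e - G.potential G.signQ T L τ (G.prev e) = 1 ∨
            G.potential G.signQ T L τ (G.arc e)
              - G.potential G.signQ T L τ (G.prev (G.arc e)) = 1 := by
          rcases Int.units_eq_one_or (ν * (G.signP e.1 * G.signQ e.2.1)) with c | c
          · right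
            apply hx'.2
            rw [h2, G.sign_mul_arc, neg_neg]
            exact mul_eq_one_iff_eq_inv.1 c |>.trans (Int.units_inv_eq_self _)
          · left
            apply hx.2
            rw [h1]
            rw [← neg_eq_iff_eq_neg, ← neg_mul] at c
            rw [← neg_inj, neg_neg]
            exact mul_eq_one_iff_eq_inv.1 c |>.trans (Int.units_inv_eq_self _)
        rw [hb.1, hb.2, hb'.1, hb'.2]
        push_cast
        rcases hor with h5 | h5
        · linarith [hx'.1]
        · linarith [hx.1]
      · have hb' := G.cornerSign_of_descent ha'
        have h5 := G.deficit_add_le_of_opposite ht (hb.1.trans hb'.2.symm) (hb'.1.trans hb.2.symm)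
        rw [hb.1, hb.2, hb'.1, hb'.2]
        push_cast
        linarith [hx.1, hdesc' _ hm' ha']
      · have hb' := G.cornerSign_of_eq ha'
        have h5 := G.deficit_add_le_of_switch ht (by rw [hb.1, hb.2]; decide) hb'
        rw [hb.1, hb.2, hb', heq _ hm' ha']
        push_cast
        linarith [hx.1]
    · have hb := G.cornerSign_of_descent ha
      have ht : e ∈ G.touch M := Or.inl (h.descents_subset ha)
      rcases switch_cases T (G.arc e).2.1 with ha' | ha' | ha'
      · have hb' := G.cornerSign_of_ascent ha'
        have h5 := G.deficit_add_le_of_opposite ht (hb.1.trans hb'.2.symm) (hb'.1.trans hb.2.symm)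
        rw [hb.1, hb.2, hb'.1, hb'.2]
        push_cast
        linarith [(hasc _ hm' ha').1, hdesc' _ hm ha]
      · have hb' := G.cornerSign_of_descent ha'
        have hx := hdesc _ hm ha
        have hx' := hdesc _ hm' ha'
        have hcl : ∀ f : BdryPoint p q Δ, f.2.1 ∉ L → G.cornerSign (marked G.signQ T L τ) f
            = G.signP f.1 * marked G.signQ T L τ f.2.1 := by
          intro f hf
          rw [cornerSign_eq, marked_switch hf]
          rcases Int.units_eq_one_or (G.signP f.1) with h7 | h7 <;>
            simp [h7]
        have hopp : marked G.signQ T L τ (G.arc e).2.1 = -marked G.signQ T L τ e.2.1 := by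
          have h6 := G.sign_mul_arc e
          rw [hA _ ha hm, hA _ ha' hm', ← neg_mul] at h6
          have h7 := mul_right_cancel h6
          rw [← h1, hcl _ hm, hcl _ hm', h7, neg_mul, ← mul_neg] at h2
          rw [← neg_eq_iff_eq_neg]
          exact mul_left_cancel h2
        have hsum : (if marked G.signQ T L τ e.2.1 = τ then -1 else 0 : ℤ)
            + (if marked G.signQ T L τ (G.arc e).2.1 = τ then -1 else 0) = -1 := by
          rw [hopp]
          clear * -
          have key : ∀ a b : ℤˣ, (if a = b then -1 else 0 : ℤ)
            + (if -a = b then -1 else 0) = -1 := by decide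
          exact key _ _
        rw [hb.1, hb.2, hb'.1, hb'.2]
        push_cast
        linarith
      · have hb' := G.cornerSign_of_eq ha'
        have h5 := G.deficit_add_le_of_switch ht (by rw [hb.1, hb.2]; decide) hb'
        rw [hb.1, hb.2, hb', heq _ hm' ha']
        push_cast
        linarith [hdesc' _ hm ha]
    · have hb := G.cornerSign_of_eq ha
      rcases switch_cases T (G.arc e).2.1 with ha' | ha' | ha'
      · have hb' := G.cornerSign_of_ascent ha'
        have ht : e ∈ G.touch M := Or.inr (h.ascents_subset ha')
        have h5 := G.deficit_add_le_of_switch' ht hb (by rw [hb'.1, hb'.2]; decide)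
        rw [hb'.1, hb'.2, hb, heq _ hm ha]
        push_cast
        linarith [(hasc _ hm' ha').1]
      · have hb' := G.cornerSign_of_descent ha'
        have ht : e ∈ G.touch M := Or.inr (h.descents_subset ha')
        have h5 := G.deficit_add_le_of_switch' ht hb (by rw [hb'.1, hb'.2]; decide)
        rw [hb'.1, hb'.2, hb, heq _ hm ha]
        push_cast
        linarith [hdesc' _ hm' ha']
      · have hb' := G.cornerSign_of_eq ha'
        rw [hb, hb', heq _ hm ha, heq _ hm' ha']
        linarith

end IntersectionPair

end DehnGraphs

namespace DehnGraphs

open Equiv.Perm SphereGraph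

variable {p q Δ : ℕ}

namespace IntersectionPair

/-- The type `T'` differs from `T` only on intervals from which the sign persists, upwards for `1`
and downwards for `-1`, until `L` is met. -/
def Persists (T' T : ZMod q → ℤˣ) (L : Set (ZMod q)) : Prop :=
  (∃ U : Set (ZMod q), (∀ j ∈ U, T' j = 1) ∧ (∀ m, m - 1 ∈ U → m ∉ L → m ∈ U) ∧
    ∀ j, T' j = 1 → T j ≠ 1 → j ∈ U) ∧
  ∃ W : Set (ZMod q), (∀ j ∈ W, T' j = -1) ∧ (∀ m ∈ W, m ∉ L → m - 1 ∈ W) ∧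
    ∀ j, T' j = -1 → T j ≠ -1 → j ∈ W

lemma Persists.refl (T : ZMod q → ℤˣ) (L : Set (ZMod q)) : Persists T T L :=
  ⟨⟨∅, by simp, by simp, fun _ h h' => absurd h h'⟩,
    ⟨∅, by simp, by simp, fun _ h h' => absurd h h'⟩⟩

lemma Persists.descents {T' T : ZMod q → ℤˣ} {L : Set (ZMod q)} (h : Persists T' T L) {m : ZMod q}
    (hm : m ∈ descents T') (hL : m ∉ L) : m ∈ IntersectionPair.descents T := by
  obtain ⟨⟨U, hU1, hU2, hU3⟩, W, hW1, hW2, hW3⟩ := h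
  refine ⟨?_, ?_⟩
  · by_contra h
    exact one_ne_neg_one_units ((hU1 _ (hU2 m (hU3 _ hm.1 h) hL)).symm.trans hm.2)
  · by_contra h
    exact one_ne_neg_one_units (hm.1.symm.trans (hW1 _ (hW2 m (hW3 _ hm.2 h) hL)))

lemma Persists.reach {T' T t : ZMod q → ℤˣ} {L : Set (ZMod q)} (h : Persists T' T L) {v : ℤˣ}
    {j : ZMod q} (hr : Reach t T' L v j) : Reach t T ∅ v j := by
  have h' := h
  obtain ⟨⟨U, hU1, hU2, hU3⟩, W, hW1, hW2, hW3⟩ := h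
  suffices hs : (j ∉ U ∧ j ∉ W) ∧ Reach t T ∅ v j from hs.2
  induction hr with
  | plus_end j h1 h2 h3 =>
    refine ⟨⟨fun hj => ?_, fun hj => ?_⟩, Reach.plus_end j (h'.descents h1 h2) (by simp) h3⟩
    · exact one_ne_neg_one_units
        ((hU1 _ (hU2 (j + 1) (by rwa [add_sub_cancel_right]) h2)).symm.trans h1.2)
    · exact one_ne_neg_one_units ((descents_succ h1).1.symm.trans (hW1 _ hj))
  | minus_end j h1 h2 h3 =>
    refine ⟨⟨fun hj => ?_, fun hj => ?_⟩, Reach.minus_end j (h'.descents h1 h2) (by simp) h3⟩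
    · exact one_ne_neg_one_units ((hU1 _ hj).symm.trans h1.2)
    · exact one_ne_neg_one_units (h1.1.symm.trans (hW1 _ (hW2 _ hj h2)))
  | plus_step j h1 h2 h3 h4 ih =>
    have hj : j ∉ U := fun hj => ih.1.1 (hU2 (j + 1) (by rwa [add_sub_cancel_right]) h1)
    refine ⟨⟨hj, fun hj => ?_⟩, Reach.plus_step j (by simp) ?_ ?_ ih.2⟩
    · exact one_ne_neg_one_units (h2.symm.trans (hW1 _ hj))
    · by_contra h; exact hj (hU3 _ h2 h)
    · by_contra h; exact ih.1.1 (hU3 _ h3 h)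
  | minus_step j h1 h2 h3 h4 ih =>
    have hj : j ∉ W := fun hj => ih.1.2 (hW2 j hj h1)
    refine ⟨⟨fun hj => ?_, hj⟩, Reach.minus_step j (by simp) ?_ ?_ ih.2⟩
    · exact one_ne_neg_one_units ((hU1 _ hj).symm.trans h3)
    · by_contra h; exact ih.1.2 (hW3 _ h2 h)
    · by_contra h; exact hj (hW3 _ h3 h)

lemma Reach.smul {T t : ZMod q → ℤˣ} {L : Set (ZMod q)} {v : ℤˣ} {j : ZMod q} (η : ℤˣ)
    (h : Reach (fun j => η * t j) T L v j) : Reach t T L (η * v) j := by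
  have hη : ∀ a, η * (η * a) = a := fun a => by rw [← mul_assoc, Int.units_mul_self, one_mul]
  induction h with
  | plus_end j h1 h2 h3 => exact Reach.plus_end j h1 h2 (by rw [h3, hη])
  | minus_end j h1 h2 h3 => exact Reach.minus_end j h1 h2 (by rw [h3, hη])
  | plus_step j h1 h2 h3 _ ih => exact Reach.plus_step j h1 h2 h3 ih
  | minus_step j h1 h2 h3 _ ih => exact Reach.minus_step j h1 h2 h3 ih

lemma Persists.spread {T' T t : ZMod q → ℤˣ} {L : Set (ZMod q)} (h : Persists T' T L)
    (η : ℤˣ) : Persists (spread (fun j => η * t j) T' L)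
      (fun j => η * spread t T ∅ j) L := by
  have hη : ∀ a, η * (η * a) = a := fun a => by rw [← mul_assoc, Int.units_mul_self, one_mul]
  have hreach : ∀ v j, Reach (fun j => η * t j) T' L v j →
      IntersectionPair.spread (fun j => η * t j) T' L j
        = η * IntersectionPair.spread t T ∅ j := by
    intro v j hv
    rw [spread_of_reach hv, spread_of_reach (h.reach (hv.smul η)), hη]
  refine ⟨⟨{j | T' j = 1 ∧ ∀ v, ¬ Reach (fun j => η * t j) T' L v j}, ?_, ?_, ?_⟩,
    {j | T' j = -1 ∧ ∀ v, ¬ Reach (fun j => η * t j) T' L v j}, ?_, ?_, ?_⟩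
  · rintro j ⟨h1, h2⟩
    rw [spread_of_not_reach h2, h1]
  · rintro m ⟨h1, h2⟩ hm
    rcases Int.units_eq_one_or (T' m) with h3 | h3
    · refine ⟨h3, fun v hv => h2 v (Reach.plus_step _ ?_ h1 ?_ ?_)⟩ <;> rw [sub_add_cancel]
      exacts [hm, h3, hv]
    · refine absurd (Reach.plus_end (m - 1) ?_ ?_ rfl) (h2 _) <;> rw [sub_add_cancel]
      exacts [⟨h1, h3⟩, hm]
  · intro j h1 h2
    have h3 : ∀ v, ¬ Reach (fun j => η * t j) T' L v j := fun v hv => h2 (by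
      beta_reduce
      rw [← hreach v j hv, h1])
    rw [spread_of_not_reach h3] at h1
    exact ⟨h1, h3⟩
  · rintro j ⟨h1, h2⟩
    rw [spread_of_not_reach h2, h1]
  · rintro m ⟨h1, h2⟩ hm
    rcases Int.units_eq_one_or (T' (m - 1)) with h3 | h3
    · exact absurd (Reach.minus_end m ⟨h3, h1⟩ hm rfl) (h2 _)
    · exact ⟨h3, fun v hv => h2 v (Reach.minus_step m hm h3 h1 hv)⟩
  · intro j h1 h2
    have h3 : ∀ v, ¬ Reach (fun j => η * t j) T' L v j := fun v hv => h2 (by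
      beta_reduce
      rw [← hreach v j hv, h1])
    rw [spread_of_not_reach h3] at h1
    exact ⟨h1, h3⟩

lemma exists_ascent [NeZero q] {T : ZMod q → ℤˣ} (h1 : ∃ i, T i = 1) (h2 : ∃ i, T i = -1) :
    (ascents T).Nonempty := by
  by_contra hne
  rw [Set.not_nonempty_iff_eq_empty] at hne
  obtain ⟨i, hi⟩ := h2
  have key : ∀ n : ℕ, T (i + n) = -1 := by
    intro n
    induction n with
    | zero => simpa using hi
    | succ n ih =>
      rcases Int.units_eq_one_or (T (i + (n + 1 : ℕ))) with h | h
      · have : i + ((n + 1 : ℕ) : ZMod q) ∈ ascents T := by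
          refine ⟨?_, h⟩
          rw [← ih]; push_cast; ring_nf
        rw [hne] at this
        exact absurd this (Set.notMem_empty _)
      · exact h
  obtain ⟨k, hk⟩ := h1
  have := key (k - i).val
  rw [ZMod.natCast_zmod_val, add_sub_cancel, hk] at this
  exact one_ne_neg_one_units this

lemma ascents_neg (T : ZMod q → ℤˣ) : ascents (-T) = descents T := by
  ext m
  simp [ascents, descents, neg_eq_iff_eq_neg]

lemma descents_neg (T : ZMod q → ℤˣ) : descents (-T) = ascents T := by
  ext m
  simp [ascents, descents, neg_eq_iff_eq_neg]

variable (G : IntersectionPair p q Δ) [NeZero p] [NeZero q] [NeZero Δ]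

/-- A nonempty set of labels of the same sign that is left by few edges. -/
structure Good (S : Set (ZMod q)) : Prop where
  nonempty : S.Nonempty
  sign : ∃ τ, ∀ m ∈ S, G.signQ m = τ
  card_le : (G.leaving S).card + 2 ≤ p

/-- `S` can be used to descend from `T`: a type that agrees with `T` near `S` and is close to `T`
leads to an unrepresented type that ascends at `S` and has descents of one sign only. -/
def Descends (S : Set (ZMod q)) (T : ZMod q → ℤˣ) : Prop :=
  ∀ L : Set (ZMod q), Disjoint S L →
    (∀ e : BdryPoint p q Δ, e.2.1 ∈ L → (G.arc e).2.1 ∈ L ∪ S) →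
    ∀ (M' : Set (ZMod q)) (T' : ZMod q → ℤˣ), G.Unrepresented M' T' → L ⊆ M' →
      (∀ m ∈ S, T' (m - 1) = T (m - 1) ∧ T' m = T m) → Persists T' T L →
      ∃ M₁ T₁, G.Unrepresented M₁ T₁ ∧ L ⊆ M₁ ∧ S ⊆ ascents T₁ ∧
        ∃ σ, ∀ m ∈ descents T₁, m ∉ L → G.signQ m = σ

/-- If the ascents and the descents of an unrepresented type have constant signs, then there is a
good set that one can use to descend. -/
lemma exists_descends_of_const {M : Set (ZMod q)} {T : ZMod q → ℤˣ} (h : G.Unrepresented M T)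
    (h1 : ∃ i, T i = 1) (h2 : ∃ i, T i = -1) (hC : ∃ σ, ∀ m ∈ ascents T, G.signQ m = σ)
    (hA : ∃ σ, ∀ m ∈ descents T, G.signQ m = σ) :
    ∃ ν : ℤˣ, ∃ S ⊆ M, G.Good S ∧ S ⊆ ascents (ν • T) ∧ G.Descends S (ν • T) := by
  have key : ∀ T : ZMod q → ℤˣ, (∃ σ, ∀ m ∈ descents T, G.signQ m = σ) →
      G.Descends (ascents T) T := by
    rintro T ⟨σ, hσ⟩ L hSL hL M' T' h' hLM hag hper
    refine ⟨M', T', h', hLM, fun m hm => ?_, σ, fun m hm hmL => hσ m (hper.descents hm hmL)⟩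
    exact ⟨(hag m hm).1.trans hm.1, (hag m hm).2.trans hm.2⟩
  have hne : M.Nonempty := (exists_ascent h1 h2).mono h.ascents_subset
  have hcard := h.card_leaving_le hne
  by_cases hle : (G.leaving (ascents T)).card + 2 ≤ p
  · refine ⟨1, ascents T, h.ascents_subset, ⟨exists_ascent h1 h2, hC, hle⟩, ?_, ?_⟩
    · rw [one_smul]
    · rw [one_smul]; exact key T hA
  · have hneg : (-1 : ℤˣ) • T = -T := by ext; simp
    refine ⟨-1, descents T, h.descents_subset, ⟨?_, hA, by omega⟩, ?_, ?_⟩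
    · rw [← ascents_neg]
      refine exists_ascent ?_ ?_
      · obtain ⟨i, hi⟩ := h2; exact ⟨i, by simp [hi]⟩
      · obtain ⟨i, hi⟩ := h1; exact ⟨i, by simp [hi]⟩
    · rw [hneg, ascents_neg]
    · rw [hneg, ← ascents_neg]
      exact key (-T) (by rwa [descents_neg])

/-- Every unrepresented type that is not constant yields a good set that one can use to
descend. -/
lemma exists_descends (n : ℕ) : ∀ {M : Set (ZMod q)} {T : ZMod q → ℤˣ}, M.ncard ≤ n →
    G.Unrepresented M T → (∃ i, T i = 1) → (∃ i, T i = -1) →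
    ∃ ν : ℤˣ, ∃ S ⊆ M, G.Good S ∧ S ⊆ ascents (ν • T) ∧ G.Descends S (ν • T) := by
  induction n with
  | zero =>
    intro M T hM h h1 h2
    obtain ⟨m, hm⟩ := (exists_ascent h1 h2).mono h.ascents_subset
    rw [Nat.le_zero, Set.ncard_eq_zero] at hM
    rw [hM] at hm
    exact absurd hm (Set.notMem_empty _)
  | succ n ih =>
    intro M T hM h h1 h2
    have hneg : (-1 : ℤˣ) • T = -T := by ext; simp
    have step : ∀ ν : ℤˣ, (¬ ∃ σ, ∀ m ∈ descents (ν • T), G.signQ m = σ) →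
        G.Unrepresented M (ν • T) →
        ∃ S ⊆ M, G.Good S ∧ S ⊆ ascents (ν • T) ∧ G.Descends S (ν • T) := by
      intro ν hA h
      push Not at hA
      set T₀ := ν • T
      obtain ⟨a, ha, hta⟩ := hA 1
      obtain ⟨b, hb, htb⟩ := hA (-1)
      rw [units_ne_iff] at hta
      rw [units_ne_iff, neg_neg] at htb
      have h01 : ∃ i, T₀ i = 1 := ⟨_, ha.1⟩
      have h02 : ∃ i, T₀ i = -1 := ⟨_, ha.2⟩
      have hS := h.of_spread (L := ∅) (Set.empty_subset _)
        (by rw [Set.union_empty]; exact exists_ascent h01 h02) (by simp) 1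
      simp only [one_mul, Set.union_empty] at hS
      have hlt : (ascents T₀).ncard < M.ncard :=
        Set.ncard_lt_ncard (Set.ssubset_iff_subset_ne.2 ⟨h.ascents_subset, fun heq => by
          have := h.descents_subset ha
          rw [← heq] at this
          exact one_ne_neg_one_units (ha.1.symm.trans this.1)⟩)
      obtain ⟨ν₁, S, hSM, hgood, hS1, hdesc⟩ := ih (by omega) hS
        ⟨b, by rw [(spread_of_descent hb (Set.notMem_empty _)).2, htb]⟩
        ⟨a, by rw [(spread_of_descent ha (Set.notMem_empty _)).2, hta]⟩
      refine ⟨S, hSM.trans h.ascents_subset, hgood, hSM, ?_⟩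
      intro L hSL hL M' T' h' hLM hag hper
      have hSasc : S ⊆ ascents T' := fun m hm =>
        ⟨(hag m hm).1.trans (hSM hm).1, (hag m hm).2.trans (hSM hm).2⟩
      refine hdesc L hSL hL (ascents T' ∪ L) (spread (fun j => ν₁ * G.signQ j) T' L)
        (h'.of_spread hLM ((hgood.nonempty.mono hSasc).mono Set.subset_union_left)
          (fun e he => (hL e he).imp id fun h => hSasc h) ν₁) Set.subset_union_right ?_
        (hper.spread ν₁)
      have hη : ∀ a, ν₁ * (ν₁ * a) = a := fun a => by
        rw [← mul_assoc, Int.units_mul_self, one_mul]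
      have hag' : ∀ j, T' j = T₀ j → T₀ j = (ν₁ • spread G.signQ T₀ ∅) j →
          spread (fun j => ν₁ * G.signQ j) T' L j = (ν₁ • spread G.signQ T₀ ∅) j := by
        intro j hj1 hj2
        by_cases hr : ∃ v, Reach (fun j => ν₁ * G.signQ j) T' L v j
        · obtain ⟨v, hv⟩ := hr
          rw [Pi.smul_apply, spread_of_reach hv, spread_of_reach (hper.reach (hv.smul ν₁)),
            smul_eq_mul, hη]
        · push Not at hr
          rw [spread_of_not_reach hr, hj1, hj2]
      intro m hm
      exact ⟨hag' _ (hag m hm).1 ((hSM hm).1.trans (hS1 hm).1.symm),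
        hag' _ (hag m hm).2 ((hSM hm).2.trans (hS1 hm).2.symm)⟩
    by_cases hA : ∃ σ, ∀ m ∈ descents T, G.signQ m = σ
    · by_cases hC : ∃ σ, ∀ m ∈ ascents T, G.signQ m = σ
      · exact G.exists_descends_of_const h h1 h2 hC hA
      · exact ⟨-1, step (-1) (by rwa [hneg, descents_neg]) (by rw [hneg]; exact h.neg)⟩
    · exact ⟨1, step 1 (by rwa [one_smul]) (by rwa [one_smul])⟩

end IntersectionPair

end DehnGraphs

namespace DehnGraphs

open Equiv.Perm SphereGraph

/-- A sum of at least two integers, each at most one, has two different summands equal to one. -/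
lemma exists_pair_of_two_le_sum {ι : Type} [Fintype ι] {d : ι → ℤ} (h1 : ∀ i, d i ≤ 1)
    (h2 : 2 ≤ ∑ i, d i) : ∃ i j, i ≠ j ∧ d i = 1 ∧ d j = 1 := by
  classical
  have hex : ∃ i, d i = 1 := by
    by_contra! hno
    have : ∑ i, d i ≤ 0 := Finset.sum_nonpos fun i _ => by have := h1 i; have := hno i; omega
    omega
  obtain ⟨i, hi⟩ := hex
  by_contra! hno
  rw [← Finset.add_sum_erase _ _ (Finset.mem_univ i)] at h2
  have : ∑ j ∈ Finset.univ.erase i, d j ≤ 0 := Finset.sum_nonpos fun j hj => by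
    have := h1 j
    have := hno i j (Finset.ne_of_mem_erase hj).symm hi
    omega
  omega

variable {p q Δ : ℕ}

/-- The distance of a label from `x` in the direction `τ`. -/
def rank (x : ZMod p) (τ : ℤˣ) (i : ZMod p) : ℕ := if τ = 1 then (i - x).val else (x - i).val

section

variable [NeZero p] (x : ZMod p) (τ : ℤˣ)

omit [NeZero p] in
lemma rank_self : rank x τ x = 0 := by
  unfold rank; split_ifs <;> simp

lemma rank_lt (i : ZMod p) : rank x τ i < p := by
  unfold rank; split_ifs <;> exact ZMod.val_lt _

lemma rank_injective : Function.Injective (rank x τ) := by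
  intro i j h
  unfold rank at h
  split_ifs at h
  · exact sub_left_injective (ZMod.val_injective p h)
  · exact sub_right_injective (ZMod.val_injective p h)

lemma val_eq_val_sub_one_add_one {a : ZMod p} (ha : a ≠ 0) : a.val = (a - 1).val + 1 := by
  have h1 : a.val ≠ 0 := by rwa [Ne, ZMod.val_eq_zero]
  have hp : p ≠ 1 := by
    rintro rfl
    exact ha (Subsingleton.elim _ _)
  have h2 : (1 : ZMod p).val = 1 := by
    rw [ZMod.val_one_eq_one_mod]
    exact Nat.mod_eq_of_lt (by have := NeZero.ne p; omega)
  rw [ZMod.val_sub (by omega), h2]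
  omega

lemma rank_step {i j : ZMod p} (hij : j = if τ = 1 then i + 1 else i - 1) (hj : j ≠ x) :
    rank x τ j = rank x τ i + 1 := by
  unfold rank
  split_ifs at hij ⊢
  · rw [val_eq_val_sub_one_add_one (sub_ne_zero.2 hj), hij]
    ring_nf
  · rw [val_eq_val_sub_one_add_one (sub_ne_zero.2 hj.symm), hij]
    ring_nf

lemma rank_of_step {i : ZMod p} (hi : x = if τ = 1 then i + 1 else i - 1) :
    rank x τ i + 1 = p := by
  have h : ((rank x τ i + 1 : ℕ) : ZMod p) = 0 := by
    unfold rank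
    split_ifs at hi ⊢ <;> push_cast <;> rw [ZMod.natCast_zmod_val, hi] <;> ring
  rw [ZMod.natCast_eq_zero_iff] at h
  have := Nat.le_of_dvd (by omega) h
  have := rank_lt x τ i
  omega

end

namespace IntersectionPair

variable (G : IntersectionPair p q Δ)

/-- The endpoints of the edges that join vertices of `S` in `G_Q`. -/
def inner (S : Set (ZMod q)) : Set (BdryPoint p q Δ) := {e | e.2.1 ∈ S ∧ (G.arc e).2.1 ∈ S}

/-- All corners of `G_Q` at vertices outside `L` lie in one region when only the edges at vertices
in `L` are kept. -/
def ConnectedOff (L : Set (ZMod q)) : Prop :=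
  ∀ x y : BdryPoint p q Δ, x.2.1 ∉ L → y.2.1 ∉ L → G.GQ.region {e | e.2.1 ∈ L} x y

lemma arc_mem_inner {S : Set (ZMod q)} (e : BdryPoint p q Δ) (h : e ∈ G.inner S) :
    G.arc e ∈ G.inner S := ⟨h.2, by rw [G.arc_arc]; exact h.1⟩

lemma label_eq_of_sameCycle {u : (ZMod Δ)ˣ} {s : ZMod q → ℤˣ} {x y : BdryPoint p q Δ}
    (h : SameCycle (rotQ u s) x y) : x.2.1 = y.2.1 :=
  rel_of_sameCycle (s := Setoid.ker fun x : BdryPoint p q Δ => x.2.1)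
    (fun x => (rotQ_label u s x).symm) h

lemma free_of_label {S : Set (ZMod q)} {x : BdryPoint p q Δ} (hx : x.2.1 ∉ S) :
    FreeVertex (rotQ G.twist G.signQ) (G.inner S) x := by
  intro y hy hyY
  rw [label_eq_of_sameCycle hy] at hx
  exact hx hyY.1

/-- No edge with the label `x` at a vertex of `S` leaves `S`. -/
def Clean (S : Set (ZMod q)) (x : ZMod p) : Prop :=
  ∀ e : BdryPoint p q Δ, e.1 = x → e.2.1 ∈ S → (G.arc e).2.1 ∈ S

variable {G} in
lemma Clean.label_notMem [NeZero p] [NeZero Δ] {S : Set (ZMod q)} {x : ZMod p} (h : G.Clean S x)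
    {z : BdryPoint p q Δ} (hz : FreeVertex (rotQ G.twist G.signQ) (G.inner S) z) :
    z.2.1 ∉ S := by
  intro hzS
  exact hz (x, z.2.1, 0) (sameCycle_rotQ _ _ rfl) ⟨hzS, h _ rfl hzS⟩

lemma sign_ne_of_inner {S : Set (ZMod q)} {τ : ℤˣ} (hS : ∀ m ∈ S, G.signQ m = τ)
    {e : BdryPoint p q Δ} (he : e ∈ G.inner S) : (G.arc e).1 ≠ e.1 := by
  intro h
  have := G.parity e
  rw [hS _ he.1, hS _ he.2, h] at this
  simp at this

variable [NeZero p] [NeZero q] [NeZero Δ]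

lemma exists_clean {S : Set (ZMod q)} (h : (G.leaving S).card < p) : ∃ x, G.Clean S x := by
  classical
  have hlt : ((G.leaving S).image Prod.fst).card < Fintype.card (ZMod p) := by
    rw [ZMod.card]
    exact Finset.card_image_le.trans_lt h
  obtain ⟨x, hx⟩ := Finset.exists_mem_notMem_of_card_lt_card
    (s := (G.leaving S).image Prod.fst) (t := Finset.univ) hlt
  refine ⟨x, fun e he heS => ?_⟩
  by_contra hno
  exact hx.2 (Finset.mem_image.2 ⟨e, G.mem_leaving.2 ⟨heS, hno⟩, he⟩)

omit [NeZero p] [NeZero q] [NeZero Δ] in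
/-- Each region has a corner at a vertex of `S`. -/
lemma exists_mem_regionSet {S : Set (ZMod q)} (hne : S.Nonempty)
    (R : Quotient (G.GQ.region (G.inner S))) : ∃ z ∈ G.GQ.regionSet (G.inner S) R, z.2.1 ∈ S := by
  by_contra! hno
  obtain ⟨z₀, rfl⟩ := Quotient.exists_rep R
  set R := Quotient.mk (G.GQ.region (G.inner S)) z₀
  obtain ⟨m, hm⟩ := hne
  have hfree : ∀ z ∈ G.GQ.regionSet (G.inner S) R, ∀ w : BdryPoint p q Δ, w.2.1 = z.2.1 →
      w ∉ G.inner S := fun z hz w hw hwY => hno z hz (hw ▸ hwY.1)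
  have hle : G.GQ.sameFace ⊔ SameCycle.setoid (rotQ G.twist G.signQ) ⊔ SameCycle.setoid G.arc
      ≤ Setoid.ker fun z => z ∈ G.GQ.regionSet (G.inner S) R := by
    refine sup_le (sup_le ?_ ?_) ?_
    · intro a b h
      exact propext (regionSet_iff (region_of_sameFace h))
    · intro a b h
      refine rel_of_sameCycle (s := Setoid.ker fun z => z ∈ G.GQ.regionSet (G.inner S) R) ?_ h
      intro a
      have hl := rotQ_label G.twist G.signQ a
      refine propext ⟨fun ha => ?_, fun ha => ?_⟩
      · exact (regionSet_iff (region_rot (hfree _ ha _ hl))).1 ha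
      · exact (regionSet_iff (region_rot (hfree _ ha _ rfl))).2 ha
    · intro a b h
      refine rel_of_sameCycle (s := Setoid.ker fun z => z ∈ G.GQ.regionSet (G.inner S) R) ?_ h
      intro a
      refine propext ⟨fun ha => ?_, fun ha => ?_⟩
      · exact (regionSet_iff (region_arc G.arc_arc G.arc_mem_inner (hfree _ ha _ rfl))).1 ha
      · have := (regionSet_iff (region_arc G.arc_arc G.arc_mem_inner (hfree _ ha _ rfl))).1 ha
        rwa [G.arc_arc] at this
  rw [G.GQ.connected] at hle
  have h1 : (z₀ ∈ G.GQ.regionSet (G.inner S) R)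
      = (((0, m, 0) : BdryPoint p q Δ) ∈ G.GQ.regionSet (G.inner S) R) := hle trivial
  have h0 : z₀ ∈ G.GQ.regionSet (G.inner S) R := rfl
  rw [h1] at h0
  exact hno _ h0 hm

lemma cellCount_not_free_le (S : Set (ZMod q)) :
    cellCount (SameCycle.setoid (rotQ G.twist G.signQ))
      (fun x => ¬ FreeVertex (rotQ G.twist G.signQ) (G.inner S) x) ≤ S.ncard := by
  unfold cellCount
  rw [← Nat.card_coe_set_eq]
  refine Nat.card_le_card_of_injective (fun c => (⟨c.1.out.2.1, by
    by_contra h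
    exact c.2 (G.free_of_label h)⟩ : S)) ?_
  rintro ⟨c, hc⟩ ⟨d, hd⟩ h
  rw [Subtype.mk.injEq] at h ⊢
  rw [← Quotient.out_eq c, ← Quotient.out_eq d]
  exact Quotient.sound (sameCycle_rotQ _ _ h)

open Classical in
/-- The cost of an edge side: the sides at the label `x` and those along which the rank goes
down are free. -/
noncomputable def cost (x : ZMod p) (τ : ℤˣ) (e : BdryPoint p q Δ) : ℤ :=
  if e.1 = x ∨ rank x τ (G.arc e).1 < rank x τ e.1 then 0 else 1

omit [NeZero p] [NeZero q] [NeZero Δ] in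
lemma cost_nonneg (x : ZMod p) (τ : ℤˣ) (e : BdryPoint p q Δ) : 0 ≤ G.cost x τ e := by
  unfold cost; split_ifs <;> simp

open Classical in
lemma sum_cost_le {S : Set (ZMod q)} {x : ZMod p} {τ : ℤˣ} (hS : ∀ m ∈ S, G.signQ m = τ)
    (hx : G.Clean S x) :
    2 * ∑ e with e ∈ G.inner S, G.cost x τ e + 2 * S.ncard
      ≤ (Finset.univ.filter fun e => e ∈ G.inner S).card := by
  have hswap : ∀ f : BdryPoint p q Δ → ℤ,
      ∑ e with e ∈ G.inner S, f (G.arc e) = ∑ e with e ∈ G.inner S, f e := by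
    intro f
    refine Finset.sum_bij' (fun e _ => G.arc e) (fun e _ => G.arc e) ?_ ?_ ?_ ?_ ?_
    · intro e he
      simpa using G.arc_mem_inner e (by simpa using he)
    · intro e he
      simpa using G.arc_mem_inner e (by simpa using he)
    · intro e _; exact G.arc_arc e
    · intro e _; exact G.arc_arc e
    · intro e _; rfl
  have hpt : ∀ e ∈ Finset.univ.filter fun e => e ∈ G.inner S,
      (G.cost x τ e + if e.1 = x then 1 else 0)
        + (G.cost x τ (G.arc e) + if (G.arc e).1 = x then 1 else 0) ≤ (1 : ℤ) := by
    intro e he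
    have hne := G.sign_ne_of_inner hS (Finset.mem_filter.1 he).2
    have hr : rank x τ (G.arc e).1 ≠ rank x τ e.1 := fun h => hne (rank_injective x τ h)
    unfold cost
    rw [G.arc_arc]
    by_cases h1 : e.1 = x
    · have h2 : (G.arc e).1 ≠ x := fun h => hne (h.trans h1.symm)
      have h3 : rank x τ e.1 < rank x τ (G.arc e).1 := by
        rw [h1, rank_self] at hr ⊢
        omega
      rw [if_pos (Or.inl h1), if_pos h1, if_pos (Or.inr h3), if_neg h2]
      norm_num
    · by_cases h2 : (G.arc e).1 = x
      · have h3 : rank x τ (G.arc e).1 < rank x τ e.1 := by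
          rw [h2, rank_self] at hr ⊢
          omega
        rw [if_pos (Or.inr h3), if_neg h1, if_pos (Or.inl h2), if_pos h2]
        norm_num
      · rw [if_neg h1, if_neg h2]
        rcases lt_or_gt_of_ne hr with h3 | h3
        · rw [if_pos (Or.inr h3)]
          split_ifs <;> norm_num
        · rw [if_pos (c := (G.arc e).1 = x ∨ rank x τ e.1 < rank x τ (G.arc e).1) (Or.inr h3)]
          split_ifs <;> norm_num
  have h1 := Finset.sum_le_sum hpt
  rw [Finset.sum_add_distrib,
    hswap fun e => G.cost x τ e + if e.1 = x then 1 else 0, Finset.sum_add_distrib] at h1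
  have h2 : (S.ncard : ℤ) ≤ ∑ e with e ∈ G.inner S, if e.1 = x then (1 : ℤ) else 0 := by
    rw [Finset.sum_boole, Nat.cast_le, ← Nat.card_coe_set_eq, ← Fintype.card_coe,
      ← Nat.card_eq_fintype_card]
    refine Nat.card_le_card_of_injective (fun m => (⟨(x, m.1, 0), ?_⟩ :
      {e // e ∈ (Finset.univ.filter fun e => e ∈ G.inner S).filter fun e => e.1 = x})) ?_
    · simp only [Finset.mem_filter, Finset.mem_univ, true_and, and_true]
      exact ⟨m.2, hx _ rfl m.2⟩
    · rintro ⟨m, hm⟩ ⟨m', hm'⟩ h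
      simpa using h
  rw [Finset.sum_const, nsmul_eq_mul, mul_one] at h1
  linarith

/-- There are two regions of defect one all of whose sides are free of cost. -/
lemma exists_two_regions {S : Set (ZMod q)} (hne : S.Nonempty) {x : ZMod p} {τ : ℤˣ}
    (hS : ∀ m ∈ S, G.signQ m = τ) (hx : G.Clean S x) :
    ∃ R₁ R₂ : Quotient (G.GQ.region (G.inner S)), R₁ ≠ R₂ ∧ ∀ R, R = R₁ ∨ R = R₂ →
      G.GQ.defect (G.inner S) R = 1 ∧
      ∀ e ∈ G.inner S, G.arc e ∈ G.GQ.regionSet (G.inner S) R → G.cost x τ e = 0 := by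
  classical
  have := Fintype.ofFinite (Quotient (G.GQ.region (G.inner S)))
  set Y := G.inner S
  let c : Quotient (G.GQ.region Y) → ℤ := fun R =>
    ∑ e ∈ Finset.univ.filter (fun e => e ∈ Y) with Quotient.mk (G.GQ.region Y) (G.arc e) = R,
      G.cost x τ e
  have hc : ∑ R, c R = ∑ e with e ∈ Y, G.cost x τ e :=
    Finset.sum_fiberwise _ _ _
  have hc0 : ∀ R, 0 ≤ c R := fun R => Finset.sum_nonneg fun e _ => G.cost_nonneg x τ e
  have h1 := two_mul_sum_defect (G := G.GQ) (Y := Y) G.arc_arc G.arc_mem_inner G.arc_ne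
  have h2 := cellCount_add_not (SameCycle.setoid (rotQ G.twist G.signQ))
    (FreeVertex (rotQ G.twist G.signQ) Y)
  have h3 := G.cellCount_not_free_le S
  have h4 := G.sum_cost_le hS hx
  rw [Nat.card_eq_fintype_card, Fintype.card_subtype] at h1
  have h5 : numCycles (rotQ G.twist G.signQ) = Nat.card (Quotient (SameCycle.setoid
    (rotQ (p := p) G.twist G.signQ))) := rfl
  have h6 : 2 ≤ ∑ R, (G.GQ.defect Y R - c R) := by
    rw [Finset.sum_sub_distrib, hc]
    rw [h5, ← h2] at h1
    push_cast at h1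
    have : (cellCount (SameCycle.setoid (rotQ G.twist G.signQ))
      (fun x => ¬ FreeVertex (rotQ G.twist G.signQ) Y x) : ℤ) ≤ S.ncard := by exact_mod_cast h3
    linarith
  have hle : ∀ R, G.GQ.defect Y R ≤ 1 := by
    intro R
    obtain ⟨z, hz, hzS⟩ := G.exists_mem_regionSet hne R
    exact defect_le_one G.arc_arc G.arc_mem_inner hz fun hfree => hx.label_notMem hfree hzS
  obtain ⟨R₁, R₂, hR, e1, e2⟩ := exists_pair_of_two_le_sum
    (fun R => by have := hle R; have := hc0 R; linarith) h6
  refine ⟨R₁, R₂, hR, fun R hR => ?_⟩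
  have e3 : G.GQ.defect Y R - c R = 1 := by rcases hR with rfl | rfl <;> assumption
  have e4 : c R = 0 := by have := hle R; have := hc0 R; linarith
  refine ⟨by linarith, fun e heY heR => ?_⟩
  exact (Finset.sum_eq_zero_iff_of_nonneg fun e _ => G.cost_nonneg x τ e).1 e4 e
    (Finset.mem_filter.2 ⟨Finset.mem_filter.2 ⟨Finset.mem_univ _, heY⟩, heR⟩)

end IntersectionPair

end DehnGraphs

namespace DehnGraphs

open Equiv.Perm SphereGraph

variable {p q Δ : ℕ}

namespace IntersectionPair

variable (G : IntersectionPair p q Δ)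

lemma rotQ_fst (y : BdryPoint p q Δ) : (rotQ G.twist G.signQ y).1
    = if G.signQ y.2.1 = 1 then y.1 + 1 else y.1 - 1 := by
  change (if G.signQ y.2.1 = 1 then alongQ p q G.twist y else (alongQ p q G.twist).symm y).1 = _
  split_ifs <;> rfl

variable [NeZero p] [NeZero q] [NeZero Δ]

/-- A region of defect one that is free of cost and has only corners at `S` is a Scharlemann
cycle. -/
lemma isScharlemannCycle_of_region {S : Set (ZMod q)} {x : ZMod p} {τ : ℤˣ}
    (hS : ∀ m ∈ S, G.signQ m = τ) (hx : G.Clean S x) {z₀ : BdryPoint p q Δ}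
    (hR : G.GQ.defect (G.inner S) (Quotient.mk _ z₀) = 1)
    (hc : ∀ e ∈ G.inner S, G.arc e ∈ G.GQ.regionSet (G.inner S) (Quotient.mk _ z₀) →
      G.cost x τ e = 0)
    (hin : ∀ z ∈ G.GQ.regionSet (G.inner S) (Quotient.mk _ z₀), z.2.1 ∈ S) :
    G.IsScharlemannCycle (Quotient.mk _ z₀) := by
  classical
  set R := Quotient.mk (G.GQ.region (G.inner S)) z₀
  have hnext : ∀ z ∈ G.GQ.regionSet (G.inner S) R,
      G.arc (rotQ G.twist G.signQ z) ∈ G.GQ.regionSet (G.inner S) R := fun z hz =>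
    (regionSet_iff (region_next G.GQ _ z)).1 hz
  have hrot : ∀ z ∈ G.GQ.regionSet (G.inner S) R, rotQ G.twist G.signQ z ∈ G.inner S :=
    fun z hz => ⟨by rw [rotQ_label]; exact hin z hz, hin _ (hnext z hz)⟩
  have hface : ∀ {z}, z ∈ G.GQ.regionSet (G.inner S) R ↔ G.GQ.sameFace z z₀ := by
    intro z
    refine ⟨fun hz => ?_, fun hz => (regionSet_iff (region_of_sameFace hz)).2 rfl⟩
    have h1 : ∀ a b, G.GQ.region (G.inner S) a b → (a ∈ G.GQ.regionSet (G.inner S) R →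
        G.GQ.sameFace a b) := by
      intro a b hab
      induction hab with
      | rel a b h =>
        intro ha
        rcases h with h | ⟨rfl, h⟩
        · exact h
        · exact absurd (hrot a ha) h
      | refl a => exact fun _ => G.GQ.sameFace.refl _
      | symm a b hab ih =>
        exact fun hb => G.GQ.sameFace.symm (ih ((regionSet_iff
          (G := G.GQ) (Y := G.inner S) hab).2 hb))
      | trans a b c hab hbc ih1 ih2 =>
        exact fun ha => G.GQ.sameFace.trans (ih1 ha)
          (ih2 ((regionSet_iff (G := G.GQ) (Y := G.inner S) hab).1 ha))
    exact h1 z z₀ (regionSet_rel hz rfl) hz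
  have hdisk : Face.IsDisk (G := G.GQ) (Quotient.mk G.GQ.sameFace z₀) := by
    unfold defect at hR
    rw [cellCount_eq_zero (s := SameCycle.setoid G.arc) (by
        rintro z ⟨hz, hzR⟩
        apply hz
        have h1 := (regionSet_iff (R := R) (region_arc G.arc_arc G.arc_mem_inner hz)).1 hzR
        exact ⟨hin z hzR, hin _ h1⟩),
      cellCount_eq_zero (s := SameCycle.setoid (rotQ G.twist G.signQ)) (by
        rintro z ⟨hz, hzR⟩
        exact hx.label_notMem hz (hin z hzR))] at hR
    have h1 : cellCount G.GQ.sameFace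
        (fun z => True ∧ Quotient.mk (G.GQ.region (G.inner S)) z = R) ≤ 1 := by
      unfold cellCount
      rw [Finite.card_le_one_iff_subsingleton]
      constructor
      rintro ⟨c, -, h2⟩ ⟨d, -, h3⟩
      have h2' := hface.1 h2
      have h3' := hface.1 h3
      rw [Subtype.mk.injEq, ← Quotient.out_eq c, ← Quotient.out_eq d]
      exact Quotient.sound (G.GQ.sameFace.trans h2' (G.GQ.sameFace.symm h3'))
    have h2 : cellCount (SameCycle.setoid (G.arc * rotQ G.twist G.signQ))
        (fun z => True ∧ Quotient.mk (G.GQ.region (G.inner S)) z = R) ≤ 1 := by omega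
    unfold cellCount at h2
    rw [Finite.card_le_one_iff_subsingleton] at h2
    intro a ha b hb
    have h3 : ∀ z, Quotient.mk G.GQ.sameFace z = Quotient.mk _ z₀ → True ∧
        Quotient.mk (G.GQ.region (G.inner S)) (base (rotQ G.twist G.signQ) G.arc z) = R := by
      intro z hz
      refine ⟨trivial, ?_⟩
      refine hface.2 (G.GQ.sameFace.trans ?_ (Quotient.exact hz))
      exact rel_of_sameCycle G.GQ.boundary (sameCycle_base z)
    exact Quotient.exact (Subtype.mk.inj (Subsingleton.elim (h := h2) ⟨_, h3 a ha⟩ ⟨_, h3 b hb⟩))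
  let σ : Equiv.Perm (BdryPoint p q Δ) := G.arc * rotQ G.twist G.signQ
  have hdown : ∀ z ∈ G.GQ.regionSet (G.inner S) R,
      rank x τ (σ z).1 ≤ rank x τ z.1 := by
    intro z hz
    have h1 := hc _ (hrot z hz) (hnext z hz)
    have h2 := G.rotQ_fst z
    rw [hS _ (hin z hz)] at h2
    change rank x τ (G.arc (rotQ G.twist G.signQ z)).1 ≤ _
    by_cases h3 : (rotQ G.twist G.signQ z).1 = x
    · rw [h3] at h2
      have := rank_of_step x τ h2
      have := rank_lt x τ (G.arc (rotQ G.twist G.signQ z)).1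
      omega
    · have h4 := rank_step x τ h2 h3
      unfold cost at h1
      by_contra h5
      rw [if_neg] at h1
      · exact one_ne_zero h1
      · rintro (h6 | h6)
        · exact h3 h6
        · omega
  have hsum : ∑ z with z ∈ G.GQ.regionSet (G.inner S) R, rank x τ (σ z).1
      = ∑ z with z ∈ G.GQ.regionSet (G.inner S) R, rank x τ z.1 := by
    have hiff : ∀ z, σ z ∈ G.GQ.regionSet (G.inner S) R ↔ z ∈ G.GQ.regionSet (G.inner S) R :=
      fun z => (regionSet_iff (region_next G.GQ _ z)).symm
    rw [Finset.sum_filter, Finset.sum_filter, ← Equiv.sum_comp σ fun z =>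
      if z ∈ G.GQ.regionSet (G.inner S) R then rank x τ z.1 else 0]
    refine Finset.sum_congr rfl fun z _ => ?_
    exact if_congr (hiff z).symm rfl rfl
  have hconst : ∀ z ∈ G.GQ.regionSet (G.inner S) R, (σ z).1 = z.1 := by
    intro z hz
    apply rank_injective x τ
    exact (Finset.sum_eq_sum_iff_of_le fun z hz => hdown z (Finset.mem_filter.1 hz).2).1 hsum z
      (Finset.mem_filter.2 ⟨Finset.mem_univ _, hz⟩)
  have hlabel : ∀ z ∈ G.GQ.regionSet (G.inner S) R, z.1 = z₀.1 := by
    intro z hz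
    let F : BdryPoint p q Δ → ZMod p := fun z =>
      if z ∈ G.GQ.regionSet (G.inner S) R then z.1 else 0
    have h1 : ∀ z, F z = F (σ z) := by
      intro z
      have h2 : z ∈ _ ↔ σ z ∈ _ := regionSet_iff (R := R) (region_next G.GQ (G.inner S) z)
      by_cases h3 : z ∈ G.GQ.regionSet (G.inner S) R
      · simp only [F]
        rw [if_pos h3, if_pos (h2.1 h3), hconst z h3]
      · simp only [F]
        rw [if_neg h3, if_neg fun h => h3 (h2.2 h)]
    have h4 : F z = F z₀ := rel_of_sameCycle (s := Setoid.ker F) h1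
      (hdisk z (Quotient.sound (hface.1 hz)) z₀ rfl)
    simp only [F] at h4
    rwa [if_pos hz, if_pos (show z₀ ∈ G.GQ.regionSet (G.inner S) R from rfl)] at h4
  have hmem : ∀ z ∈ Face.corners (G := G.GQ) (Quotient.mk G.GQ.sameFace z₀),
      z ∈ G.GQ.regionSet (G.inner S) R := fun z hz => hface.2 (Quotient.exact hz)
  refine ⟨hdisk, ⟨τ, fun z hz => hS _ (hin z (hmem z hz))⟩,
    if τ = 1 then z₀.1 else z₀.1 - 1, fun z hz => ?_⟩
  unfold intervalQ
  rw [hS _ (hin z (hmem z hz)), hlabel z (hmem z hz)]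

/-- The labels outside `S` in a region of defect one can be discarded without disconnecting the
other vertices. -/
lemma connectedOff_of_region {S L' : Set (ZMod q)} (hne : S.Nonempty) {x : ZMod p}
    (hx : G.Clean S x) {R : Quotient (G.GQ.region (G.inner S))}
    (hR : G.GQ.defect (G.inner S) R = 1)
    (hL' : ∀ z ∈ G.GQ.regionSet (G.inner S) R, z.2.1 ∉ S → z.2.1 ∈ L')
    (hL'R : ∀ z : BdryPoint p q Δ, z.2.1 ∈ L' → z ∈ G.GQ.regionSet (G.inner S) R)
    (hdisj : Disjoint S L') : G.ConnectedOff L' := by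
  classical
  obtain ⟨z₀, hz₀, hz₀S⟩ := G.exists_mem_regionSet hne R
  let σ : Equiv.Perm (BdryPoint p q Δ) := G.arc * rotQ G.twist G.signQ
  intro x₀ y₀ hx₀ hy₀
  let χ : BdryPoint p q Δ → ZMod 2 := fun z =>
    if G.GQ.region {e | e.2.1 ∈ L'} x₀ z then 1 else 0
  have hχ : ∀ a b, G.GQ.region {e | e.2.1 ∈ L'} a b → χ a = χ b := by
    intro a b hab
    have : G.GQ.region {e | e.2.1 ∈ L'} x₀ a ↔ G.GQ.region {e | e.2.1 ∈ L'} x₀ b :=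
      ⟨fun h => Setoid.trans' _ h hab, fun h => Setoid.trans' _ h (Setoid.symm' _ hab)⟩
    exact if_congr this rfl rfl
  have hχface : ∀ a b, G.GQ.sameFace a b → χ a = χ b := fun a b h => hχ a b (region_of_sameFace h)
  have hχrot : ∀ a : BdryPoint p q Δ, a.2.1 ∉ L' → χ a = χ (rotQ G.twist G.signQ a) := by
    intro a ha
    exact hχ _ _ (region_rot (by rwa [Set.mem_ofPred_eq, rotQ_label]))
  have hSL : ∀ m ∈ S, m ∉ L' := fun m hm => Set.disjoint_left.1 hdisj hm
  let v : BdryPoint p q Δ → ZMod 2 := fun z => if z.2.1 ∈ S then χ z else 0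
  have hvS : ∀ z : BdryPoint p q Δ, z.2.1 ∈ S → v z = χ z := fun z hz => if_pos hz
  have hvrot : ∀ z, v (rotQ G.twist G.signQ z) = v z := by
    intro z
    simp only [v, rotQ_label]
    by_cases hz : z.2.1 ∈ S
    · rw [if_pos hz, if_pos hz, hχrot z (hSL _ hz)]
    · rw [if_neg hz, if_neg hz]
  have hinner : ∀ z, rotQ G.twist G.signQ z ∈ G.inner S → v z = v (σ z) := by
    rintro z ⟨h1, h2⟩
    rw [rotQ_label] at h1
    rw [hvS z h1, hvS (σ z) h2]
    exact hχface _ _ (G.GQ.boundary z)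
  obtain ⟨f, φ, hf, hf0, hφ, hg, hk⟩ := region_exact G.arc_arc G.arc_mem_inner hz₀
    (fun hfree => hx.label_notMem hfree hz₀S) hR (fun z => v z + v (G.arc z)) v
    (fun z _ _ => by rw [G.arc_arc, add_comm]) (by
      intro w hw
      have h1 : ∀ z, (if G.GQ.sameFace z w ∧ rotQ G.twist G.signQ z ∉ G.inner S then
          v (rotQ G.twist G.signQ z) + v (G.arc (rotQ G.twist G.signQ z)) else 0)
          = (if G.GQ.sameFace z w then v z else 0)
            + if G.GQ.sameFace (σ z) w then v (σ z) else 0 := by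
        intro z
        have h2 : G.GQ.sameFace (σ z) w ↔ G.GQ.sameFace z w :=
          ⟨fun h => G.GQ.sameFace.trans (G.GQ.boundary z) h,
            fun h => G.GQ.sameFace.trans (G.GQ.sameFace.symm (G.GQ.boundary z)) h⟩
        by_cases h : G.GQ.sameFace z w
        · rw [if_pos h, if_pos (h2.2 h)]
          by_cases h3 : rotQ G.twist G.signQ z ∈ G.inner S
          · rw [if_neg fun h' => h'.2 h3, hinner z h3]
            exact (zmod2_add_self _).symm
          · rw [if_pos ⟨h, h3⟩, hvrot]
            rfl
        · rw [if_neg h, if_neg fun h' => h h'.1, if_neg fun h' => h (h2.1 h'), add_zero]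
      rw [Finset.sum_congr rfl fun z _ => h1 z, Finset.sum_add_distrib,
        Equiv.sum_comp σ fun z => if G.GQ.sameFace z w then v z else 0, zmod2_add_self])
  have hadd : ∀ a b c d : ZMod 2, a + b = c + d → a + c = b + d := by decide
  let F : BdryPoint p q Δ → ZMod 2 := fun z => f z + v z
  have hFrot : ∀ z, F (rotQ G.twist G.signQ z) = F z := fun z => by
    simp only [F]
    rw [hvrot, hf z (rotQ G.twist G.signQ z) ⟨1, by simp⟩]
  have hFS : ∀ z : BdryPoint p q Δ, z.2.1 ∈ S → F z = χ z := by
    intro z hz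
    simp only [F]
    rw [hvS z hz, hf0 z fun hfree => hx.label_notMem hfree hz, zero_add]
  have hFnext : ∀ z ∈ G.GQ.regionSet (G.inner S) R, F z = F (σ z) := by
    intro z hz
    by_cases h3 : rotQ G.twist G.signQ z ∈ G.inner S
    · rw [hFS z (by rw [← rotQ_label G.twist G.signQ]; exact h3.1), hFS (σ z) h3.2]
      exact hχface _ _ (G.GQ.boundary z)
    · rw [← hFrot z]
      exact hadd _ _ _ _ (hg _ ((regionSet_iff (region_rot h3)).1 hz) h3)
  have hext : ∀ s : Setoid (BdryPoint p q Δ),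
      (∀ a b, s a b → (a ∈ G.GQ.regionSet (G.inner S) R ↔ b ∈ G.GQ.regionSet (G.inner S) R)) →
      ∀ H : BdryPoint p q Δ → ZMod 2,
      (∀ a b, s a b → a ∈ G.GQ.regionSet (G.inner S) R → H a = H b) →
      s ≤ Setoid.ker fun z => if z ∈ G.GQ.regionSet (G.inner S) R then H z else 0 := by
    intro s h1 H h2 a b hab
    change (if _ then _ else _) = (if _ then _ else _)
    by_cases ha : a ∈ G.GQ.regionSet (G.inner S) R
    · rw [if_pos ha, if_pos ((h1 a b hab).1 ha), h2 a b hab ha]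
    · rw [if_neg ha, if_neg fun hb => ha ((h1 a b hab).2 hb)]
  let F₀ : BdryPoint p q Δ → ZMod 2 := fun z =>
    if z ∈ G.GQ.regionSet (G.inner S) R then F z else 0
  have hF₀ : ∀ z ∈ G.GQ.regionSet (G.inner S) R, F₀ z = F z := fun z hz => if_pos hz
  have hstep : ∀ z, F₀ z = F₀ (σ z) := by
    intro z
    have h2 : z ∈ _ ↔ σ z ∈ _ := regionSet_iff (R := R) (region_next G.GQ (G.inner S) z)
    by_cases h3 : z ∈ G.GQ.regionSet (G.inner S) R
    · rw [hF₀ z h3, hF₀ _ (h2.1 h3), hFnext z h3]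
    · simp only [F₀]
      rw [if_neg h3, if_neg fun h => h3 (h2.2 h)]
  have hbase : ∀ z ∈ G.GQ.regionSet (G.inner S) R,
      F (base (rotQ G.twist G.signQ) G.arc z) = F z := by
    intro z hz
    have h1 := rel_of_sameCycle (s := Setoid.ker F₀) hstep
      (sameCycle_base (rot := rotQ G.twist G.signQ) (arc := G.arc) z)
    have h2 : base (rotQ G.twist G.signQ) G.arc z ∈ G.GQ.regionSet (G.inner S) R :=
      (regionSet_iff (rel_of_sameCycle (region_next G.GQ _) (sameCycle_base z))).2 hz
    rw [← hF₀ z hz, ← hF₀ _ h2]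
    exact h1
  have hFφ : ∀ z ∈ G.GQ.regionSet (G.inner S) R, φ z = F z := by
    intro z hz
    rw [← hbase z hz]
    have h1 := hadd _ _ 0 _ ((hk z hz).trans (zero_add _).symm)
    rwa [add_zero] at h1
  have hconst : ∀ z ∈ G.GQ.regionSet (G.inner S) R, F z = F z₀ := by
    intro z hz
    rw [← hF₀ z hz, ← hF₀ z₀ hz₀]
    refine region_le (s := Setoid.ker F₀) ?_ ?_ (regionSet_rel hz hz₀)
    · refine hext G.GQ.sameFace (fun a b h => regionSet_iff (region_of_sameFace h)) F ?_
      intro a b h ha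
      rw [← hFφ a ha, ← hFφ b ((regionSet_iff (region_of_sameFace h)).1 ha), hφ a b h]
    · intro a ha
      have h1 := regionSet_iff (R := R) (region_rot ha)
      change F₀ a = F₀ _
      by_cases h3 : a ∈ G.GQ.regionSet (G.inner S) R
      · rw [hF₀ a h3, hF₀ _ (h1.1 h3), hFrot]
      · simp only [F₀]
        rw [if_neg h3, if_neg fun h => h3 (h1.2 h)]
  let H : BdryPoint p q Δ → ZMod 2 := fun z =>
    if z ∈ G.GQ.regionSet (G.inner S) R then F z₀ else χ z
  have hHχ : ∀ z : BdryPoint p q Δ, z.2.1 ∉ L' → H z = χ z := by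
    intro z hz
    by_cases h : z ∈ G.GQ.regionSet (G.inner S) R
    · have hzS : z.2.1 ∈ S := by
        by_contra hzS
        exact hz (hL' z h hzS)
      simp only [H]
      rw [if_pos h, ← hconst z h, hFS z hzS]
    · exact if_neg h
  have hHin : ∀ z ∈ G.GQ.regionSet (G.inner S) R, H z = F z₀ := fun z hz => if_pos hz
  have hHface : ∀ a b, G.GQ.sameFace a b → H a = H b := by
    intro a b h
    have h1 := regionSet_iff (R := R) (region_of_sameFace (Y := G.inner S) h)
    by_cases ha : a ∈ G.GQ.regionSet (G.inner S) R
    · rw [hHin a ha, hHin b (h1.1 ha)]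
    · simp only [H]
      rw [if_neg ha, if_neg fun hb => ha (h1.2 hb), hχface a b h]
  have hHrot : ∀ a, H a = H (rotQ G.twist G.signQ a) := by
    intro a
    by_cases ha : a.2.1 ∈ L'
    · rw [hHin a (hL'R a ha), hHin _ (hL'R _ (by rwa [rotQ_label]))]
    · rw [hHχ a ha, hHχ _ (by rwa [rotQ_label]), hχrot a ha]
  have hle : G.GQ.sameFace ⊔ SameCycle.setoid (rotQ G.twist G.signQ) ⊔ SameCycle.setoid G.arc
      ≤ Setoid.ker H := by
    refine sup_le (sup_le (fun {a b} h => hHface a b h) fun {a b} h =>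
      rel_of_sameCycle (s := Setoid.ker H) hHrot h) fun {a b} h =>
      rel_of_sameCycle (s := Setoid.ker H) (fun a => ?_) h
    have h1 := G.GQ.boundary ((rotQ G.twist G.signQ)⁻¹ a)
    have h2 := hHrot ((rotQ G.twist G.signQ)⁻¹ a)
    have h3 : rotQ G.twist G.signQ ((rotQ G.twist G.signQ)⁻¹ a) = a := by simp
    rw [h3] at h1 h2
    exact h2.symm.trans (hHface _ _ h1)
  rw [G.GQ.connected] at hle
  have h1 : H x₀ = H y₀ := hle trivial
  rw [hHχ x₀ hx₀, hHχ y₀ hy₀] at h1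
  have h2 : χ x₀ = 1 := if_pos (Setoid.refl' _ _)
  by_contra hno
  have h3 : χ y₀ = 0 := if_neg hno
  rw [h2, h3] at h1
  exact one_ne_zero h1

/-- If `G_Q` contains no Scharlemann cycle, then a good set of vertices cuts off a set of vertices
whose edges lead only to itself and to the good set. -/
lemma Good.exists_cut_off {G : IntersectionPair p q Δ} (hno : ¬ ∃ D, G.IsScharlemannCycle D)
    {L S : Set (ZMod q)} (hL : G.ConnectedOff L) (hSL : S ⊆ L) (hS : G.Good S) :
    ∃ L' ⊆ L, L'.Nonempty ∧ Disjoint S L' ∧ G.ConnectedOff L' ∧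
      (∀ e : BdryPoint p q Δ, e.2.1 ∈ L' → (G.arc e).2.1 ∈ L' ∪ S) ∧
      (G.leaving L').card + 2 ≤ p := by
  classical
  obtain ⟨hne, ⟨τ, hτ⟩, hcard⟩ := hS
  obtain ⟨x, hx⟩ := G.exists_clean (S := S) (by omega)
  obtain ⟨R₁, R₂, hR, hcost⟩ := G.exists_two_regions hne hτ hx
  have hout : ∀ R, R = R₁ ∨ R = R₂ →
      ∃ z ∈ G.GQ.regionSet (G.inner S) R, z.2.1 ∉ S := by
    intro R hR
    by_contra! hin
    obtain ⟨z₀, rfl⟩ := Quotient.exists_rep R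
    exact hno ⟨_, G.isScharlemannCycle_of_region hτ hx (hcost _ hR).1 (hcost _ hR).2 hin⟩
  have hsub : G.inner S ⊆ {e | e.2.1 ∈ L} := fun e he => hSL he.1
  obtain ⟨R, hR12, hRL⟩ : ∃ R, (R = R₁ ∨ R = R₂) ∧
      ∀ z ∈ G.GQ.regionSet (G.inner S) R, z.2.1 ∈ L := by
    by_contra! hall
    obtain ⟨z₁, h1, h1'⟩ := hall R₁ (Or.inl rfl)
    obtain ⟨z₂, h2, h2'⟩ := hall R₂ (Or.inr rfl)
    have h3 : Quotient.mk (G.GQ.region (G.inner S)) z₁ = Quotient.mk _ z₂ :=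
      Quotient.sound (region_mono hsub (hL z₁ z₂ h1' h2'))
    exact hR (Eq.trans (Eq.symm h1) (h3.trans h2))
  obtain ⟨z₁, hz₁, hz₁S⟩ := hout R hR12
  let L' : Set (ZMod q) := {m | m ∉ S ∧ ∃ z ∈ G.GQ.regionSet (G.inner S) R, z.2.1 = m}
  have hL'R : ∀ z : BdryPoint p q Δ, z.2.1 ∈ L' → z ∈ G.GQ.regionSet (G.inner S) R := by
    rintro z ⟨h1, w, hw, hwz⟩
    refine (regionSet_iff (region_rot_of_free (sameCycle_rotQ _ _ hwz) ?_)).1 hw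
    exact G.free_of_label (by rwa [hwz])
  have hclosed : ∀ e : BdryPoint p q Δ, e.2.1 ∈ L' → (G.arc e).2.1 ∈ L' ∪ S := by
    intro e he
    by_cases h : (G.arc e).2.1 ∈ S
    · exact Or.inr h
    · refine Or.inl ⟨h, _, ?_, rfl⟩
      exact (regionSet_iff (region_arc G.arc_arc G.arc_mem_inner fun h' => he.1 h'.1)).1 (hL'R e he)
  have hdisj : Disjoint S L' := Set.disjoint_left.2 fun m hm hm' => hm'.1 hm
  refine ⟨L', ?_, ⟨z₁.2.1, hz₁S, z₁, hz₁, rfl⟩, hdisj, ?_, hclosed, ?_⟩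
  · rintro m ⟨-, z, hz, rfl⟩
    exact hRL z hz
  · exact G.connectedOff_of_region hne hx (hcost R hR12).1 (fun z hz hzS => ⟨hzS, z, hz, rfl⟩)
      hL'R hdisj
  · have hle : (G.leaving L').card ≤ (G.leaving S).card := by
      refine Finset.card_le_card_of_injOn G.arc ?_ G.arc.injective.injOn
      intro e he
      have he := G.mem_leaving.1 (Finset.mem_coe.1 he)
      refine Finset.mem_coe.2 (G.mem_leaving.2 ⟨(hclosed e he.1).resolve_left he.2, ?_⟩)
      rw [G.arc_arc]
      exact he.1.1
    omega

end IntersectionPair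

end DehnGraphs

namespace DehnGraphs

variable {p q Δ : ℕ}

namespace IntersectionPair

variable {G : IntersectionPair p q Δ} [NeZero p] [NeZero q] [NeZero Δ]

/-- If a constant type is unrepresented, then a set of vertices which is left only by edges
between vertices of opposite signs is left by few edges. -/
lemma Unrepresented.card_leaving_le_of_negative {L S : Set (ZMod q)} {T : ZMod q → ℤˣ}
    (h : G.Unrepresented L T) (hL : L.Nonempty) {c : ℤˣ} (hT : ∀ j, T j = c) (hSL : S ⊆ L)
    (hneg : ∀ e ∈ G.leaving S, G.signQ e.2.1 ≠ G.signQ (G.arc e).2.1) :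
    (G.leaving S).card + 2 ≤ p := by
  classical
  have h1 := h.card_negative_le hL hT
  have h2 : (G.leaving S ∪ (G.leaving S).image G.arc).card
      ≤ (Finset.univ.filter fun e => e ∈ G.touch L ∧
        G.signQ e.2.1 ≠ G.signQ (G.arc e).2.1).card := by
    refine Finset.card_le_card fun e he => ?_
    rw [Finset.mem_union, Finset.mem_image] at he
    rw [Finset.mem_filter]
    refine ⟨Finset.mem_univ _, ?_⟩
    rcases he with he | ⟨f, hf, rfl⟩
    · exact ⟨Or.inl (hSL (G.mem_leaving.1 he).1), hneg e he⟩
    · refine ⟨G.arc_mem_touch (Or.inl (hSL (G.mem_leaving.1 hf).1)), ?_⟩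
      rw [G.arc_arc]
      exact (hneg f hf).symm
  rw [Finset.card_union_of_disjoint, Finset.card_image_of_injective _ G.arc.injective] at h2
  · omega
  · rw [Finset.disjoint_left]
    rintro e he he'
    obtain ⟨f, hf, rfl⟩ := Finset.mem_image.1 he'
    exact (G.mem_leaving.1 hf).2 (G.mem_leaving.1 he).1

/-- The edges that leave `L` end at vertices of one sign, and there are few of them. -/
def FewLeaving (G : IntersectionPair p q Δ) (L : Set (ZMod q)) : Prop :=
  (∃ τ, ∀ e ∈ G.leaving L, G.signQ (G.arc e).2.1 = τ) ∧ (G.leaving L).card + 2 ≤ p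

lemma Unrepresented.exists_good_of_const {L : Set (ZMod q)} {T : ZMod q → ℤˣ}
    (h : G.Unrepresented L T) (hL : L.Nonempty) {c : ℤˣ} (hT : ∀ j, T j = c)
    (hfew : L = Set.univ ∨ G.FewLeaving L) :
    ∃ S ⊆ L, G.Good S ∧ ∃ σ, ∀ m ∈ L, m ∉ S → G.signQ m = σ := by
  have key : ∀ τ, (∃ l ∈ L, G.signQ l ≠ τ) →
      (∀ e ∈ G.leaving L, G.signQ (G.arc e).2.1 = τ) →
      ∃ S ⊆ L, G.Good S ∧ ∃ σ, ∀ m ∈ L, m ∉ S → G.signQ m = σ := by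
    rintro τ ⟨l, hl, hlτ⟩ hτ
    refine ⟨{m | m ∈ L ∧ G.signQ m ≠ τ}, fun m hm => hm.1, ⟨⟨l, hl, hlτ⟩,
      ⟨-τ, fun m hm => units_ne_iff.1 hm.2⟩, ?_⟩, τ, fun m hm hmS => ?_⟩
    · refine h.card_leaving_le_of_negative hL hT (fun m hm => hm.1) fun e he => ?_
      obtain ⟨h1, h2⟩ := G.mem_leaving.1 he
      have h3 : G.signQ (G.arc e).2.1 = τ := by
        by_contra h4
        exact h4 (hτ e (G.mem_leaving.2 ⟨h1.1, fun h5 => h2 ⟨h5, h4⟩⟩))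
      rw [h3]
      exact h1.2
    · by_contra h4
      exact hmS ⟨hm, h4⟩
  rcases hfew with rfl | ⟨⟨τ, hτ⟩, hcard⟩
  · refine key (-G.signQ 0) ⟨0, trivial, ?_⟩ fun e he => ?_
    · exact (by decide : ∀ a : ℤˣ, a ≠ -a) _
    · exact absurd trivial (G.mem_leaving.1 he).2
  · by_cases hex : ∃ l ∈ L, G.signQ l ≠ τ
    · exact key τ hex hτ
    · push Not at hex
      exact ⟨L, subset_rfl, ⟨hL, ⟨τ, hex⟩, hcard⟩, τ, fun m hm hm' => absurd hm hm'⟩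

lemma not_unrepresented (hno : ¬ ∃ D, G.IsScharlemannCycle D) (n : ℕ) :
    ∀ {L : Set (ZMod q)} {T : ZMod q → ℤˣ}, L.ncard ≤ n → L.Nonempty → G.ConnectedOff L →
      L = Set.univ ∨ G.FewLeaving L → ¬ G.Unrepresented L T := by
  induction n with
  | zero =>
    intro L T hn hL
    rw [Nat.le_zero, Set.ncard_eq_zero] at hn
    exact absurd hn hL.ne_empty
  | succ n ih =>
    intro L T hn hL hconn hfew h
    by_cases hconst : ∃ c, ∀ j, T j = c
    · obtain ⟨c, hc⟩ := hconst
      obtain ⟨S, hSL, hS, σ, hσ⟩ := h.exists_good_of_const hL hc hfew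
      obtain ⟨L', hL'L, hL'ne, hdisj, hconn', hcl, hcard⟩ := hS.exists_cut_off hno hconn hSL
      have hL' : G.Good L' := ⟨hL'ne, ⟨σ, fun m hm => hσ m (hL'L hm) fun hmS =>
        Set.disjoint_left.1 hdisj hmS hm⟩, hcard⟩
      obtain ⟨L'', hsub, ⟨m, hm⟩, hdisj', -⟩ := hL'.exists_cut_off hno hconn' subset_rfl
      exact Set.disjoint_left.1 hdisj' (hsub hm) hm
    · have h1 : ∃ i, T i = 1 := by
        by_contra! h1
        exact hconst ⟨-1, fun j => units_ne_iff.1 (h1 j)⟩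
      have h2 : ∃ i, T i = -1 := by
        by_contra! h2
        exact hconst ⟨1, fun j => by rw [units_ne_iff.1 (h2 j), neg_neg]⟩
      obtain ⟨ν, S, hSL, hS, -, hdesc⟩ := G.exists_descends L.ncard le_rfl h h1 h2
      obtain ⟨L', hL'L, hL'ne, hdisj, hconn', hcl, hcard⟩ := hS.exists_cut_off hno hconn hSL
      have hν : G.Unrepresented L (ν • T) := by
        rcases Int.units_eq_one_or ν with rfl | rfl
        · rwa [one_smul]
        · rw [show (-1 : ℤˣ) • T = -T by ext; simp]
          exact h.neg
      obtain ⟨M₁, T₁, h₁, hLM, hST, σ, hσ⟩ := hdesc L' hdisj hcl L (ν • T) hν hL'L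
        (fun _ _ => ⟨rfl, rfl⟩) (Persists.refl _ _)
      obtain ⟨τ, hτ⟩ := hS.sign
      obtain ⟨s, hs⟩ := hS.nonempty
      have hlt : L'.ncard < L.ncard := Set.ncard_lt_ncard
        ⟨hL'L, fun hle => Set.disjoint_left.1 hdisj hs (hle (hSL hs))⟩
      refine ih (by omega) hL'ne hconn' (Or.inr ⟨⟨τ, fun e he => ?_⟩, hcard⟩)
        (h₁.of_marked hLM hL'ne hcl hdisj hST hτ hσ)
      obtain ⟨he1, he2⟩ := G.mem_leaving.1 he
      exact hτ _ ((hcl e he1).resolve_left he2)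

end IntersectionPair

end DehnGraphs

/-- For a pair of intersection graphs in 2-spheres with `Δ ≥ 1`, either `G_P` represents all types,
or `G_Q` contains a Scharlemann cycle. -/
theorem theorem6p3 (p q Δ : ℕ) (hp : 1 ≤ p) (hq : 1 ≤ q) (hΔ : 1 ≤ Δ)
    (G : DehnGraphs.IntersectionPair p q Δ) :
    G.RepresentsAllTypes ∨ ∃ D : G.GQ.Face, G.IsScharlemannCycle D := by
  have : NeZero p := ⟨by omega⟩
  have : NeZero q := ⟨by omega⟩
  have : NeZero Δ := ⟨by omega⟩
  by_contra! hcon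
  obtain ⟨hrep, hno⟩ := hcon
  refine hrep ⟨{D | D.IsDisk}, fun D hD => hD, fun τ => ?_⟩
  by_contra! hτ
  exact DehnGraphs.IntersectionPair.not_unrepresented (not_exists.2 hno) _ le_rfl
    Set.univ_nonempty (fun x _ hx _ => absurd (Set.mem_univ _) hx) (Or.inl rfl)
    (G.unrepresented_univ hτ)
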